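/- **Theorem 3.** Fix $T>0$ and $s>\frac32$. There exists $\varepsilon_0>0$ (depending only on $T$ and $s$) such that the following holds. Let $c\in\mathbb R$ and let $u,v:\mathbb R\times[-1,1]\to\mathbb R$ be $T$-periodic in $x$, continuous on $\mathbb R\times[-1,1]$ and $C^1$ in $\mathbb R\times(-1,1)$, such that the travelling velocity field $\big(u(x-ct,y),\,v(x-ct,y)\big)$ solves, with some pressure $P(t,x,y)$, the incompressible Euler equations in the channel $-1<y<1$, $$\partial_t u+u\,\partial_x u+v\,\partial_y u=-\partial_x P,\qquad \partial_t v+u\,\partial_x v+v\,\partial_y v=-\partial_y P,\qquad \partial_x u+\partial_y v=0,$$ with the boundary condition $v=0$ on $\{y=-1\}$ and $\{y=1\}$. If the vorticity $\omega=\partial_y u-\partial_x v$ satisfies $$\|\omega-1\|_{H^s((0,T)\times(-1,1))}<\varepsilon_0,$$ where $\|f\|_{H^s(\Omega)}$ is the infimum of $\|F\|_{H^s(\mathbb R^2)}=\big(\int_{\mathbb R^2}(1+|\xi|^2)^s|\hat F(\xi)|^2\,d\xi\big)^{1/2}$, $\hat F(\xi)=\int_{\mathbb R^2}F(z)e^{-2\pi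 i z\cdot\xi}\,dz$, over all extensions $F\in H^s(\mathbb R^2)$ of $f$, then $v(x,y)\equiv 0$ on $\mathbb R\times[-1,1]$; that is, $(u,v)=(U(y),0)$ is a shear flow. -/

import Mathlib

open MeasureTheory Set
open scoped ENNReal FourierTransform

noncomputable section

namespace ChannelEuler

/-- The plane, with its Euclidean norm. -/
abbrev Plane : Type := EuclideanSpace ℝ (Fin 2)

/-- The `H^s(ℝ²)` norm of an `L²` function, `s ≥ 0`, on the Fourier side:
`(∫ (1 + |ξ|²)^s |𝓕 F(ξ)|² dξ)^{1/2}`, with value `∞` when `F` is not in `H^s`.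
(The weight is the square of the Bessel potential symbol in Mathlib's convention.) -/
def sobolevNorm (s : ℝ) (F : Lp ℂ 2 (volume : Measure Plane)) : ℝ≥0∞ :=
  (∫⁻ ξ : Plane, ENNReal.ofReal ((1 + ‖ξ‖ ^ 2) ^ s) * ‖(𝓕 F : Lp ℂ 2 (volume : Measure Plane)) ξ‖ₑ ^ 2)
    ^ (1 / 2 : ℝ)

/-- The `H^s(Ω)` norm, `s ≥ 0`, of a real function on `Ω ⊆ ℝ²`: the infimum of the `H^s(ℝ²)`
norms of all extensions of `f` from `Ω` to the plane (`∞` when there is none in `H^s(ℝ²)`). -/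
def sobolevNormOn (s : ℝ) (Ω : Set Plane) (f : ℝ → ℝ → ℝ) : ℝ≥0∞ :=
  ⨅ (F : Lp ℂ 2 (volume : Measure Plane))
    (_ : ∀ᵐ p ∂(volume.restrict Ω), F p = ((f (p 0) (p 1) : ℝ) : ℂ)), sobolevNorm s F

/-- One period cell `(0,T) × (-1,1)` of the channel. -/
def cell (T : ℝ) : Set Plane := {p | p 0 ∈ Ioo 0 T ∧ p 1 ∈ Ioo (-1) 1}

/-- The vorticity `ω = ∂_y u - ∂_x v`. -/
def vorticity (u v : ℝ → ℝ → ℝ) (x y : ℝ) : ℝ :=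
  deriv (fun y' => u x y') y - deriv (fun x' => v x' y) x

/-- `(u, v)(t, x, y)` with pressure `P(t, x, y)` is a (classical) solution of the incompressible
Euler equations in the channel `-1 ≤ y ≤ 1` with impermeable walls. Only the values on the channel
matter. The velocity is continuous up to the walls and `C¹` inside. -/
structure IsEulerSolution (u v P : ℝ → ℝ → ℝ → ℝ) : Prop where
  continuous_u : ContinuousOn (fun p : ℝ × ℝ × ℝ => u p.1 p.2.1 p.2.2)
    {p | p.2.2 ∈ Icc (-1) 1}
  continuous_v : ContinuousOn (fun p : ℝ × ℝ × ℝ => v p.1 p.2.1 p.2.2)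
    {p | p.2.2 ∈ Icc (-1) 1}
  contDiff_u : ContDiffOn ℝ 1 (fun p : ℝ × ℝ × ℝ => u p.1 p.2.1 p.2.2)
    {p | p.2.2 ∈ Ioo (-1) 1}
  contDiff_v : ContDiffOn ℝ 1 (fun p : ℝ × ℝ × ℝ => v p.1 p.2.1 p.2.2)
    {p | p.2.2 ∈ Ioo (-1) 1}
  differentiable_P : ∀ t : ℝ, DifferentiableOn ℝ (fun p : ℝ × ℝ => P t p.1 p.2)
    {p | p.2 ∈ Ioo (-1) 1}
  momentum_x : ∀ t x : ℝ, ∀ y ∈ Ioo (-1 : ℝ) 1,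
    deriv (fun t' => u t' x y) t + u t x y * deriv (fun x' => u t x' y) x
      + v t x y * deriv (fun y' => u t x y') y = -deriv (fun x' => P t x' y) x
  momentum_y : ∀ t x : ℝ, ∀ y ∈ Ioo (-1 : ℝ) 1,
    deriv (fun t' => v t' x y) t + u t x y * deriv (fun x' => v t x' y) x
      + v t x y * deriv (fun y' => v t x y') y = -deriv (fun y' => P t x y') y
  incompressible : ∀ t x : ℝ, ∀ y ∈ Ioo (-1 : ℝ) 1,
    deriv (fun x' => u t x' y) x + deriv (fun y' => v t x y') y = 0
  wall_bot : ∀ t x : ℝ, v t x (-1) = 0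
  wall_top : ∀ t x : ℝ, v t x 1 = 0

/-- The velocity `(u(x - ct, y), v(x - ct, y))` solves the Euler equations in the channel, for some
pressure. -/
def IsTravellingSolution (c : ℝ) (u v : ℝ → ℝ → ℝ) : Prop :=
  ∃ P : ℝ → ℝ → ℝ → ℝ,
    IsEulerSolution (fun t x y => u (x - c * t) y) (fun t x y => v (x - c * t) y) P

/-- `f` has period `T` in `x` on the channel (`T` need not be the minimal period). -/
def HasXPeriod (T : ℝ) (f : ℝ → ℝ → ℝ) : Prop :=
  ∀ x : ℝ, ∀ y ∈ Icc (-1 : ℝ) 1, f (x + T) y = f x y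

end ChannelEuler

end

noncomputable section

namespace ChannelEuler

/-! ### The inverse Fourier transform on `L¹ ∩ L²` -/

section FourierL2

variable {E : Type*} [NormedAddCommGroup E] [InnerProductSpace ℝ E] [FiniteDimensional ℝ E]
  [MeasurableSpace E] [BorelSpace E]

/-! Write `ω = 1 + f` on a period cell. The proof is a contraction argument: the Hölder seminorm of
`v` in `y` bounds itself, through the vorticity, with a factor proportional to the size `E` of `f`.

From vorticity to velocity. On vertical sections let `a`, `b`, `w` be the coefficients of `u` on a
cosine mode and of `v`, `ω` on the sine mode of the same frequency `λ`. Incompressibility and the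
definition of `ω` become `a' = -λ b`, `b' = -λ a - w`, whose `T`-periodic solution is an exponential
average of differences of `w`. If every `w` is `1/2`-Hölder in `x` with constant `N`, then `|b| ≲ N
λ^(-11/8)`, and summing the sine series makes `v` Hölder of order `α` in `y` with constant `C N`
(`PeriodicFlow.exists_holder_v`). Second differences of `ω`, combined over all modes by Bessel's
inequality, bound `∂_x v` by a multiple of `E` (`PeriodicFlow.exists_lipschitz_v`), so `∂_y u = ω +
∂_x v` is close to `1`.

From velocity to vorticity. In the moving frame the vorticity is transported: `(u - c) f_x + v f_y =
0` almost everywhere (`RegularVorticity.ae_vorticity_equation`). Since `∂_y u ≥ 1/2`, the factor `u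
- c` has at most one zero `y₀` on a section, and it is simple. As `f_x` is integrable on almost
every section and `1/(y - y₀)` is not, `v f_y` must vanish at an interior zero; if there is none,
the wall nearest to a zero plays its role, because `v = 0` there. Hence `f_x = -v f_y/(u - c)` is
only as singular as `|y - y₀|^(α - 1)`, and `∫ |f_x| dy ≲ M A(x)`, where `M` is the Hölder constant
of `v` and `A(x)` the `C^{1,α}` constant of `f` on the section (`integral_abs_section_le`). The `L²`
norm of `A` is at most `E`, so integrating in `x` gives a `1/2`-Hölder bound for `w` with constant
`C M E` (`RegularVorticity.coeffHolder_of_holder`).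

For small `E` one round trip halves `M`. A finite starting value exists without any smallness, so
`v(x, ·)` is constant, and the wall makes it `0`.

The condition `s > 3/2` provides the functions `A` and `B` (`exists_regular_representative`):
Plancherel in one frequency and Cauchy-Schwarz in the other, with `1 + α` moments, require `1 + α -
s < -1/2`. -/

theorem integral_fourierInv_mul_eq (f g : E → ℂ) (hf : Integrable f) (hg : Integrable g) :
    ∫ x, 𝓕⁻ f x * g x = ∫ x, f x * 𝓕⁻ g x := by
  have h := VectorFourier.integral_fourierIntegral_smul_eq_flip (μ := (volume : Measure E))
    (ν := (volume : Measure E)) (e := Real.fourierChar) (L := -innerₗ E) (f := f) (g := g)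
    Real.continuous_fourierChar (continuous_inner (𝕜 := ℝ)).neg hf hg
  have hL : (-innerₗ E).flip = -innerₗ E := by
    ext x y
    simp [real_inner_comm]
  rw [hL] at h
  exact h

theorem continuous_fourierInv {f : E → ℂ} (hf : Integrable f) : Continuous (𝓕⁻ f) := by
  have := VectorFourier.fourierIntegral_continuous (μ := (volume : Measure E))
    (e := Real.fourierChar) (L := -innerₗ E) Real.continuous_fourierChar (continuous_inner (𝕜 := ℝ)).neg hf
  exact this

/-- On `L¹ ∩ L²` the `L²` inverse Fourier transform is given by the integral. -/
theorem coeFn_fourierInv_ae_eq (φ : Lp ℂ 2 (volume : Measure E))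
    (hφ : Integrable (fun x => φ x)) :
    ((𝓕⁻ φ : Lp ℂ 2 (volume : Measure E)) : E → ℂ) =ᵐ[volume] 𝓕⁻ (fun x => φ x) := by
  have hloc : LocallyIntegrable
      (fun x => (𝓕⁻ φ : Lp ℂ 2 (volume : Measure E)) x - 𝓕⁻ (fun x => φ x) x) := by
    apply LocallyIntegrable.sub
    · exact (Lp.memLp (𝓕⁻ φ : Lp ℂ 2 (volume : Measure E))).locallyIntegrable (by norm_num)
    · exact (continuous_fourierInv hφ).locallyIntegrable
  -- Both sides are locally integrable, so pairing with real test functions decides. The transform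
  -- passes to the test function by the distributional definition, and back by Fubini because `φ` is
  -- integrable.
  have key := ae_eq_zero_of_integral_contDiff_smul_eq_zero hloc ?_
  · filter_upwards [key] with x hx
    exact sub_eq_zero.1 hx
  intro g hg hgc
  have hgC : ContDiff ℝ (⊤ : ℕ∞) (fun x => (g x : ℂ)) :=
    Complex.ofRealCLM.contDiff.comp hg
  have hgCc : HasCompactSupport (fun x => (g x : ℂ)) :=
    hgc.comp_left (g := fun r : ℝ => (r : ℂ)) (by simp)
  let G : SchwartzMap E ℂ := hgCc.toSchwartzMap hgC
  have hG : ∀ x, G x = (g x : ℂ) := fun x => rfl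
  have h1 := congrArg (fun D => D G) (Lp.fourierInv_toTemperedDistribution_eq φ)
  simp only [TemperedDistribution.fourierInv_apply, Lp.toTemperedDistribution_apply,
    SchwartzMap.fourierInv_coe, smul_eq_mul] at h1
  rw [integral_fourierInv_mul_eq _ _ G.integrable hφ] at h1
  have i1 : Integrable (fun x => G x * (𝓕⁻ φ : Lp ℂ 2 (volume : Measure E)) x) := by
    have := (G.memLp 2 volume).integrable_mul (Lp.memLp (𝓕⁻ φ : Lp ℂ 2 (volume : Measure E)))
    exact this
  have i2 : Integrable (fun x => G x * 𝓕⁻ (fun x => φ x) x) := by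
    have : Continuous (fun x => G x * 𝓕⁻ (fun x => φ x) x) :=
      G.continuous.mul (continuous_fourierInv hφ)
    exact this.integrable_of_hasCompactSupport hgCc.mul_right
  have h2 : ∀ x, g x • ((𝓕⁻ φ : Lp ℂ 2 (volume : Measure E)) x - 𝓕⁻ (fun x => φ x) x)
      = G x * (𝓕⁻ φ : Lp ℂ 2 (volume : Measure E)) x - G x * 𝓕⁻ (fun x => φ x) x := by
    intro x
    rw [hG, Complex.real_smul, mul_sub]
  simp_rw [h2]
  rw [integral_sub i1 i2, h1, sub_self]

/-- Plancherel's identity for functions in `L¹ ∩ L²`. -/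
theorem lintegral_enorm_fourierInv_sq {g : E → ℂ} (h1 : Integrable g) (h2 : MemLp g 2) :
    ∫⁻ x, ‖𝓕⁻ g x‖ₑ ^ 2 = ∫⁻ x, ‖g x‖ₑ ^ 2 := by
  have hae : (fun x => (h2.toLp g) x) =ᵐ[volume] g := h2.coeFn_toLp
  have hint : Integrable (fun x => (h2.toLp g) x) := h1.congr hae.symm
  have hk := coeFn_fourierInv_ae_eq (h2.toLp g) hint
  have hn : ‖(𝓕⁻ (h2.toLp g) : Lp ℂ 2 (volume : Measure E))‖ₑ = ‖h2.toLp g‖ₑ := by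
    rw [enorm_eq_iff_norm_eq]
    rw [← Lp.norm_fourier_eq (𝓕⁻ (h2.toLp g)), FourierTransform.fourier_fourierInv_eq]
  have e : ∀ f : Lp ℂ 2 (volume : Measure E), ‖f‖ₑ ^ 2 = ∫⁻ x, ‖f x‖ₑ ^ 2 := by
    intro f
    rw [Lp.enorm_def, eLpNorm_eq_lintegral_rpow_enorm_toReal (by norm_num) (by norm_num)]
    simp only [ENNReal.toReal_ofNat, ENNReal.rpow_ofNat]
    rw [← ENNReal.rpow_natCast, ← ENNReal.rpow_mul]
    simp
  have := congrArg (fun t => t ^ 2) hn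
  simp only [e] at this
  have e2 : ∫⁻ x, ‖h2.toLp g x‖ₑ ^ 2 = ∫⁻ x, ‖g x‖ₑ ^ 2 :=
    lintegral_congr_ae (hae.mono fun x hx => by simp only at hx ⊢; rw [hx])
  rw [← e2, ← this]
  apply lintegral_congr_ae
  filter_upwards [hk] with x hx
  rw [hx, Real.fourierInv_congr_ae hae x]

end FourierL2

/-! ### Weighted Cauchy-Schwarz and one-dimensional `C^{1,α}` regularity from Fourier moments -/

theorem lintegral_mul_sq_le {α : Type*} [MeasurableSpace α] (μ : Measure α) {f g : α → ℝ≥0∞}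
    (hf : AEMeasurable f μ) (hg : AEMeasurable g μ) :
    (∫⁻ a, f a * g a ∂μ) ^ 2 ≤ (∫⁻ a, f a ^ 2 ∂μ) * ∫⁻ a, g a ^ 2 ∂μ := by
  have h := ENNReal.lintegral_mul_le_Lp_mul_Lq μ Real.HolderConjugate.two_two hf hg
  simp only [Pi.mul_apply, ENNReal.rpow_ofNat] at h
  calc _ ≤ _ := pow_le_pow_left' h 2
    _ = _ := by
      rw [mul_pow, ← ENNReal.rpow_natCast, ← ENNReal.rpow_natCast, ← ENNReal.rpow_mul,
        ← ENNReal.rpow_mul]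
      simp

/-- `g` is differentiable, with a derivative bounded by `K` and Hölder with constant `K`. -/
def HolderSlice (α K : ℝ) (g : ℝ → ℝ) : Prop :=
  Differentiable ℝ g ∧ (∀ y, |deriv g y| ≤ K) ∧
    ∀ y y', |deriv g y - deriv g y'| ≤ K * |y - y'| ^ α

theorem HolderSlice.mono {α K K' : ℝ} {g : ℝ → ℝ} (h : HolderSlice α K g) (hK : K ≤ K') :
    HolderSlice α K' g :=
  ⟨h.1, fun y => (h.2.1 y).trans hK, fun y y' => (h.2.2 y y').trans (by gcongr)⟩

/-- Weighted Cauchy-Schwarz: an `L¹` bound with a weight from an `L²` bound. -/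
theorem integrable_weight_mul {β : Type*} [MeasurableSpace β] {μ : Measure β}
    {w : β → ℝ} (hw : Measurable w) (hw1 : ∀ x, 0 < w x)
    {a s : ℝ} (hint : Integrable (fun x => w x ^ (2 * a - s)) μ)
    {h : β → ℂ} (hh : AEStronglyMeasurable h μ) {D : ℝ} (hD : 0 ≤ D)
    (hb : ∫⁻ x, ENNReal.ofReal (w x ^ s) * ‖h x‖ₑ ^ 2 ∂μ ≤ ENNReal.ofReal (D ^ 2)) :
    Integrable (fun x => w x ^ a * ‖h x‖) μ ∧
      ∫ x, w x ^ a * ‖h x‖ ∂μ ≤ √(∫ x, w x ^ (2 * a - s) ∂μ) * D := by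
  set I := ∫ x, w x ^ (2 * a - s) ∂μ with hI
  have hI0 : 0 ≤ I := integral_nonneg fun x => (Real.rpow_pos_of_pos (hw1 x) _).le
  have hmeas : AEStronglyMeasurable (fun x => w x ^ a * ‖h x‖) μ :=
    (hw.pow_const a).aestronglyMeasurable.mul hh.norm
  have key : ∫⁻ x, ENNReal.ofReal (w x ^ a * ‖h x‖) ∂μ ≤ ENNReal.ofReal (√I * D) := by
    -- Cauchy-Schwarz is applied to the splitting `w^a = w^(a - s/2) · w^(s/2)`.
    have e1 : ∀ x, ENNReal.ofReal (w x ^ a * ‖h x‖) =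
        ENNReal.ofReal (w x ^ (a - s / 2)) * (ENNReal.ofReal (w x ^ (s / 2)) * ‖h x‖ₑ) := by
      intro x
      rw [← mul_assoc, ← ENNReal.ofReal_mul (Real.rpow_pos_of_pos (hw1 x) _).le,
        ← Real.rpow_add (hw1 x), ENNReal.ofReal_mul (Real.rpow_pos_of_pos (hw1 x) _).le,
        ofReal_norm]
      ring_nf
    have h2 := lintegral_mul_sq_le μ (f := fun x => ENNReal.ofReal (w x ^ (a - s / 2)))
      (g := fun x => ENNReal.ofReal (w x ^ (s / 2)) * ‖h x‖ₑ)
      (hw.pow_const _).ennreal_ofReal.aemeasurable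
      ((hw.pow_const _).ennreal_ofReal.aemeasurable.mul hh.enorm)
    have e2 : ∫⁻ x, ENNReal.ofReal (w x ^ (a - s / 2)) ^ 2 ∂μ = ENNReal.ofReal I := by
      rw [hI, ofReal_integral_eq_lintegral_ofReal hint
        (Filter.Eventually.of_forall fun x => (Real.rpow_pos_of_pos (hw1 x) _).le)]
      refine lintegral_congr fun x => ?_
      rw [← ENNReal.ofReal_pow (Real.rpow_pos_of_pos (hw1 x) _).le, ← Real.rpow_natCast,
        ← Real.rpow_mul (hw1 x).le]
      congr 2
      push_cast
      ring
    have e3 : ∀ x, (ENNReal.ofReal (w x ^ (s / 2)) * ‖h x‖ₑ) ^ 2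
        = ENNReal.ofReal (w x ^ s) * ‖h x‖ₑ ^ 2 := by
      intro x
      rw [mul_pow, ← ENNReal.ofReal_pow (Real.rpow_pos_of_pos (hw1 x) _).le, ← Real.rpow_natCast,
        ← Real.rpow_mul (hw1 x).le]
      congr 3
      push_cast
      ring
    simp_rw [e3] at h2
    rw [e2] at h2
    simp_rw [e1]
    have h3 := h2.trans (mul_le_mul_right hb _)
    rw [← ENNReal.ofReal_mul hI0] at h3
    have h4 : ENNReal.ofReal (I * D ^ 2) = ENNReal.ofReal (√I * D) ^ 2 := by
      rw [← ENNReal.ofReal_pow (by positivity), mul_pow, Real.sq_sqrt hI0]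
    rw [h4] at h3
    exact (ENNReal.pow_le_pow_left_iff two_ne_zero).1 h3
  have hint2 : Integrable (fun x => w x ^ a * ‖h x‖) μ := by
    refine ⟨hmeas, ?_⟩
    rw [hasFiniteIntegral_iff_ofReal (Filter.Eventually.of_forall fun x =>
      mul_nonneg (Real.rpow_pos_of_pos (hw1 x) _).le (norm_nonneg _))]
    exact key.trans_lt ENNReal.ofReal_lt_top
  refine ⟨hint2, ?_⟩
  rw [integral_eq_lintegral_of_nonneg_ae (Filter.Eventually.of_forall fun x =>
      mul_nonneg (Real.rpow_pos_of_pos (hw1 x) _).le (norm_nonneg _)) hmeas]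
  exact ENNReal.toReal_le_of_le_ofReal (by positivity) key

/-- Interpolation between the trivial bound `2`, used for `|a - b| ≥ 1`, and the Lipschitz bound,
used for `|a - b| ≤ 1`. -/
theorem norm_cexp_mul_I_sub_le (a b : ℝ) {α : ℝ} (h0 : 0 ≤ α) (h1 : α ≤ 1) :
    ‖Complex.exp (a * Complex.I) - Complex.exp (b * Complex.I)‖ ≤ 2 * |a - b| ^ α := by
  rcases le_total 1 |a - b| with h | h
  · calc _ ≤ ‖Complex.exp (a * Complex.I)‖ + ‖Complex.exp (b * Complex.I)‖ := norm_sub_le _ _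
      _ = 2 * 1 := by rw [Complex.norm_exp_ofReal_mul_I, Complex.norm_exp_ofReal_mul_I]; norm_num
      _ ≤ _ := by gcongr; exact Real.one_le_rpow h h0
  · have e : Complex.exp (a * Complex.I) - Complex.exp (b * Complex.I)
        = Complex.exp (b * Complex.I) * (Complex.exp (Complex.I * ((a - b : ℝ) : ℂ)) - 1) := by
      rw [mul_sub, ← Complex.exp_add]
      push_cast
      ring_nf
    rw [e, norm_mul, Complex.norm_exp_ofReal_mul_I, one_mul]
    calc _ ≤ ‖a - b‖ := Real.norm_exp_I_mul_ofReal_sub_one_le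
      _ = |a - b| := rfl
      _ ≤ |a - b| ^ α := by
        conv_lhs => rw [← Real.rpow_one |a - b|]
        exact Real.rpow_le_rpow_of_exponent_ge' (abs_nonneg _) h h0 h1
      _ ≤ _ := by linarith [Real.rpow_nonneg (abs_nonneg (a - b)) α]

/-- One-dimensional Fourier synthesis with `1 + α` moments gives a `C^{1,α}` function. -/
theorem holderSlice_fourier {α : ℝ} (h0 : 0 < α) (h1 : α ≤ 1) {h : ℝ → ℂ}
    (hm : AEStronglyMeasurable h)
    (hi : Integrable (fun η : ℝ => (1 + η ^ 2) ^ ((1 + α) / 2) * ‖h η‖)) :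
    HolderSlice α (100 * ∫ η : ℝ, (1 + η ^ 2) ^ ((1 + α) / 2) * ‖h η‖)
      (fun y => (∫ η : ℝ, Complex.exp (((2 * Real.pi * (η * y) : ℝ) : ℂ) * Complex.I) * h η).re) := by
  set K := ∫ η : ℝ, (1 + η ^ 2) ^ ((1 + α) / 2) * ‖h η‖
  have hsqrt : ∀ η : ℝ, |η| ≤ (1 + η ^ 2) ^ ((1 : ℝ) / 2) := by
    intro η
    rw [← Real.sqrt_eq_rpow]
    exact Real.abs_le_sqrt (by linarith)
  have hone : ∀ η : ℝ, 1 ≤ 1 + η ^ 2 := fun η => by nlinarith [sq_nonneg η]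
  have hw1 : ∀ η : ℝ, 1 ≤ (1 + η ^ 2) ^ ((1 + α) / 2) := fun η =>
    Real.one_le_rpow (hone η) (by positivity)
  have hw2 : ∀ η : ℝ, |η| ≤ (1 + η ^ 2) ^ ((1 + α) / 2) := fun η =>
    (hsqrt η).trans (Real.rpow_le_rpow_of_exponent_le (hone η) (by linarith))
  have hw3 : ∀ η : ℝ, |η| * |η| ^ α ≤ (1 + η ^ 2) ^ ((1 + α) / 2) := by
    intro η
    have : (1 + η ^ 2) ^ ((1 + α) / 2) = (1 + η ^ 2) ^ ((1 : ℝ) / 2) *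
        ((1 + η ^ 2) ^ ((1 : ℝ) / 2)) ^ α := by
      rw [← Real.rpow_mul (by positivity), ← Real.rpow_add (by positivity)]
      ring_nf
    rw [this]
    gcongr <;> exact hsqrt η
  let G : ℝ → ℝ → ℂ := fun y η =>
    Complex.exp (((2 * Real.pi * (η * y) : ℝ) : ℂ) * Complex.I) * h η
  let G' : ℝ → ℝ → ℂ := fun y η =>
    (2 * Real.pi * η * Complex.I) * (Complex.exp (((2 * Real.pi * (η * y) : ℝ) : ℂ) * Complex.I) * h η)
  have hGm : ∀ y, AEStronglyMeasurable (G y) := fun y =>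
    (Continuous.aestronglyMeasurable (by fun_prop)).mul hm
  have hG'm : ∀ y, AEStronglyMeasurable (G' y) := fun y =>
    (Continuous.aestronglyMeasurable (by fun_prop)).mul (hGm y)
  have hGn : ∀ y η, ‖G y η‖ = ‖h η‖ := by
    intro y η
    simp only [G, norm_mul, Complex.norm_exp_ofReal_mul_I, one_mul]
  have hpi : ‖(2 * Real.pi : ℂ)‖ = 2 * Real.pi := by
    rw [norm_mul, Complex.norm_real, Real.norm_of_nonneg Real.pi_pos.le]
    simp
  have hG'n : ∀ y η, ‖G' y η‖ ≤ 7 * ((1 + η ^ 2) ^ ((1 + α) / 2) * ‖h η‖) := by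
    intro y η
    have : ‖G' y η‖ = 2 * Real.pi * |η| * ‖h η‖ := by
      change ‖(2 * Real.pi * η * Complex.I) * G y η‖ = _
      rw [norm_mul, hGn, norm_mul, norm_mul, hpi]
      simp
    rw [this]
    have h3 : 2 * Real.pi ≤ 7 := by linarith [Real.pi_lt_d2]
    calc 2 * Real.pi * |η| * ‖h η‖ ≤ 7 * (1 + η ^ 2) ^ ((1 + α) / 2) * ‖h η‖ := by
          gcongr; exact hw2 η
      _ = _ := by ring
  have hGi : ∀ y, Integrable (G y) := by
    intro y
    refine hi.mono' (hGm y) (Filter.Eventually.of_forall fun η => ?_)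
    rw [hGn]
    exact le_mul_of_one_le_left (norm_nonneg _) (hw1 η)
  have hG'i : ∀ y, Integrable (G' y) := fun y =>
    (hi.const_mul 7).mono' (hG'm y) (Filter.Eventually.of_forall fun η => hG'n y η)
  have hder : ∀ y, HasDerivAt (fun y => ∫ η, G y η) (∫ η, G' y η) y := by
    intro y
    refine (hasDerivAt_integral_of_dominated_loc_of_deriv_le (F := G) (F' := G')
      (bound := fun η => 7 * ((1 + η ^ 2) ^ ((1 + α) / 2) * ‖h η‖)) Filter.univ_mem
      (Filter.Eventually.of_forall hGm) (hGi y) (hG'm y)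
      (Filter.Eventually.of_forall fun η y _ => hG'n y η) (hi.const_mul 7)
      (Filter.Eventually.of_forall fun η y _ => ?_)).2
    have hb : HasDerivAt (fun y : ℝ => ((2 * Real.pi * (η * y) : ℝ) : ℂ) * Complex.I)
        ((2 * Real.pi * η) * Complex.I) y := by
      have : HasDerivAt (fun y : ℝ => (2 * Real.pi * (η * y) : ℝ)) (2 * Real.pi * η) y := by
        have := ((hasDerivAt_id y).const_mul η).const_mul (2 * Real.pi)
        simpa [mul_assoc] using this
      have := (this.ofReal_comp).mul_const Complex.I
      simpa using this
    have := (hb.cexp).mul_const (h η)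
    refine this.congr_deriv ?_
    simp only [G']
    ring
  have hre : ∀ y, HasDerivAt (fun y => (∫ η, G y η).re) ((∫ η, G' y η).re) y := fun y =>
    (Complex.reCLM.hasFDerivAt.comp_hasDerivAt y (hder y))
  have hK0 : 0 ≤ K := integral_nonneg fun η => by positivity
  refine ⟨fun y => (hre y).differentiableAt, fun y => ?_, fun y y' => ?_⟩
  · change |deriv (fun y => (∫ η, G y η).re) y| ≤ _
    rw [(hre y).deriv]
    calc _ ≤ ‖∫ η, G' y η‖ := Complex.abs_re_le_norm _
      _ ≤ ∫ η, ‖G' y η‖ := norm_integral_le_integral_norm _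
      _ ≤ ∫ η, 7 * ((1 + η ^ 2) ^ ((1 + α) / 2) * ‖h η‖) :=
        integral_mono (hG'i y).norm (hi.const_mul 7) (hG'n y)
      _ = 7 * K := integral_const_mul _ _
      _ ≤ _ := by linarith
  · change |deriv (fun y => (∫ η, G y η).re) y - deriv (fun y => (∫ η, G y η).re) y'| ≤ _
    rw [(hre y).deriv, (hre y').deriv, ← Complex.sub_re, ← integral_sub (hG'i y) (hG'i y')]
    have hb : ∀ η, ‖G' y η - G' y' η‖ ≤
        100 * |y - y'| ^ α * ((1 + η ^ 2) ^ ((1 + α) / 2) * ‖h η‖) := by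
      intro η
      have e : G' y η - G' y' η = (2 * Real.pi * η * Complex.I) *
          ((Complex.exp (((2 * Real.pi * (η * y) : ℝ) : ℂ) * Complex.I)
            - Complex.exp (((2 * Real.pi * (η * y') : ℝ) : ℂ) * Complex.I)) * h η) := by
        simp only [G']; ring
      rw [e, norm_mul, norm_mul (2 * Real.pi * (η : ℂ)), norm_mul (2 * Real.pi : ℂ), hpi,
        norm_mul (_ - _), Complex.norm_I, Complex.norm_real]
      have hc := norm_cexp_mul_I_sub_le (2 * Real.pi * (η * y)) (2 * Real.pi * (η * y')) h0.le h1
      have e2 : |2 * Real.pi * (η * y) - 2 * Real.pi * (η * y')| ^ α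
          = (2 * Real.pi) ^ α * |η| ^ α * |y - y'| ^ α := by
        rw [show 2 * Real.pi * (η * y) - 2 * Real.pi * (η * y') = 2 * Real.pi * η * (y - y') by ring,
          abs_mul, abs_mul, Real.mul_rpow (by positivity) (by positivity),
          Real.mul_rpow (by positivity) (by positivity), abs_of_pos (by positivity : 0 < 2 * Real.pi)]
      rw [e2] at hc
      have h3 : 2 * Real.pi ≤ 7 := by linarith [Real.pi_lt_d2]
      have h4 : (2 * Real.pi) ^ α ≤ 7 := by
        calc (2 * Real.pi) ^ α ≤ (2 * Real.pi) ^ (1 : ℝ) :=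
              Real.rpow_le_rpow_of_exponent_le (by linarith [Real.pi_gt_three]) h1
          _ ≤ 7 := by rw [Real.rpow_one]; exact h3
      -- Both `2π` and `(2π)^α` are at most `7`, so the constant is `7 · 2 · 7 = 98`, which explains
      -- the `100` of the statement.
      calc _ ≤ 2 * Real.pi * ‖η‖ * 1 * (2 * ((2 * Real.pi) ^ α * |η| ^ α * |y - y'| ^ α) * ‖h η‖) := by
            gcongr
        _ ≤ 7 * ‖η‖ * 1 * (2 * (7 * |η| ^ α * |y - y'| ^ α) * ‖h η‖) := by gcongr
        _ = 98 * |y - y'| ^ α * ((|η| * |η| ^ α) * ‖h η‖) := by rw [Real.norm_eq_abs]; ring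
        _ ≤ _ := by gcongr; norm_num; exact hw3 η
    calc _ ≤ ‖∫ η, G' y η - G' y' η‖ := Complex.abs_re_le_norm _
      _ ≤ ∫ η, ‖G' y η - G' y' η‖ := norm_integral_le_integral_norm _
      _ ≤ ∫ η, 100 * |y - y'| ^ α * ((1 + η ^ 2) ^ ((1 + α) / 2) * ‖h η‖) :=
        integral_mono ((hG'i y).sub (hG'i y')).norm (hi.const_mul _) hb
      _ = 100 * |y - y'| ^ α * K := integral_const_mul _ _
      _ = _ := by ring

/-! ### Regularity of `H^s` functions of the plane on lines parallel to the axes -/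

/-- Fourier synthesis in the plane. -/
def synth (φ : ℝ × ℝ → ℂ) (x y : ℝ) : ℂ :=
  ∫ p : ℝ × ℝ, Complex.exp (((2 * Real.pi * (p.1 * x + p.2 * y) : ℝ) : ℂ) * Complex.I) * φ p

/-- Reduces horizontal lines to vertical ones: only vertical sections are analysed directly. -/
theorem synth_swap (φ : ℝ × ℝ → ℂ) (x y : ℝ) :
    synth (fun p => φ p.swap) y x = synth φ x y := by
  unfold synth
  rw [Measure.volume_eq_prod, ← integral_prod_swap]
  simp only [Prod.fst_swap, Prod.snd_swap, add_comm]
  rfl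

theorem integrable_synth_integrand {φ : ℝ × ℝ → ℂ} (hφ : Integrable φ) (x y : ℝ) :
    Integrable (fun p : ℝ × ℝ =>
      Complex.exp (((2 * Real.pi * (p.1 * x + p.2 * y) : ℝ) : ℂ) * Complex.I) * φ p) := by
  refine hφ.norm.mono' ((Continuous.aestronglyMeasurable (by fun_prop)).mul hφ.1)
    (Filter.Eventually.of_forall fun p => ?_)
  rw [norm_mul, Complex.norm_exp_ofReal_mul_I, one_mul]

theorem norm_synth_le (φ : ℝ × ℝ → ℂ) (x y : ℝ) : ‖synth φ x y‖ ≤ ∫ p, ‖φ p‖ := by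
  refine (norm_integral_le_integral_norm _).trans (le_of_eq (integral_congr_ae ?_))
  refine Filter.Eventually.of_forall fun p => ?_
  simp only [norm_mul, Complex.norm_exp_ofReal_mul_I, one_mul]

theorem continuous_synth {φ : ℝ × ℝ → ℂ} (hφ : Integrable φ) :
    Continuous (fun q : ℝ × ℝ => synth φ q.1 q.2) := by
  refine continuous_of_dominated (bound := fun p => ‖φ p‖)
    (fun q => (integrable_synth_integrand hφ q.1 q.2).1) (fun q => ?_) hφ.norm ?_
  · refine Filter.Eventually.of_forall fun p => ?_
    rw [norm_mul, Complex.norm_exp_ofReal_mul_I, one_mul]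
  · refine Filter.Eventually.of_forall fun p => ?_
    fun_prop

theorem integrable_one_add_sq_rpow {r : ℝ} (hr : r < -1 / 2) :
    Integrable (fun η : ℝ => (1 + η ^ 2) ^ r) := by
  have := integrable_rpow_neg_one_add_norm_sq (E := ℝ) (μ := volume) (r := -2 * r)
    (by simp; linarith)
  convert this using 3
  · simp
  · ring

/-- A function with finite weighted `L²` norm on the Fourier side has, on almost every vertical
line, a Hölder continuous derivative, with constants square integrable in the other variable. -/
theorem ae_holderSlice_synth {s α : ℝ} (h0 : 0 < α) (h1 : α ≤ 1) (hs : α < s - 3 / 2)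
    {φ : ℝ × ℝ → ℂ} (hm : StronglyMeasurable φ) (hφ : Integrable φ) {D : ℝ}
    (hb : ∫⁻ p, ENNReal.ofReal ((1 + (p.1 ^ 2 + p.2 ^ 2)) ^ s) * ‖φ p‖ₑ ^ 2
      ≤ ENNReal.ofReal (D ^ 2)) :
    ∃ A : ℝ → ℝ, Measurable A ∧ (∀ x, 0 ≤ A x) ∧ Integrable (fun x => A x ^ 2) ∧
      ∫ x, A x ^ 2 ≤ (100 * √(∫ η : ℝ, (1 + η ^ 2) ^ (1 + α - s)) * D) ^ 2 ∧
      ∀ᵐ x, HolderSlice α (A x) (fun y => (synth φ x y).re) := by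
  set I := ∫ η : ℝ, (1 + η ^ 2) ^ (1 + α - s) with hI
  -- Partial synthesis in `ξ` only: for fixed `x`, the remaining one-dimensional synthesis of `h x`
  -- in `η` is the restriction to the vertical line.
  let h : ℝ → ℝ → ℂ := fun x η =>
    ∫ ξ : ℝ, Complex.exp (((2 * Real.pi * (ξ * x) : ℝ) : ℂ) * Complex.I) * φ (ξ, η)
  have hhm : StronglyMeasurable (Function.uncurry h) := by
    have : StronglyMeasurable (fun q : (ℝ × ℝ) × ℝ =>
        Complex.exp (((2 * Real.pi * (q.2 * q.1.1) : ℝ) : ℂ) * Complex.I) * φ (q.2, q.1.2)) := by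
      refine StronglyMeasurable.mul (Continuous.stronglyMeasurable (by fun_prop)) ?_
      exact hm.comp_measurable (by fun_prop)
    exact this.integral_prod_right
  have hweight : ∀ η : ℝ, (0 : ℝ) < 1 + η ^ 2 := fun η => by positivity
  have hmono : ∀ ξ η : ℝ, ENNReal.ofReal ((1 + η ^ 2) ^ s)
      ≤ ENNReal.ofReal ((1 + (ξ ^ 2 + η ^ 2)) ^ s) := fun ξ η =>
    ENNReal.ofReal_le_ofReal (Real.rpow_le_rpow (hweight η).le (by nlinarith [sq_nonneg ξ])
      (by linarith))
  have hphim : Measurable (fun p : ℝ × ℝ => ‖φ p‖ₑ ^ 2) := hm.enorm.pow_const 2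
  have hb2 : ∫⁻ η, ENNReal.ofReal ((1 + η ^ 2) ^ s) * ∫⁻ ξ, ‖φ (ξ, η)‖ₑ ^ 2
      ≤ ENNReal.ofReal (D ^ 2) := by
    refine le_trans ?_ hb
    have hwp : Measurable (fun p : ℝ × ℝ =>
        ENNReal.ofReal ((1 + (p.1 ^ 2 + p.2 ^ 2)) ^ s) * ‖φ p‖ₑ ^ 2) :=
      Measurable.mul (by fun_prop) hphim
    rw [Measure.volume_eq_prod, lintegral_prod_symm _ hwp.aemeasurable]
    refine lintegral_mono fun η => ?_
    have hsm : Measurable (fun ξ : ℝ => ‖φ (ξ, η)‖ₑ ^ 2) :=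
      hphim.comp (by fun_prop : Measurable fun ξ : ℝ => (ξ, η))
    rw [← lintegral_const_mul _ hsm]
    refine lintegral_mono fun ξ => ?_
    exact mul_le_mul_left (hmono ξ η) _
  -- Plancherel in `ξ` for almost every fixed `η`; the weight `(1 + η²)^s` does not involve `ξ` and
  -- is carried along.
  have hsec : ∀ᵐ η, ∫⁻ x, ‖h x η‖ₑ ^ 2 = ∫⁻ ξ, ‖φ (ξ, η)‖ₑ ^ 2 := by
    have hlt : ∀ᵐ η, ENNReal.ofReal ((1 + η ^ 2) ^ s) * ∫⁻ ξ, ‖φ (ξ, η)‖ₑ ^ 2 < ⊤ := by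
      refine ae_lt_top (Measurable.mul (by fun_prop) ?_)
        (hb2.trans_lt ENNReal.ofReal_lt_top).ne
      exact hphim.lintegral_prod_left'
    have hint : ∀ᵐ η, Integrable (fun ξ => φ (ξ, η)) := by
      rw [Measure.volume_eq_prod] at hφ
      exact hφ.prod_left_ae
    filter_upwards [hlt, hint] with η h1 h2
    have hfin : ∫⁻ ξ, ‖φ (ξ, η)‖ₑ ^ 2 < ⊤ := by
      refine lt_of_le_of_lt ?_ h1
      refine le_mul_of_one_le_left (zero_le) ?_
      rw [ENNReal.one_le_ofReal]
      exact Real.one_le_rpow (by nlinarith [sq_nonneg η]) (by linarith)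
    have hmem : MemLp (fun ξ => φ (ξ, η)) 2 := by
      refine ⟨h2.1, ?_⟩
      rw [eLpNorm_lt_top_iff_lintegral_rpow_enorm_lt_top (by norm_num) (by norm_num)]
      simpa using hfin
    rw [← lintegral_enorm_fourierInv_sq h2 hmem]
    refine lintegral_congr fun x => ?_
    rw [Real.fourierInv_eq']
    simp only [h, smul_eq_mul, RCLike.inner_apply, conj_trivial]
    simp_rw [mul_comm x]
  let a : ℝ → ℝ≥0∞ := fun x => ∫⁻ η, ENNReal.ofReal ((1 + η ^ 2) ^ s) * ‖h x η‖ₑ ^ 2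
  have hwm : Measurable (fun q : ℝ × ℝ =>
      ENNReal.ofReal ((1 + q.2 ^ 2) ^ s) * ‖h q.1 q.2‖ₑ ^ 2) :=
    Measurable.mul (by fun_prop) (hhm.enorm.pow_const 2)
  have ham : Measurable a := hwm.lintegral_prod_right'
  have hatot : ∫⁻ x, a x ≤ ENNReal.ofReal (D ^ 2) := by
    refine le_trans (le_of_eq ?_) hb2
    simp only [a]
    rw [lintegral_lintegral_swap (f := fun x η => ENNReal.ofReal ((1 + η ^ 2) ^ s) * ‖h x η‖ₑ ^ 2)
      hwm.aemeasurable]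
    refine lintegral_congr_ae ?_
    filter_upwards [hsec] with η hη
    rw [← hη, lintegral_const_mul]
    exact (hhm.enorm.comp (by fun_prop : Measurable fun x : ℝ => (x, η))).pow_const 2
  have hafin : ∀ᵐ x, a x < ⊤ := ae_lt_top ham (hatot.trans_lt ENNReal.ofReal_lt_top).ne
  have hI0 : 0 ≤ I := integral_nonneg fun η => (Real.rpow_pos_of_pos (hweight η) _).le
  have hsq : ∀ x, (100 * √I * √(a x).toReal) ^ 2 = (100 * √I) ^ 2 * (a x).toReal := by
    intro x
    rw [mul_pow, Real.sq_sqrt ENNReal.toReal_nonneg]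
  refine ⟨fun x => 100 * √I * √(a x).toReal, ?_, fun x => by positivity, ?_, ?_, ?_⟩
  · exact (ham.ennreal_toReal.sqrt).const_mul _
  · simp_rw [hsq]
    exact (integrable_toReal_of_lintegral_ne_top ham.aemeasurable
      (hatot.trans_lt ENNReal.ofReal_lt_top).ne).const_mul _
  · simp_rw [hsq]
    rw [integral_const_mul, integral_toReal ham.aemeasurable hafin, mul_pow _ D]
    gcongr
    exact ENNReal.toReal_le_of_le_ofReal (by positivity) hatot
  · filter_upwards [hafin] with x hx
    have hxm : AEStronglyMeasurable (h x) :=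
      (hhm.comp_measurable (by fun_prop : Measurable fun η : ℝ => (x, η))).aestronglyMeasurable
    obtain ⟨hi, hle⟩ := integrable_weight_mul (μ := volume) (w := fun η : ℝ => 1 + η ^ 2)
      (by fun_prop) hweight (a := (1 + α) / 2) (s := s)
      (by
        -- The condition `α < s - 3/2` is exactly what makes this exponent less than `-1/2`.
        have := integrable_one_add_sq_rpow (r := 1 + α - s) (by linarith)
        convert this using 3
        ring)
      hxm (D := √(a x).toReal) (Real.sqrt_nonneg _)
      (by
        rw [Real.sq_sqrt ENNReal.toReal_nonneg, ENNReal.ofReal_toReal hx.ne])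
    have hh := holderSlice_fourier h0 h1 hxm hi
    have hfub : ∀ y, synth φ x y =
        ∫ η : ℝ, Complex.exp (((2 * Real.pi * (η * y) : ℝ) : ℂ) * Complex.I) * h x η := by
      intro y
      unfold synth
      have hi2 := integrable_synth_integrand hφ x y
      rw [Measure.volume_eq_prod] at hi2 ⊢
      rw [integral_prod_symm _ hi2]
      refine integral_congr_ae (Filter.Eventually.of_forall fun η => ?_)
      simp only [h]
      rw [← integral_const_mul]
      refine integral_congr_ae (Filter.Eventually.of_forall fun ξ => ?_)
      simp only
      rw [← mul_assoc, ← Complex.exp_add]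
      congr 2
      push_cast
      ring
    simp_rw [hfub]
    refine hh.mono ?_
    rw [mul_assoc]
    gcongr
    refine hle.trans (le_of_eq ?_)
    rw [hI]
    ring_nf

/-- The identification of `ℝ × ℝ` with the Euclidean plane. -/
def prodPlane : ℝ × ℝ ≃ᵐ Plane :=
  (MeasurableEquiv.finTwoArrow (α := ℝ)).symm.trans (MeasurableEquiv.toLp 2 (Fin 2 → ℝ))

theorem prodPlane_zero (q : ℝ × ℝ) : prodPlane q 0 = q.1 := rfl

theorem prodPlane_one (q : ℝ × ℝ) : prodPlane q 1 = q.2 := rfl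

theorem measurePreserving_prodPlane : MeasurePreserving prodPlane :=
  (PiLp.volume_preserving_toLp (Fin 2)).comp
    ((volume_preserving_finTwoArrow ℝ).symm (MeasurableEquiv.finTwoArrow (α := ℝ)))

theorem lintegral_weight_le_of_sobolevNorm_lt {s D : ℝ} (hD : 0 ≤ D)
    {F : Lp ℂ 2 (volume : Measure Plane)} (hF : sobolevNorm s F < ENNReal.ofReal D) :
    ∫⁻ p : ℝ × ℝ, ENNReal.ofReal ((1 + (p.1 ^ 2 + p.2 ^ 2)) ^ s) *
      ‖(𝓕 F : Lp ℂ 2 (volume : Measure Plane)) (prodPlane p)‖ₑ ^ 2 ≤ ENNReal.ofReal (D ^ 2) := by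
  have e : ∀ p : ℝ × ℝ, p.1 ^ 2 + p.2 ^ 2 = ‖prodPlane p‖ ^ 2 := by
    intro p
    rw [EuclideanSpace.norm_sq_eq, Fin.sum_univ_two, prodPlane_zero, prodPlane_one]
    simp
  simp_rw [e]
  rw [measurePreserving_prodPlane.lintegral_comp_emb prodPlane.measurableEmbedding
    (fun ξ => ENNReal.ofReal ((1 + ‖ξ‖ ^ 2) ^ s) *
      ‖(𝓕 F : Lp ℂ 2 (volume : Measure Plane)) ξ‖ₑ ^ 2)]
  have h := pow_le_pow_left' hF.le 2
  rw [sobolevNorm, ← ENNReal.rpow_natCast, ← ENNReal.rpow_mul, ← ENNReal.ofReal_pow hD] at h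
  simpa using h

theorem integrable_plane_weight {r : ℝ} (hr : r < -1) :
    Integrable (fun p : ℝ × ℝ => (1 + (p.1 ^ 2 + p.2 ^ 2)) ^ r) := by
  have h := integrable_rpow_neg_one_add_norm_sq (E := Plane) (μ := volume) (r := -2 * r)
    (by simp; linarith)
  have h2 := (measurePreserving_prodPlane.integrable_comp_emb prodPlane.measurableEmbedding).2 h
  refine h2.congr (Filter.Eventually.of_forall fun p => ?_)
  simp only [Function.comp]
  rw [EuclideanSpace.norm_sq_eq, Fin.sum_univ_two, prodPlane_zero, prodPlane_one]
  simp only [Real.norm_eq_abs, sq_abs]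
  congr 1
  ring

/-- Functions of class `H^s` of the plane, `s > 3/2`, have a continuous representative whose
restrictions to almost every line parallel to an axis are of class `C^{1,α}`. -/
theorem exists_regular_representative {s α : ℝ} (h0 : 0 < α) (h1 : α ≤ 1) (hs : α < s - 3 / 2) :
    ∃ C : ℝ, 0 < C ∧ ∀ (F : Lp ℂ 2 (volume : Measure Plane)) (D : ℝ), 0 ≤ D →
      sobolevNorm s F < ENNReal.ofReal D →
      ∃ f : ℝ → ℝ → ℝ, Continuous (fun q : ℝ × ℝ => f q.1 q.2) ∧
        (∀ x y, |f x y| ≤ C * D) ∧ (∀ᵐ p : Plane, (F p).re = f (p 0) (p 1)) ∧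
        (∃ A : ℝ → ℝ, Measurable A ∧ (∀ x, 0 ≤ A x) ∧ Integrable (fun x => A x ^ 2) ∧
          ∫ x, A x ^ 2 ≤ (C * D) ^ 2 ∧ ∀ᵐ x, HolderSlice α (A x) (fun y => f x y)) ∧
        (∃ B : ℝ → ℝ, Measurable B ∧ (∀ y, 0 ≤ B y) ∧ Integrable (fun y => B y ^ 2) ∧
          ∫ y, B y ^ 2 ≤ (C * D) ^ 2 ∧ ∀ᵐ y, HolderSlice α (B y) (fun x => f x y)) := by
  set C1 := 100 * √(∫ η : ℝ, (1 + η ^ 2) ^ (1 + α - s))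
  set C2 := √(∫ p : ℝ × ℝ, (1 + (p.1 ^ 2 + p.2 ^ 2)) ^ (2 * 0 - s))
  have hC1 : 0 ≤ C1 := by positivity
  have hC2 : 0 ≤ C2 := by positivity
  refine ⟨C1 + C2 + 1, by positivity, fun F D hD hF => ?_⟩
  set ψ : Lp ℂ 2 (volume : Measure Plane) := 𝓕 F with hψ
  let φ : ℝ × ℝ → ℂ := fun p => ψ (prodPlane p)
  have hm : StronglyMeasurable φ := (Lp.stronglyMeasurable ψ).comp_measurable prodPlane.measurable
  have hb := lintegral_weight_le_of_sobolevNorm_lt hD hF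
  have hL := integrable_weight_mul (μ := (volume : Measure (ℝ × ℝ)))
    (w := fun p : ℝ × ℝ => 1 + (p.1 ^ 2 + p.2 ^ 2)) (by fun_prop) (fun p => by positivity)
    (a := 0) (s := s) (integrable_plane_weight (by linarith)) hm.aestronglyMeasurable hD hb
  simp only [Real.rpow_zero, one_mul] at hL
  have hφ : Integrable φ := (integrable_norm_iff hm.aestronglyMeasurable).1 hL.1
  have hφn : ∫ p, ‖φ p‖ ≤ C2 * D := hL.2
  have hψi : Integrable (fun ξ => ψ ξ) :=
    (measurePreserving_prodPlane.integrable_comp_emb prodPlane.measurableEmbedding).1 hφ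
  have hinv : ((𝓕⁻ ψ : Lp ℂ 2 (volume : Measure Plane))) = F := by
    rw [hψ, FourierTransform.fourierInv_fourier_eq]
  have hrep := coeFn_fourierInv_ae_eq ψ hψi
  rw [hinv] at hrep
  have hle1 : (C1 * D) ^ 2 ≤ ((C1 + C2 + 1) * D) ^ 2 := by gcongr; linarith
  refine ⟨fun x y => (synth φ x y).re, Complex.continuous_re.comp (continuous_synth hφ),
    fun x y => ?_, ?_, ?_, ?_⟩
  · calc |(synth φ x y).re| ≤ ‖synth φ x y‖ := Complex.abs_re_le_norm _
      _ ≤ _ := norm_synth_le φ x y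
      _ ≤ C2 * D := hφn
      _ ≤ _ := by gcongr; linarith
  · filter_upwards [hrep] with p hp
    rw [hp, Real.fourierInv_eq']
    congr 1
    rw [synth, ← measurePreserving_prodPlane.integral_comp prodPlane.measurableEmbedding]
    refine integral_congr_ae (Filter.Eventually.of_forall fun q => ?_)
    simp only [smul_eq_mul, φ, PiLp.inner_apply, Fin.sum_univ_two, prodPlane_zero, prodPlane_one]
    simp [mul_comm]
  · obtain ⟨A, hA1, hA2, hA3, hA4, hA5⟩ := ae_holderSlice_synth h0 h1 hs hm hφ hb
    exact ⟨A, hA1, hA2, hA3, hA4.trans hle1, hA5⟩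
  -- The Sobolev weight is symmetric in the two frequencies, so the swapped symbol obeys the same
  -- bound.
  · have hb' : ∫⁻ p : ℝ × ℝ, ENNReal.ofReal ((1 + (p.1 ^ 2 + p.2 ^ 2)) ^ s) * ‖φ p.swap‖ₑ ^ 2
        ≤ ENNReal.ofReal (D ^ 2) := by
      refine le_trans (le_of_eq ?_) hb
      have hmp : MeasurePreserving (Prod.swap : ℝ × ℝ → ℝ × ℝ) := by
        rw [Measure.volume_eq_prod]
        exact Measure.measurePreserving_swap
      rw [← hmp.lintegral_comp_emb MeasurableEquiv.prodComm.measurableEmbedding]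
      refine lintegral_congr fun p => ?_
      simp only [Prod.fst_swap, Prod.snd_swap, add_comm (p.2 ^ 2), φ]
      rw [Prod.swap_swap, hψ]
    obtain ⟨B, hB1, hB2, hB3, hB4, hB5⟩ := ae_holderSlice_synth h0 h1 hs
      (φ := fun p => φ p.swap) (hm.comp_measurable measurable_swap)
      (by
        rw [Measure.volume_eq_prod] at hφ ⊢
        exact hφ.swap) hb'
    refine ⟨B, hB1, hB2, hB3, hB4.trans hle1, ?_⟩
    simpa only [synth_swap] using hB5

/-! ### Sine series on `[-1, 1]` -/

/-- The Dirichlet eigenfunctions of the interval `[-1, 1]`, normalised in `L²`. -/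
def sinMode (m : ℕ) (y : ℝ) : ℝ := Real.sin (m * (Real.pi / 2) * (y + 1))

@[fun_prop]
theorem continuous_sinMode (m : ℕ) : Continuous (sinMode m) := by
  unfold sinMode
  fun_prop

theorem abs_sinMode_le (m : ℕ) (y : ℝ) : |sinMode m y| ≤ 1 := Real.abs_sin_le_one _

theorem sinMode_zero (y : ℝ) : sinMode 0 y = 0 := by simp [sinMode]

theorem sinMode_neg_one (m : ℕ) : sinMode m (-1) = 0 := by simp [sinMode]

theorem sinMode_one (m : ℕ) : sinMode m 1 = 0 := by
  have : (m : ℝ) * (Real.pi / 2) * (1 + 1) = m * Real.pi := by ring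
  rw [sinMode, this, Real.sin_nat_mul_pi]

theorem integral_cos_mode (j : ℤ) (hj : j ≠ 0) :
    ∫ y in (-1 : ℝ)..1, Real.cos (j * (Real.pi / 2) * (y + 1)) = 0 := by
  have hc : (j : ℝ) * (Real.pi / 2) ≠ 0 := by
    have : (j : ℝ) ≠ 0 := by exact_mod_cast hj
    positivity
  have hd : ∀ y ∈ uIcc (-1 : ℝ) 1, HasDerivAt
      (fun y => Real.sin (j * (Real.pi / 2) * (y + 1)) / (j * (Real.pi / 2)))
      (Real.cos (j * (Real.pi / 2) * (y + 1))) y := by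
    intro y _
    have h1 : HasDerivAt (fun y : ℝ => j * (Real.pi / 2) * (y + 1)) (j * (Real.pi / 2)) y := by
      simpa using ((hasDerivAt_id y).add_const 1).const_mul (j * (Real.pi / 2))
    have := h1.sin.div_const (j * (Real.pi / 2))
    rwa [mul_div_cancel_right₀ _ hc] at this
  rw [intervalIntegral.integral_eq_sub_of_hasDerivAt hd
    (Continuous.intervalIntegrable (by fun_prop) _ _)]
  have : (j : ℝ) * (Real.pi / 2) * (1 + 1) = j * Real.pi := by ring
  rw [this, Real.sin_int_mul_pi]
  simp

/-- Product-to-sum turns this into cosine integrals of integer frequencies `m - k` and `m + k + 2`.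
The shift by one skips the mode `0`, which is identically zero. -/
theorem integral_sinMode_mul (m k : ℕ) :
    ∫ y in (-1 : ℝ)..1, sinMode (m + 1) y * sinMode (k + 1) y = if m = k then 1 else 0 := by
  have e : ∀ y, sinMode (m + 1) y * sinMode (k + 1) y =
      (1 / 2) * (Real.cos (((m - k : ℤ) : ℝ) * (Real.pi / 2) * (y + 1))
        - Real.cos (((m + k + 2 : ℤ) : ℝ) * (Real.pi / 2) * (y + 1))) := by
    intro y
    have h1 : ((m - k : ℤ) : ℝ) * (Real.pi / 2) * (y + 1) =
        ((m + 1 : ℕ) : ℝ) * (Real.pi / 2) * (y + 1) - ((k + 1 : ℕ) : ℝ) * (Real.pi / 2) * (y + 1) := by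
      push_cast; ring
    have h2 : ((m + k + 2 : ℤ) : ℝ) * (Real.pi / 2) * (y + 1) =
        ((m + 1 : ℕ) : ℝ) * (Real.pi / 2) * (y + 1) + ((k + 1 : ℕ) : ℝ) * (Real.pi / 2) * (y + 1) := by
      push_cast; ring
    rw [h1, h2, Real.cos_sub, Real.cos_add, sinMode, sinMode]
    ring
  simp_rw [e]
  rw [intervalIntegral.integral_const_mul, intervalIntegral.integral_sub
    (Continuous.intervalIntegrable (by fun_prop) _ _)
    (Continuous.intervalIntegrable (by fun_prop) _ _), integral_cos_mode (m + k + 2) (by positivity)]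
  split_ifs with h
  · subst h
    simp
    norm_num
  · rw [integral_cos_mode (m - k) (by omega)]
    simp

/-- Bessel's inequality for the sine modes. -/
theorem sum_sq_integral_sinMode_le {g : ℝ → ℝ} (hg : IntervalIntegrable g volume (-1) 1)
    (hg2 : IntervalIntegrable (fun y => g y ^ 2) volume (-1) 1) (n : ℕ) :
    ∑ m ∈ Finset.range n, (∫ y in (-1 : ℝ)..1, g y * sinMode (m + 1) y) ^ 2
      ≤ ∫ y in (-1 : ℝ)..1, g y ^ 2 := by
  set c : ℕ → ℝ := fun m => ∫ y in (-1 : ℝ)..1, g y * sinMode (m + 1) y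
  have hgs : ∀ m, IntervalIntegrable (fun y => g y * sinMode m y) volume (-1) 1 := fun m =>
    hg.mul_continuousOn (by fun_prop)
  let S : ℝ → ℝ := fun y => ∑ m ∈ Finset.range n, c m * sinMode (m + 1) y
  have hS : Continuous S := by fun_prop
  have hgS : IntervalIntegrable (fun y => g y * S y) volume (-1) 1 :=
    hg.mul_continuousOn hS.continuousOn
  have h1 : ∫ y in (-1 : ℝ)..1, g y * S y = ∑ m ∈ Finset.range n, c m ^ 2 := by
    simp only [S, Finset.mul_sum]
    rw [intervalIntegral.integral_finsetSum]
    · refine Finset.sum_congr rfl fun m _ => ?_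
      rw [sq]
      conv_rhs => rw [← intervalIntegral.integral_const_mul]
      refine intervalIntegral.integral_congr fun y _ => ?_
      ring
    · intro m _
      exact hg.mul_continuousOn (by fun_prop)
  have h2 : ∫ y in (-1 : ℝ)..1, S y ^ 2 = ∑ m ∈ Finset.range n, c m ^ 2 := by
    have e : ∀ y, S y ^ 2 = ∑ m ∈ Finset.range n, ∑ k ∈ Finset.range n,
        c m * c k * (sinMode (m + 1) y * sinMode (k + 1) y) := by
      intro y
      rw [sq]
      simp only [S, Finset.sum_mul_sum]
      refine Finset.sum_congr rfl fun m _ => Finset.sum_congr rfl fun k _ => ?_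
      ring
    simp_rw [e]
    rw [intervalIntegral.integral_finsetSum
      (fun m _ => Continuous.intervalIntegrable (by fun_prop) _ _)]
    refine Finset.sum_congr rfl fun m hm => ?_
    rw [intervalIntegral.integral_finsetSum
      (fun k _ => Continuous.intervalIntegrable (by fun_prop) _ _)]
    simp_rw [intervalIntegral.integral_const_mul, integral_sinMode_mul]
    simp only [mul_ite, mul_one, mul_zero, Finset.sum_ite_eq, hm, if_true]
    ring
  -- Bessel: expand the square of the distance from `g` to its partial sum.
  have h3 : 0 ≤ ∫ y in (-1 : ℝ)..1, (g y - S y) ^ 2 :=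
    intervalIntegral.integral_nonneg (by norm_num) fun y _ => sq_nonneg _
  have e : ∀ y, (g y - S y) ^ 2 = g y ^ 2 - 2 * (g y * S y) + S y ^ 2 := fun y => by ring
  simp_rw [e] at h3
  have hS2 : IntervalIntegrable (fun y => S y ^ 2) volume (-1) 1 :=
    (hS.pow 2).intervalIntegrable _ _
  rw [intervalIntegral.integral_add (hg2.sub (hgS.const_mul 2)) hS2, intervalIntegral.integral_sub hg2 (hgS.const_mul 2),
    intervalIntegral.integral_const_mul, h1, h2] at h3
  linarith

/-- The sine series of a continuous function vanishing at the end points, with summable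
coefficients, converges to that function. -/
theorem hasSum_sinMode {v : ℝ → ℝ} (hv : ContinuousOn v (Icc (-1) 1)) (hv0 : v (-1) = 0)
    (hv1 : v 1 = 0)
    (hsum : Summable fun m : ℕ => |∫ y in (-1 : ℝ)..1, v y * sinMode m y|)
    {y : ℝ} (hy : y ∈ Icc (-1 : ℝ) 1) :
    HasSum (fun m : ℕ => (∫ y in (-1 : ℝ)..1, v y * sinMode m y) * sinMode m y) (v y) := by
  have : Fact ((0 : ℝ) < 4) := ⟨by norm_num⟩
  let b : ℕ → ℝ := fun m => ∫ y in (-1 : ℝ)..1, v y * sinMode m y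
  -- With `t = y + 1`, the odd extension of `v` to `[-2, 2]`. The zero boundary values make it
  -- continuous, also as a function on the circle of length `4`, so the summability criterion for
  -- Fourier series applies.
  let V : ℝ → ℝ := fun t => Real.sign t * v (|t| - 1)
  have hVpos : ∀ t, 0 ≤ t → V t = v (t - 1) := by
    intro t ht
    rcases ht.eq_or_lt with rfl | h
    · simp [V, hv0]
    · simp [V, Real.sign_of_pos h, abs_of_pos h]
  have hVodd : ∀ t, V (-t) = -V t := by
    intro t
    simp [V, Real.sign_neg]
  have hVc1 : ContinuousOn V (Icc 0 2) := by
    have : ContinuousOn (fun t => v (t - 1)) (Icc 0 2) :=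
      hv.comp (by fun_prop) (fun t ht => ⟨by linarith [ht.1], by linarith [ht.2]⟩)
    exact this.congr fun t ht => hVpos t ht.1
  have hVc2 : ContinuousOn V (Icc (-2) 0) := by
    have : ContinuousOn (fun t => -V (-t)) (Icc (-2) 0) :=
      (hVc1.comp (f := fun t : ℝ => -t) (by fun_prop)
        (fun t ht => ⟨by linarith [ht.2], by linarith [ht.1]⟩)).neg
    exact this.congr fun t ht => by simp only [hVodd, neg_neg]
  have hVc : ContinuousOn V (Icc (-2) 2) := by
    have := hVc2.union_of_isClosed hVc1 isClosed_Icc isClosed_Icc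
    rwa [Icc_union_Icc_eq_Icc (by norm_num) (by norm_num)] at this
  let W : ℝ → ℂ := fun t => (V t : ℂ)
  have hWc : ContinuousOn W (Icc (-2) 2) := Complex.continuous_ofReal.comp_continuousOn hVc
  have hV2 : V 2 = 0 := by rw [hVpos 2 (by norm_num)]; norm_num [hv1]
  let G : C(AddCircle (4 : ℝ), ℂ) := ⟨AddCircle.liftIco 4 (-2) W, by
    refine AddCircle.liftIco_continuous ?_ ?_
    · have : V (-2 + 4) = V (-2) := by
        rw [hVodd, show (-2 + 4 : ℝ) = 2 by norm_num, hV2, neg_zero]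
      simp only [W, this]
    · rwa [show (-2 + 4 : ℝ) = 2 by norm_num]⟩
  have hcoef : ∀ n : ℤ, fourierCoeff G n =
      -(Complex.I / 2) * ((∫ y in (-1 : ℝ)..1, v y * Real.sin (n * (Real.pi / 2) * (y + 1)) : ℝ) : ℂ) := by
    intro n
    have h1 : fourierCoeff G n = fourierCoeff (AddCircle.liftIco 4 (-2) W) n := rfl
    rw [h1, fourierCoeff_liftIco_eq, fourierCoeffOn_eq_integral]
    have e0 : ∀ t : ℝ, (fourier (-n) (t : AddCircle ((-2 + 4 : ℝ) - -2)) : ℂ) • W t =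
        Complex.exp (((-(n * (Real.pi / 2) * t) : ℝ) : ℂ) * Complex.I) * W t := by
      intro t
      rw [fourier_coe_apply, smul_eq_mul]
      congr 2
      push_cast
      ring
    simp_rw [e0]
    let E : ℝ → ℂ := fun t => Complex.exp (((-(n * (Real.pi / 2) * t) : ℝ) : ℂ) * Complex.I) * W t
    have hE : ContinuousOn E (Icc (-2) 2) := ContinuousOn.mul (by fun_prop) hWc
    have hi1 : IntervalIntegrable E volume (-2) 0 :=
      (hE.mono (by rw [uIcc_of_le (by norm_num)]; exact Icc_subset_Icc_right (by norm_num))).intervalIntegrable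
    have hi2 : IntervalIntegrable E volume 0 2 :=
      (hE.mono (by rw [uIcc_of_le (by norm_num)]; exact Icc_subset_Icc_left (by norm_num))).intervalIntegrable
    have hi3 : IntervalIntegrable (fun t => E (-t)) volume 0 2 := by
      exact (hE.comp (f := fun t : ℝ => -t) (by fun_prop) (fun t ht => by
        rw [uIcc_of_le (by norm_num)] at ht
        exact ⟨by linarith [ht.2], by linarith [ht.1]⟩)).intervalIntegrable
    have hI : ∫ t in (-2 : ℝ)..(-2 + 4), E t = ∫ t in (0 : ℝ)..2, (E t + E (-t)) := by
      rw [show (-2 + 4 : ℝ) = 2 by norm_num, ← intervalIntegral.integral_add_adjacent_intervals hi1 hi2,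
        intervalIntegral.integral_add hi2 hi3, intervalIntegral.integral_comp_neg]
      simp [add_comm]
    have hsimp : ∀ t, E t + E (-t) = -(2 * Complex.I) * ((V t * Real.sin (n * (Real.pi / 2) * t) : ℝ) : ℂ) := by
      intro t
      simp only [E, W, hVodd]
      have : -(↑n * (Real.pi / 2) * -t) = n * (Real.pi / 2) * t := by ring
      rw [this]
      rw [Complex.exp_mul_I, Complex.exp_mul_I]
      push_cast
      rw [Complex.cos_neg, Complex.sin_neg]
      ring
    have hb : ∫ t in (0 : ℝ)..2, V t * Real.sin (n * (Real.pi / 2) * t) =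
        ∫ y in (-1 : ℝ)..1, v y * Real.sin (n * (Real.pi / 2) * (y + 1)) := by
      have := intervalIntegral.integral_comp_sub_right (a := 0) (b := 2)
        (fun y => v y * Real.sin (n * (Real.pi / 2) * (y + 1))) 1
      norm_num at this
      rw [← this]
      refine intervalIntegral.integral_congr fun t ht => ?_
      rw [uIcc_of_le (by norm_num)] at ht
      rw [hVpos t ht.1]
    change _ • ∫ t in (-2 : ℝ)..(-2 + 4), E t = _
    rw [hI]
    simp_rw [hsimp]
    rw [intervalIntegral.integral_const_mul, intervalIntegral.integral_ofReal, hb]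
    rw [Complex.real_smul]
    push_cast
    ring
  have hcn : ∀ m : ℕ, fourierCoeff G (m : ℤ) = -(Complex.I / 2) * (b m : ℂ) := by
    intro m
    rw [hcoef]
    rfl
  have hcneg : ∀ m : ℕ, fourierCoeff G (-(m : ℤ)) = (Complex.I / 2) * (b m : ℂ) := by
    intro m
    rw [hcoef]
    have : ∀ y, v y * Real.sin (((-(m : ℤ) : ℤ) : ℝ) * (Real.pi / 2) * (y + 1)) = -(v y * sinMode m y) := by
      intro y
      rw [sinMode, ← mul_neg, ← Real.sin_neg]
      push_cast
      ring_nf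
    simp_rw [this]
    rw [intervalIntegral.integral_neg]
    push_cast
    ring
  have hbs : Summable fun m : ℕ => (b m : ℂ) := by
    refine Summable.of_norm ?_
    simpa using hsum
  have hsG : Summable (fourierCoeff G) := by
    refine Summable.of_nat_of_neg ?_ ?_
    · simp_rw [hcn]
      exact hbs.mul_left _
    · simp_rw [hcneg]
      exact hbs.mul_left _
  have hy1 : y + 1 ∈ Icc (0 : ℝ) 2 := ⟨by linarith [hy.1], by linarith [hy.2]⟩
  -- The fundamental domain `[-2, 2)` omits `t = 2`; at this wall every term is zero.
  rcases eq_or_ne y 1 with rfl | hne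
  · simp only [sinMode_one, mul_zero, hv1]
    exact hasSum_zero
  have hGy : G ((y + 1 : ℝ) : AddCircle (4 : ℝ)) = (v y : ℂ) := by
    change AddCircle.liftIco 4 (-2) W _ = _
    rw [AddCircle.liftIco_coe_apply]
    · simp only [W]
      rw [hVpos _ hy1.1]
      simp
    · refine ⟨by linarith [hy1.1], ?_⟩
      have : y < 1 := lt_of_le_of_ne hy.2 hne
      linarith
  -- Pairing the frequencies `m` and `-m`, whose coefficients are `∓(i/2) b m`, recombines the
  -- exponentials into sines.
  have hS := (has_pointwise_sum_fourier_series_of_summable hsG ((y + 1 : ℝ) : AddCircle (4 : ℝ))).nat_add_neg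
  have hc0 : fourierCoeff G 0 = 0 := by
    have := hcn 0
    simp only [b, sinMode_zero] at this
    simpa using this
  rw [hGy, hc0, zero_smul, add_zero] at hS
  rw [← Complex.hasSum_ofReal]
  convert hS using 1
  funext m
  rw [hcn, hcneg, fourier_coe_apply, fourier_coe_apply, smul_eq_mul, smul_eq_mul]
  have e1 : (2 * Real.pi * Complex.I * ((m : ℤ) : ℂ) * ((y + 1 : ℝ) : ℂ) / ((4 : ℝ) : ℂ)) =
      ((m * (Real.pi / 2) * (y + 1) : ℝ) : ℂ) * Complex.I := by
    push_cast; ring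
  have e2 : (2 * Real.pi * Complex.I * ((-(m : ℤ) : ℤ) : ℂ) * ((y + 1 : ℝ) : ℂ) / ((4 : ℝ) : ℂ)) =
      -((m * (Real.pi / 2) * (y + 1) : ℝ) : ℂ) * Complex.I := by
    push_cast; ring
  rw [e1, e2, Complex.exp_mul_I, Complex.exp_mul_I, Complex.cos_neg, Complex.sin_neg, sinMode]
  push_cast
  have := Complex.I_sq
  linear_combination ((b m : ℂ) * Complex.sin (m * (Real.pi / 2) * (y + 1))) * this

/-! ### Flows in the channel and the divergence theorem -/

/-- The open channel. -/
def channel : Set (ℝ × ℝ) := {p | p.2 ∈ Ioo (-1 : ℝ) 1}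

/-- The closed channel. -/
def closedChannel : Set (ℝ × ℝ) := {p | p.2 ∈ Icc (-1 : ℝ) 1}

theorem isOpen_channel : IsOpen channel := isOpen_Ioo.preimage continuous_snd

theorem channel_subset_closedChannel : channel ⊆ closedChannel := fun _ hp => Ioo_subset_Icc_self hp

/-- An incompressible velocity field in the channel with impermeable walls, periodic in `x`. -/
structure PeriodicFlow (T : ℝ) (u v : ℝ → ℝ → ℝ) : Prop where
  continuous_u : ContinuousOn (fun p : ℝ × ℝ => u p.1 p.2) closedChannel
  continuous_v : ContinuousOn (fun p : ℝ × ℝ => v p.1 p.2) closedChannel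
  contDiff_u : ContDiffOn ℝ 1 (fun p : ℝ × ℝ => u p.1 p.2) channel
  contDiff_v : ContDiffOn ℝ 1 (fun p : ℝ × ℝ => v p.1 p.2) channel
  incompressible : ∀ x : ℝ, ∀ y ∈ Ioo (-1 : ℝ) 1,
    deriv (fun x' => u x' y) x + deriv (fun y' => v x y') y = 0
  wall_bot : ∀ x : ℝ, v x (-1) = 0
  wall_top : ∀ x : ℝ, v x 1 = 0
  periodic_u : HasXPeriod T u
  periodic_v : HasXPeriod T v

section PartialDerivatives

variable {g : ℝ → ℝ → ℝ}

theorem hasFDerivAt_channel (hg : ContDiffOn ℝ 1 (fun p : ℝ × ℝ => g p.1 p.2) channel)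
    {x y : ℝ} (hy : y ∈ Ioo (-1 : ℝ) 1) :
    HasFDerivAt (fun p : ℝ × ℝ => g p.1 p.2) (fderiv ℝ (fun p : ℝ × ℝ => g p.1 p.2) (x, y)) (x, y) :=
  ((hg.differentiableOn (by norm_num)).differentiableAt
    (isOpen_channel.mem_nhds (show (x, y) ∈ channel from hy))).hasFDerivAt

theorem hasDerivAt_fst (hg : ContDiffOn ℝ 1 (fun p : ℝ × ℝ => g p.1 p.2) channel)
    {x y : ℝ} (hy : y ∈ Ioo (-1 : ℝ) 1) :
    HasDerivAt (fun x' => g x' y) (fderiv ℝ (fun p : ℝ × ℝ => g p.1 p.2) (x, y) (1, 0)) x := by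
  have h1 : HasDerivAt (fun x' : ℝ => (x', y)) ((1 : ℝ), (0 : ℝ)) x :=
    (hasDerivAt_id x).prodMk (hasDerivAt_const x y)
  exact (hasFDerivAt_channel hg hy).comp_hasDerivAt x h1

theorem hasDerivAt_snd (hg : ContDiffOn ℝ 1 (fun p : ℝ × ℝ => g p.1 p.2) channel)
    {x y : ℝ} (hy : y ∈ Ioo (-1 : ℝ) 1) :
    HasDerivAt (fun y' => g x y') (fderiv ℝ (fun p : ℝ × ℝ => g p.1 p.2) (x, y) (0, 1)) y := by
  have h1 : HasDerivAt (fun y' : ℝ => (x, y')) ((0 : ℝ), (1 : ℝ)) y :=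
    (hasDerivAt_const y x).prodMk (hasDerivAt_id y)
  exact (hasFDerivAt_channel hg hy).comp_hasDerivAt y h1

theorem continuousOn_deriv_fst (hg : ContDiffOn ℝ 1 (fun p : ℝ × ℝ => g p.1 p.2) channel) :
    ContinuousOn (fun p : ℝ × ℝ => deriv (fun x' => g x' p.2) p.1) channel := by
  have h := (hg.continuousOn_fderiv_of_isOpen isOpen_channel (by norm_num)).clm_apply
    (continuousOn_const (c := ((1 : ℝ), (0 : ℝ))))
  exact h.congr fun p hp => (hasDerivAt_fst hg hp).deriv

theorem continuousOn_deriv_snd (hg : ContDiffOn ℝ 1 (fun p : ℝ × ℝ => g p.1 p.2) channel) :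
    ContinuousOn (fun p : ℝ × ℝ => deriv (fun y' => g p.1 y') p.2) channel := by
  have h := (hg.continuousOn_fderiv_of_isOpen isOpen_channel (by norm_num)).clm_apply
    (continuousOn_const (c := ((0 : ℝ), (1 : ℝ))))
  exact h.congr fun p hp => (hasDerivAt_snd hg hp).deriv

end PartialDerivatives

theorem exists_bound_of_periodic {T : ℝ} (hT : 0 < T) {g : ℝ → ℝ → ℝ}
    (hg : ContinuousOn (fun p : ℝ × ℝ => g p.1 p.2) closedChannel) (hp : HasXPeriod T g) :
    ∃ K : ℝ, ∀ x, ∀ y ∈ Icc (-1 : ℝ) 1, |g x y| ≤ K := by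
  have hc : IsCompact (Icc (0 : ℝ) T ×ˢ Icc (-1 : ℝ) 1) := isCompact_Icc.prod isCompact_Icc
  obtain ⟨K, hK⟩ := hc.exists_bound_of_continuousOn (hg.mono fun p hp => hp.2)
  refine ⟨K, fun x y hy => ?_⟩
  have hper : Function.Periodic (fun x => g x y) T := fun x => hp x y hy
  obtain ⟨x', hx', he⟩ := hper.exists_mem_Ico₀ hT x
  rw [he]
  exact hK (x', y) ⟨Ico_subset_Icc_self hx', hy⟩

theorem continuous_integral_channel {g : ℝ → ℝ → ℝ}
    (hg : ContinuousOn (fun p : ℝ × ℝ => g p.1 p.2) channel) {K : ℝ}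
    (hK : ∀ x, ∀ y ∈ Ioo (-1 : ℝ) 1, |g x y| ≤ K) {k : ℝ → ℝ} (hk : Continuous k)
    (hk1 : ∀ y, |k y| ≤ 1) :
    Continuous fun x => ∫ y in (-1 : ℝ)..1, g x y * k y := by
  have hae : ∀ᵐ y : ℝ, y ∈ uIoc (-1 : ℝ) 1 → y ∈ Ioo (-1 : ℝ) 1 := by
    have : ∀ᵐ y : ℝ, y ≠ 1 := by simp [ae_iff, measure_singleton]
    filter_upwards [this] with y hy h
    rw [uIoc_of_le (by norm_num)] at h
    exact ⟨h.1, lt_of_le_of_ne h.2 hy⟩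
  refine intervalIntegral.continuous_of_dominated_interval (bound := fun _ => K) ?_ ?_
    intervalIntegrable_const ?_
  · intro x
    rw [uIoc_of_le (by norm_num), ← restrict_Ioo_eq_restrict_Ioc]
    have : ContinuousOn (fun y => g x y * k y) (Ioo (-1) 1) :=
      (hg.comp (f := fun y => (x, y)) (by fun_prop) (fun y hy => hy)).mul hk.continuousOn
    exact this.aestronglyMeasurable measurableSet_Ioo
  · intro x
    filter_upwards [hae] with y hy h
    rw [norm_mul, Real.norm_eq_abs, Real.norm_eq_abs]
    calc _ ≤ K * 1 := mul_le_mul (hK x y (hy h)) (hk1 y) (abs_nonneg _)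
          ((abs_nonneg _).trans (hK x y (hy h)))
      _ = K := mul_one K
  · filter_upwards [hae] with y hy h
    refine Continuous.mul ?_ continuous_const
    exact hg.comp_continuous (f := fun x => (x, y)) (by fun_prop) (fun x => hy h)

/-- The even counterpart of `sinMode`. -/
def cosMode (m : ℕ) (y : ℝ) : ℝ := Real.cos (m * (Real.pi / 2) * (y + 1))

@[fun_prop]
theorem continuous_cosMode (m : ℕ) : Continuous (cosMode m) := by
  unfold cosMode
  fun_prop

theorem abs_cosMode_le (m : ℕ) (y : ℝ) : |cosMode m y| ≤ 1 := Real.abs_cos_le_one _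

theorem hasDerivAt_sinMode (m : ℕ) (y : ℝ) :
    HasDerivAt (sinMode m) (m * (Real.pi / 2) * cosMode m y) y := by
  have h1 : HasDerivAt (fun y : ℝ => m * (Real.pi / 2) * (y + 1)) (m * (Real.pi / 2)) y := by
    simpa using ((hasDerivAt_id y).add_const 1).const_mul (m * (Real.pi / 2))
  exact h1.sin.congr_deriv (by rw [cosMode]; ring)

theorem hasDerivAt_cosMode (m : ℕ) (y : ℝ) :
    HasDerivAt (cosMode m) (-(m * (Real.pi / 2) * sinMode m y)) y := by
  have h1 : HasDerivAt (fun y : ℝ => m * (Real.pi / 2) * (y + 1)) (m * (Real.pi / 2)) y := by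
    simpa using ((hasDerivAt_id y).add_const 1).const_mul (m * (Real.pi / 2))
  exact h1.cos.congr_deriv (by rw [sinMode]; ring)

/-- Divergence theorem on a rectangle spanning the channel, for fields multiplied by functions
of `y`. -/
theorem integral_divergence_channel {p q : ℝ → ℝ → ℝ}
    (hp : ContinuousOn (fun z : ℝ × ℝ => p z.1 z.2) closedChannel)
    (hq : ContinuousOn (fun z : ℝ × ℝ => q z.1 z.2) closedChannel)
    (hp1 : ContDiffOn ℝ 1 (fun z : ℝ × ℝ => p z.1 z.2) channel)
    (hq1 : ContDiffOn ℝ 1 (fun z : ℝ × ℝ => q z.1 z.2) channel)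
    {d : ℝ → ℝ → ℝ} {K : ℝ} (hd : ContinuousOn (fun z : ℝ × ℝ => d z.1 z.2) channel)
    (hdK : ∀ x, ∀ y ∈ Ioo (-1 : ℝ) 1, |d x y| ≤ K)
    (hdiv : ∀ x, ∀ y ∈ Ioo (-1 : ℝ) 1,
      deriv (fun x' => p x' y) x + deriv (fun y' => q x y') y = d x y)
    (hq0 : ∀ x, q x (-1) = 0) (hq2 : ∀ x, q x 1 = 0) (x₁ x₂ : ℝ) :
    (∫ y in (-1 : ℝ)..1, p x₂ y) - ∫ y in (-1 : ℝ)..1, p x₁ y =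
      ∫ x in x₁..x₂, ∫ y in (-1 : ℝ)..1, d x y := by
  have hsub : uIcc x₁ x₂ ×ˢ uIcc (-1 : ℝ) 1 ⊆ closedChannel := by
    intro z hz
    have := hz.2
    rwa [uIcc_of_le (by norm_num)] at this
  have hint : ∀ z ∈ Ioo (min x₁ x₂) (max x₁ x₂) ×ˢ Ioo (min (-1 : ℝ) 1) (max (-1) 1),
      z.2 ∈ Ioo (-1 : ℝ) 1 := by
    intro z hz
    have := hz.2
    rwa [min_eq_left (by norm_num), max_eq_right (by norm_num)] at this
  have hK0 : 0 ≤ K := (abs_nonneg _).trans (hdK 0 0 (by norm_num))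
  let P' := fderiv ℝ (fun z : ℝ × ℝ => p z.1 z.2)
  let Q' := fderiv ℝ (fun z : ℝ × ℝ => q z.1 z.2)
  have heq : ∀ x, ∀ y ∈ Ioo (-1 : ℝ) 1, P' (x, y) (1, 0) + Q' (x, y) (0, 1) = d x y := by
    intro x y hy
    rw [← hdiv x y hy, (hasDerivAt_fst hp1 hy).deriv, (hasDerivAt_snd hq1 hy).deriv]
  -- Derivatives exist only inside the channel, and each may be unbounded near the walls.
  -- Integrability is needed for the divergence alone, which is bounded by `K` off the null set
  -- formed by the walls.
  have haeq : (uIcc x₁ x₂ ×ˢ uIcc (-1 : ℝ) 1 : Set (ℝ × ℝ)) =ᵐ[volume]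
      (uIcc x₁ x₂ ×ˢ Ioo (-1 : ℝ) 1 : Set (ℝ × ℝ)) := by
    rw [uIcc_of_le (by norm_num : (-1 : ℝ) ≤ 1), Measure.volume_eq_prod]
    exact Measure.set_prod_ae_eq Filter.EventuallyEq.rfl Ioo_ae_eq_Icc.symm
  have hmain := integral2_divergence_prod_of_hasFDerivAt (fun z : ℝ × ℝ => p z.1 z.2)
    (fun z : ℝ × ℝ => q z.1 z.2) P' Q' x₁ (-1) x₂ 1 (hp.mono hsub) (hq.mono hsub)
    (fun z hz => hasFDerivAt_channel hp1 (hint z hz))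
    (fun z hz => hasFDerivAt_channel hq1 (hint z hz)) ?_
  · simp only [hq0, hq2, intervalIntegral.integral_zero, sub_self, zero_add] at hmain
    rw [← hmain]
    refine intervalIntegral.integral_congr fun x _ => ?_
    refine intervalIntegral.integral_congr_ae ?_
    have : ∀ᵐ y : ℝ, y ≠ 1 := by simp [ae_iff, measure_singleton]
    filter_upwards [this] with y hy h
    rw [uIoc_of_le (by norm_num)] at h
    exact heq x y ⟨h.1, lt_of_le_of_ne h.2 hy⟩
  · rw [IntegrableOn, Measure.restrict_congr_set haeq]
    have hms : MeasurableSet (uIcc x₁ x₂ ×ˢ Ioo (-1 : ℝ) 1) :=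
      measurableSet_uIcc.prod measurableSet_Ioo
    have hdi : IntegrableOn (fun z : ℝ × ℝ => d z.1 z.2) (uIcc x₁ x₂ ×ˢ Ioo (-1 : ℝ) 1) := by
      refine IntegrableOn.of_bound ?_
        ((hd.mono fun z hz => hz.2).aestronglyMeasurable hms) K ?_
      · exact lt_of_le_of_lt (measure_mono (prod_mono_right Ioo_subset_Icc_self))
          (isCompact_uIcc.prod isCompact_Icc).measure_lt_top
      · refine (ae_restrict_iff' hms).2 (Filter.Eventually.of_forall fun z hz => ?_)
        exact hdK z.1 z.2 hz.2
    refine hdi.congr_fun (fun z hz => ?_) hms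
    exact (heq z.1 z.2 hz.2).symm

/-- Lets section integrals be differentiated from a flux identity, where differentiating under the
integral would need control of derivatives at the walls. -/
theorem hasDerivAt_of_integral_eq {F D : ℝ → ℝ} (hD : Continuous D)
    (h : ∀ x₁ x₂, F x₂ - F x₁ = ∫ x in x₁..x₂, D x) (x : ℝ) : HasDerivAt F (D x) x := by
  have e : F = fun z => F x + ∫ t in x..z, D t := by
    funext z
    rw [← h x z]
    ring
  rw [e]
  have := intervalIntegral.integral_hasDerivAt_right (hD.intervalIntegrable x x)
    (hD.stronglyMeasurableAtFilter _ _) hD.continuousAt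
  exact this.const_add (F x)

/-! ### The first-order system for the coefficients of a flow -/

/-- Coefficients in the sine basis on vertical sections. -/
def sinCoeff (g : ℝ → ℝ → ℝ) (m : ℕ) (x : ℝ) : ℝ := ∫ y in (-1 : ℝ)..1, g x y * sinMode m y

/-- Coefficients in the cosine basis on vertical sections. -/
def cosCoeff (g : ℝ → ℝ → ℝ) (m : ℕ) (x : ℝ) : ℝ := ∫ y in (-1 : ℝ)..1, g x y * cosMode m y

/-- Frequency of `sinMode`. -/
def freq (m : ℕ) : ℝ := m * (Real.pi / 2)

namespace PeriodicFlow

variable {T : ℝ} {u v : ℝ → ℝ → ℝ}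

theorem continuousOn_vorticity (h : PeriodicFlow T u v) :
    ContinuousOn (fun p : ℝ × ℝ => vorticity u v p.1 p.2) channel :=
  (continuousOn_deriv_snd h.contDiff_u).sub (continuousOn_deriv_fst h.contDiff_v)

theorem vorticity_periodic (h : PeriodicFlow T u v) (x : ℝ) {y : ℝ} (hy : y ∈ Ioo (-1 : ℝ) 1) :
    vorticity u v (x + T) y = vorticity u v x y := by
  unfold vorticity
  congr 1
  · refine Filter.EventuallyEq.deriv_eq ?_
    filter_upwards [isOpen_Ioo.mem_nhds hy] with y' hy'
    exact h.periodic_u x y' (Ioo_subset_Icc_self hy')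
  · have e : (fun x' => v x' y) = fun x' => v (x' + T) y := by
      funext x'
      exact (h.periodic_v x' y (Ioo_subset_Icc_self hy)).symm
    conv_rhs => rw [e]
    exact (deriv_comp_add_const (f := fun x' => v x' y) T x).symm

theorem sinCoeff_vorticity_periodic (h : PeriodicFlow T u v) (m : ℕ) :
    Function.Periodic (sinCoeff (vorticity u v) m) T := by
  intro x
  refine intervalIntegral.integral_congr_ae ?_
  have : ∀ᵐ y : ℝ, y ≠ 1 := by simp [ae_iff, measure_singleton]
  filter_upwards [this] with y hy hy'
  rw [uIoc_of_le (by norm_num)] at hy'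
  rw [h.vorticity_periodic x ⟨hy'.1, lt_of_le_of_ne hy'.2 hy⟩]

theorem sinCoeff_v_periodic (h : PeriodicFlow T u v)
    (m : ℕ) : Function.Periodic (sinCoeff v m) T := by
  intro x
  refine intervalIntegral.integral_congr fun y hy => ?_
  rw [uIcc_of_le (by norm_num)] at hy
  simp only [h.periodic_v x y hy]

theorem cosCoeff_u_periodic (h : PeriodicFlow T u v)
    (m : ℕ) : Function.Periodic (cosCoeff u m) T := by
  intro x
  refine intervalIntegral.integral_congr fun y hy => ?_
  rw [uIcc_of_le (by norm_num)] at hy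
  simp only [h.periodic_u x y hy]

/-- Flux of `(u cos, v cos)`: incompressibility leaves only the derivative of the cosine, and
nothing crosses the walls since `v = 0` there. -/
theorem hasDerivAt_cosCoeff_u (h : PeriodicFlow T u v) (hT : 0 < T) (m : ℕ) (x : ℝ) :
    HasDerivAt (cosCoeff u m) (-(freq m * sinCoeff v m x)) x := by
  obtain ⟨K, hK⟩ := exists_bound_of_periodic hT h.continuous_v h.periodic_v
  have hc : Continuous (fun x => -(freq m * sinCoeff v m x)) :=
    ((continuous_integral_channel (h.continuous_v.mono channel_subset_closedChannel)
      (fun x y hy => hK x y (Ioo_subset_Icc_self hy)) (continuous_sinMode m)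
      (abs_sinMode_le m)).const_mul _).neg
  refine hasDerivAt_of_integral_eq hc (fun x₁ x₂ => ?_) x
  have := integral_divergence_channel (p := fun x y => u x y * cosMode m y)
    (q := fun x y => v x y * cosMode m y) (d := fun x y => -(freq m * (v x y * sinMode m y)))
    (K := |freq m| * K)
    (h.continuous_u.mul (by fun_prop)) (h.continuous_v.mul (by fun_prop))
    (h.contDiff_u.mul (by unfold cosMode; fun_prop)) (h.contDiff_v.mul (by unfold cosMode; fun_prop))
    (((h.continuous_v.mono channel_subset_closedChannel).mul (by fun_prop)).const_mul _).neg
    (fun x y hy => by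
      have h1 := hK x y (Ioo_subset_Icc_self hy)
      rw [abs_neg, abs_mul, abs_mul]
      gcongr
      calc _ ≤ K * 1 := mul_le_mul h1 (abs_sinMode_le m y) (abs_nonneg _) ((abs_nonneg _).trans h1)
        _ = K := mul_one K)
    (fun x y hy => by
      have h1 := (hasDerivAt_fst h.contDiff_u (x := x) hy).differentiableAt.hasDerivAt
      have h2 := (hasDerivAt_snd h.contDiff_v (x := x) hy).differentiableAt.hasDerivAt
      have h3 : HasDerivAt (fun y' => v x y' * cosMode m y') _ y := h2.mul (hasDerivAt_cosMode m y)
      rw [(h1.mul_const (cosMode m y)).deriv, h3.deriv]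
      have := h.incompressible x y hy
      rw [freq]
      linear_combination cosMode m y * this)
    (fun x => by rw [h.wall_bot, zero_mul]) (fun x => by rw [h.wall_top, zero_mul]) x₁ x₂
  simp only [intervalIntegral.integral_neg, intervalIntegral.integral_const_mul] at this ⊢
  exact this

/-- Flux of `(-v sin, u sin)`, whose divergence is `ω sin + λ u cos` with `λ` the frequency. Here
the sine vanishes at the walls, so no boundary condition on `u` is needed. -/
theorem hasDerivAt_sinCoeff_v (h : PeriodicFlow T u v) (hT : 0 < T) {K : ℝ}
    (hω : ∀ x, ∀ y ∈ Ioo (-1 : ℝ) 1, |vorticity u v x y| ≤ K) (m : ℕ) (x : ℝ) :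
    HasDerivAt (sinCoeff v m)
      (-(freq m * cosCoeff u m x) - sinCoeff (vorticity u v) m x) x := by
  obtain ⟨L, hL⟩ := exists_bound_of_periodic hT h.continuous_u h.periodic_u
  have hcu : Continuous (cosCoeff u m) :=
    continuous_integral_channel (h.continuous_u.mono channel_subset_closedChannel)
      (fun x y hy => hL x y (Ioo_subset_Icc_self hy)) (continuous_cosMode m) (abs_cosMode_le m)
  have hcw : Continuous (sinCoeff (vorticity u v) m) :=
    continuous_integral_channel h.continuousOn_vorticity hω (continuous_sinMode m)
      (abs_sinMode_le m)
  have hc : Continuous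
      (fun x => -(freq m * cosCoeff u m x) - sinCoeff (vorticity u v) m x) :=
    (hcu.const_mul _).neg.sub hcw
  refine hasDerivAt_of_integral_eq hc (fun x₁ x₂ => ?_) x
  have hsec : ∀ x, IntervalIntegrable (fun y => vorticity u v x y * sinMode m y) volume (-1) 1 := by
    intro x
    rw [intervalIntegrable_iff_integrableOn_Ioo_of_le (by norm_num)]
    refine IntegrableOn.of_bound (by simp) ?_ K ?_
    · have : ContinuousOn (fun y => vorticity u v x y * sinMode m y) (Ioo (-1) 1) :=
        (h.continuousOn_vorticity.comp (f := fun y => (x, y)) (by fun_prop) (fun y hy => hy)).mul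
          (by fun_prop)
      exact this.aestronglyMeasurable measurableSet_Ioo
    · refine (ae_restrict_iff' measurableSet_Ioo).2 (Filter.Eventually.of_forall fun y hy => ?_)
      rw [norm_mul, Real.norm_eq_abs, Real.norm_eq_abs]
      calc _ ≤ K * 1 := mul_le_mul (hω x y hy) (abs_sinMode_le m y) (abs_nonneg _)
            ((abs_nonneg _).trans (hω x y hy))
        _ = K := mul_one K
  have hsec2 : ∀ x, IntervalIntegrable (fun y => freq m * (u x y * cosMode m y)) volume (-1) 1 := by
    intro x
    refine ContinuousOn.intervalIntegrable ?_
    rw [uIcc_of_le (by norm_num)]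
    have : ContinuousOn (fun y => u x y) (Icc (-1) 1) :=
      h.continuous_u.comp (f := fun y => (x, y)) (by fun_prop) (fun y hy => hy)
    exact (this.mul (by fun_prop)).const_mul _
  have := integral_divergence_channel (p := fun x y => -(v x y * sinMode m y))
    (q := fun x y => u x y * sinMode m y)
    (d := fun x y => vorticity u v x y * sinMode m y + freq m * (u x y * cosMode m y))
    (K := K + |freq m| * L)
    (h.continuous_v.mul (by fun_prop)).neg (h.continuous_u.mul (by fun_prop))
    (h.contDiff_v.mul (by unfold sinMode; fun_prop)).neg
    (h.contDiff_u.mul (by unfold sinMode; fun_prop))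
    ((h.continuousOn_vorticity.mul (by fun_prop)).add
      (((h.continuous_u.mono channel_subset_closedChannel).mul (by fun_prop)).const_mul _))
    (fun x y hy => by
      refine (abs_add_le _ _).trans (add_le_add ?_ ?_)
      · rw [abs_mul]
        calc _ ≤ K * 1 := mul_le_mul (hω x y hy) (abs_sinMode_le m y) (abs_nonneg _)
              ((abs_nonneg _).trans (hω x y hy))
          _ = K := mul_one K
      · have h1 := hL x y (Ioo_subset_Icc_self hy)
        rw [abs_mul, abs_mul]
        gcongr
        calc _ ≤ L * 1 := mul_le_mul h1 (abs_cosMode_le m y) (abs_nonneg _)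
              ((abs_nonneg _).trans h1)
          _ = L := mul_one L)
    (fun x y hy => by
      have h1 := (hasDerivAt_fst h.contDiff_v (x := x) hy).differentiableAt.hasDerivAt
      have h2 := (hasDerivAt_snd h.contDiff_u (x := x) hy).differentiableAt.hasDerivAt
      have h3 : HasDerivAt (fun x' => -(v x' y * sinMode m y)) _ x := (h1.mul_const (sinMode m y)).neg
      have h4 : HasDerivAt (fun y' => u x y' * sinMode m y') _ y := h2.mul (hasDerivAt_sinMode m y)
      rw [h3.deriv, h4.deriv, freq, vorticity]
      ring)
    (fun x => by rw [sinMode_neg_one, mul_zero]) (fun x => by rw [sinMode_one, mul_zero]) x₁ x₂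
  simp_rw [fun x => intervalIntegral.integral_add (hsec x) (hsec2 x)] at this
  simp only [intervalIntegral.integral_neg, intervalIntegral.integral_const_mul] at this
  have e : ∀ x, -(freq m * cosCoeff u m x) - sinCoeff (vorticity u v) m x =
      -(sinCoeff (vorticity u v) m x + freq m * cosCoeff u m x) := fun x => by ring
  simp_rw [e, intervalIntegral.integral_neg]
  simp only [sinCoeff, cosCoeff] at this ⊢
  linarith

end PeriodicFlow

/-! ### Explicit periodic solutions of the system -/

section PeriodicODE

variable {T l : ℝ} {a b w : ℝ → ℝ}

/-- Periodic solution of `p' = -l p - w`. -/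
theorem periodic_solution_decay {p : ℝ → ℝ} (hp : Function.Periodic p T)
    (hw : Continuous w) (hd : ∀ x, HasDerivAt p (-(l * p x) - w x) x) (x : ℝ) :
    ∫ τ in (0 : ℝ)..T, Real.exp (-(l * τ)) * w (x - τ) = -((1 - Real.exp (-(l * T))) * p x) := by
  have hder : ∀ τ ∈ uIcc 0 T, HasDerivAt (fun τ => Real.exp (-(l * τ)) * p (x - τ))
      (Real.exp (-(l * τ)) * w (x - τ)) τ := by
    intro τ _
    have h1 : HasDerivAt (fun τ => Real.exp (-(l * τ))) (Real.exp (-(l * τ)) * -l) τ := by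
      have : HasDerivAt (fun τ : ℝ => -(l * τ)) (-l) τ := by
        simpa using (hasDerivAt_id τ).const_mul (-l)
      exact this.exp
    have h2 : HasDerivAt (fun τ => p (x - τ)) (-(-(l * p (x - τ)) - w (x - τ))) τ :=
      (hd (x - τ)).comp_const_sub x τ
    exact (h1.mul h2).congr_deriv (by ring)
  rw [intervalIntegral.integral_eq_sub_of_hasDerivAt hder
    (Continuous.intervalIntegrable (by fun_prop) _ _)]
  have := hp (x - T)
  rw [sub_add_cancel] at this
  rw [← this]
  simp
  ring

/-- Periodic solution of `q' = l q + w`. -/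
theorem periodic_solution_growth {q : ℝ → ℝ} (hq : Function.Periodic q T)
    (hw : Continuous w) (hd : ∀ x, HasDerivAt q (l * q x + w x) x) (x : ℝ) :
    ∫ τ in (0 : ℝ)..T, Real.exp (-(l * τ)) * w (x + τ) = -((1 - Real.exp (-(l * T))) * q x) := by
  have hder : ∀ τ ∈ uIcc 0 T, HasDerivAt (fun τ => Real.exp (-(l * τ)) * q (x + τ))
      (Real.exp (-(l * τ)) * w (x + τ)) τ := by
    intro τ _
    have h1 : HasDerivAt (fun τ => Real.exp (-(l * τ))) (Real.exp (-(l * τ)) * -l) τ := by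
      have : HasDerivAt (fun τ : ℝ => -(l * τ)) (-l) τ := by
        simpa using (hasDerivAt_id τ).const_mul (-l)
      exact this.exp
    have h2 : HasDerivAt (fun τ => q (x + τ)) (l * q (x + τ) + w (x + τ)) τ :=
      (hd (x + τ)).comp_const_add x τ
    exact (h1.mul h2).congr_deriv (by ring)
  rw [intervalIntegral.integral_eq_sub_of_hasDerivAt hder
    (Continuous.intervalIntegrable (by fun_prop) _ _)]
  rw [hq x]
  simp
  ring

/-- The combinations `a + b` and `a - b` decouple the system; the first is solved backward and the
second forward in `x` over one period. Subtracting leaves differences of `w`, so constants cancel.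
-/
theorem periodic_system_value (ha : Function.Periodic a T) (hb : Function.Periodic b T) (hw : Continuous w)
    (hda : ∀ x, HasDerivAt a (-(l * b x)) x) (hdb : ∀ x, HasDerivAt b (-(l * a x) - w x) x)
    (x : ℝ) :
    2 * (1 - Real.exp (-(l * T))) * b x =
      ∫ τ in (0 : ℝ)..T, Real.exp (-(l * τ)) * (w (x + τ) - w (x - τ)) := by
  have h1 := periodic_solution_decay (l := l) (ha.add hb) hw
    (fun x => ((hda x).add (hdb x)).congr_deriv (by simp only [Pi.add_apply]; ring)) x
  have h2 := periodic_solution_growth (l := l) (ha.sub hb) hw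
    (fun x => ((hda x).sub (hdb x)).congr_deriv (by simp only [Pi.sub_apply]; ring)) x
  simp_rw [mul_sub]
  rw [intervalIntegral.integral_sub (Continuous.intervalIntegrable (by fun_prop) _ _)
    (Continuous.intervalIntegrable (by fun_prop) _ _), h1, h2]
  simp only [Pi.add_apply, Pi.sub_apply]
  ring

/-- Adding the two decoupled solutions gives `a`. The kernel `l e^(-lτ)` has mass `1 - e^(-lT)` on a
period, so `w x` can be absorbed and a second difference appears in the formula for `b'`. -/
theorem periodic_system_deriv (ha : Function.Periodic a T) (hb : Function.Periodic b T) (hw : Continuous w)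
    (hda : ∀ x, HasDerivAt a (-(l * b x)) x) (hdb : ∀ x, HasDerivAt b (-(l * a x) - w x) x)
    (x : ℝ) :
    2 * (1 - Real.exp (-(l * T))) * (-(l * a x) - w x) =
      ∫ τ in (0 : ℝ)..T, l * Real.exp (-(l * τ)) * (w (x + τ) + w (x - τ) - 2 * w x) := by
  have h1 := periodic_solution_decay (l := l) (ha.add hb) hw
    (fun x => ((hda x).add (hdb x)).congr_deriv (by simp only [Pi.add_apply]; ring)) x
  have h2 := periodic_solution_growth (l := l) (ha.sub hb) hw
    (fun x => ((hda x).sub (hdb x)).congr_deriv (by simp only [Pi.sub_apply]; ring)) x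
  have h3 : ∫ τ in (0 : ℝ)..T, l * Real.exp (-(l * τ)) = 1 - Real.exp (-(l * T)) := by
    have hder : ∀ τ ∈ uIcc 0 T, HasDerivAt (fun τ => -Real.exp (-(l * τ)))
        (l * Real.exp (-(l * τ))) τ := by
      intro τ _
      have : HasDerivAt (fun τ : ℝ => -(l * τ)) (-l) τ := by
        simpa using (hasDerivAt_id τ).const_mul (-l)
      exact this.exp.neg.congr_deriv (by ring)
    rw [intervalIntegral.integral_eq_sub_of_hasDerivAt hder
      (Continuous.intervalIntegrable (by fun_prop) _ _)]
    simp
    ring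
  have e : ∀ τ, l * Real.exp (-(l * τ)) * (w (x + τ) + w (x - τ) - 2 * w x) =
      l * (Real.exp (-(l * τ)) * w (x + τ)) + l * (Real.exp (-(l * τ)) * w (x - τ))
        - l * Real.exp (-(l * τ)) * (2 * w x) := fun τ => by ring
  simp_rw [e]
  rw [intervalIntegral.integral_sub (Continuous.intervalIntegrable (by fun_prop) _ _)
    (Continuous.intervalIntegrable (by fun_prop) _ _),
    intervalIntegral.integral_add (Continuous.intervalIntegrable (by fun_prop) _ _)
    (Continuous.intervalIntegrable (by fun_prop) _ _), intervalIntegral.integral_const_mul,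
    intervalIntegral.integral_const_mul, intervalIntegral.integral_mul_const, h1, h2, h3]
  simp only [Pi.add_apply, Pi.sub_apply]
  ring

end PeriodicODE

/-! ### Decay of the solutions in the frequency -/

/-- Trades the exponential kernel for a power of `l τ`, separating the frequency from the
integration variable. -/
theorem exp_neg_le_rpow {x β : ℝ} (hx : 0 < x) (h0 : 0 ≤ β) (h2 : β ≤ 2) :
    Real.exp (-x) ≤ 2 * x ^ (-β) := by
  have h1 : x ^ β ≤ 1 + x ^ 2 := by
    rcases le_total x 1 with h | h
    · nlinarith [Real.rpow_le_one hx.le h h0, sq_nonneg x]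
    · have := Real.rpow_le_rpow_of_exponent_le h h2
      rw [Real.rpow_two] at this
      linarith
  have h3 : x ^ β ≤ 2 * Real.exp x := by
    nlinarith [Real.quadratic_le_exp_of_nonneg hx.le]
  rw [Real.exp_neg, Real.rpow_neg hx.le, ← div_eq_mul_inv, le_div_iff₀ (Real.rpow_pos_of_pos hx _),
    inv_mul_le_iff₀ (Real.exp_pos x)]
  linarith

theorem integral_rpow_zero_left {T r : ℝ} (hr : -1 < r) :
    ∫ τ in (0 : ℝ)..T, τ ^ r = T ^ (r + 1) / (r + 1) := by
  rw [integral_rpow (Or.inl hr), Real.zero_rpow (by linarith), sub_zero]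

theorem le_freq (m : ℕ) : (m : ℝ) ≤ freq m := by
  rw [freq]
  exact le_mul_of_one_le_right (Nat.cast_nonneg m) (by linarith [Real.pi_gt_three])

theorem freq_nonneg (m : ℕ) : 0 ≤ freq m := (Nat.cast_nonneg m).trans (le_freq m)

theorem one_le_freq_succ (m : ℕ) : 1 ≤ freq (m + 1) :=
  le_trans (by push_cast; linarith [(Nat.cast_nonneg m : (0 : ℝ) ≤ m)]) (le_freq (m + 1))

theorem gap_pos {T : ℝ} (hT : 0 < T) : 0 < 1 - Real.exp (-T) := by
  have : Real.exp (-T) < 1 := by rw [Real.exp_lt_one_iff]; linarith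
  linarith

/-- Makes the denominators `1 - e^(-lT)` uniform over the modes. -/
theorem gap_le {T l : ℝ} (hT : 0 < T) (hl : 1 ≤ l) :
    1 - Real.exp (-T) ≤ 1 - Real.exp (-(l * T)) := by
  have : Real.exp (-(l * T)) ≤ Real.exp (-T) := Real.exp_le_exp.2 (by nlinarith)
  linarith

section ODEBounds

variable {T : ℝ}

theorem abs_periodic_system_le (hT : 0 < T) {l : ℝ} (hl : 1 ≤ l) {a b w : ℝ → ℝ}
    (ha : Function.Periodic a T) (hb : Function.Periodic b T) (hw : Continuous w)
    (hda : ∀ x, HasDerivAt a (-(l * b x)) x) (hdb : ∀ x, HasDerivAt b (-(l * a x) - w x) x)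
    {N x : ℝ} (hN : ∀ τ ∈ Ioc 0 T, |w (x + τ) - w (x - τ)| ≤ N * τ ^ (1 / 2 : ℝ)) :
    |b x| ≤ 8 * T ^ (1 / 8 : ℝ) / (1 - Real.exp (-T)) * N * l ^ (-(11 / 8) : ℝ) := by
  have hl0 : 0 < l := by linarith
  have hκ := gap_pos hT
  have h1 := periodic_system_value ha hb hw hda hdb x
  have hbound : ‖∫ τ in (0 : ℝ)..T, Real.exp (-(l * τ)) * (w (x + τ) - w (x - τ))‖ ≤
      ∫ τ in (0 : ℝ)..T, 2 * l ^ (-(11 / 8) : ℝ) * N * τ ^ (-(7 / 8) : ℝ) := by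
    refine intervalIntegral.norm_integral_le_of_norm_le hT.le
      (Filter.Eventually.of_forall fun τ hτ => ?_)
      ((intervalIntegral.intervalIntegrable_rpow' (by norm_num)).const_mul _)
    have hτ0 := hτ.1
    -- Any exponent below `3/2` keeps `τ^(-β + 1/2)` integrable at `0`. The choice `11/8` leaves
    -- `9/8 > 1` after `1/4` is given up to Hölder continuity in `y`.
    have he := exp_neg_le_rpow (mul_pos hl0 hτ0) (β := 11 / 8) (by norm_num) (by norm_num)
    rw [norm_mul, Real.norm_of_nonneg (Real.exp_pos _).le, Real.norm_eq_abs]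
    calc _ ≤ (2 * (l * τ) ^ (-(11 / 8) : ℝ)) * (N * τ ^ (1 / 2 : ℝ)) :=
          mul_le_mul he (hN τ hτ) (abs_nonneg _) (by positivity)
      _ = 2 * l ^ (-(11 / 8) : ℝ) * N * (τ ^ (-(11 / 8) : ℝ) * τ ^ (1 / 2 : ℝ)) := by
          rw [Real.mul_rpow hl0.le hτ.1.le]
          ring
      _ = _ := by
          rw [← Real.rpow_add hτ.1]
          norm_num
  rw [intervalIntegral.integral_const_mul, integral_rpow_zero_left (by norm_num), ← h1, norm_mul,
    norm_mul, Real.norm_of_nonneg (by linarith [gap_le hT hl] : 0 ≤ 1 - Real.exp (-(l * T))),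
    Real.norm_eq_abs, Real.norm_eq_abs] at hbound
  norm_num at hbound
  have h2 : (1 - Real.exp (-T)) * |b x| ≤ 8 * T ^ (1 / 8 : ℝ) * N * l ^ (-(11 / 8) : ℝ) := by
    have := mul_le_mul_of_nonneg_right (gap_le hT hl) (abs_nonneg (b x))
    linarith
  calc |b x| = (1 - Real.exp (-T)) * |b x| / (1 - Real.exp (-T)) := by field_simp
    _ ≤ 8 * T ^ (1 / 8 : ℝ) * N * l ^ (-(11 / 8) : ℝ) / (1 - Real.exp (-T)) := by gcongr
    _ = _ := by ring

theorem sum_abs_deriv_periodic_system_le (hT : 0 < T) {l : ℕ → ℝ} (hl : ∀ m, 1 ≤ l m)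
    {a b w : ℕ → ℝ → ℝ} (ha : ∀ m, Function.Periodic (a m) T)
    (hb : ∀ m, Function.Periodic (b m) T) (hw : ∀ m, Continuous (w m))
    (hda : ∀ m x, HasDerivAt (a m) (-(l m * b m x)) x)
    (hdb : ∀ m x, HasDerivAt (b m) (-(l m * a m x) - w m x) x)
    {n : ℕ} {Z K x : ℝ} (hZ : ∑ m ∈ Finset.range n, l m ^ (-(3 / 2) : ℝ) ≤ Z) (hK0 : 0 ≤ K)
    (hK : ∀ τ ∈ Ioc 0 T, ∑ m ∈ Finset.range n,
      (w m (x + τ) + w m (x - τ) - 2 * w m x) ^ 2 ≤ (K * τ) ^ 2) :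
    ∑ m ∈ Finset.range n, |-(l m * a m x) - w m x| ≤
      4 * T ^ (1 / 4 : ℝ) / (1 - Real.exp (-T)) * √Z * K := by
  have hκ := gap_pos hT
  let Δ : ℕ → ℝ → ℝ := fun m τ => w m (x + τ) + w m (x - τ) - 2 * w m x
  have hterm : ∀ m, 2 * (1 - Real.exp (-T)) * |-(l m * a m x) - w m x| ≤
      ∫ τ in (0 : ℝ)..T, l m * Real.exp (-(l m * τ)) * |Δ m τ| := by
    intro m
    have h1 := periodic_system_deriv (ha m) (hb m) (hw m) (hda m) (hdb m) x
    have h2 : ‖∫ τ in (0 : ℝ)..T, l m * Real.exp (-(l m * τ)) * Δ m τ‖ ≤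
        ∫ τ in (0 : ℝ)..T, l m * Real.exp (-(l m * τ)) * |Δ m τ| := by
      refine (intervalIntegral.norm_integral_le_integral_norm hT.le).trans (le_of_eq ?_)
      refine intervalIntegral.integral_congr fun τ _ => ?_
      have hlm : 0 ≤ l m := by linarith [hl m]
      simp only [norm_mul, Real.norm_eq_abs, abs_of_nonneg hlm, Real.abs_exp]
    rw [← h1, norm_mul, norm_mul, Real.norm_of_nonneg
      (by linarith [gap_le hT (hl m)] : 0 ≤ 1 - Real.exp (-(l m * T))), Real.norm_eq_abs,
      Real.norm_eq_abs] at h2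
    norm_num at h2
    refine le_trans ?_ h2
    gcongr
    exact le_mul_of_one_le_left hT.le (hl m)
  have hΔc : ∀ m, Continuous (fun τ => l m * Real.exp (-(l m * τ)) * |Δ m τ|) := by
    intro m
    have := hw m
    fun_prop
  have hsum : 2 * (1 - Real.exp (-T)) * ∑ m ∈ Finset.range n, |-(l m * a m x) - w m x| ≤
      ∫ τ in (0 : ℝ)..T, ∑ m ∈ Finset.range n, l m * Real.exp (-(l m * τ)) * |Δ m τ| := by
    rw [intervalIntegral.integral_finsetSum fun m _ => (hΔc m).intervalIntegrable _ _,
      Finset.mul_sum]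
    exact Finset.sum_le_sum fun m _ => hterm m
  have hbound : ‖∫ τ in (0 : ℝ)..T, ∑ m ∈ Finset.range n, l m * Real.exp (-(l m * τ)) * |Δ m τ|‖ ≤
      ∫ τ in (0 : ℝ)..T, 2 * √Z * K * τ ^ (-(3 / 4) : ℝ) := by
    refine intervalIntegral.norm_integral_le_of_norm_le hT.le
      (Filter.Eventually.of_forall fun τ hτ => ?_)
      ((intervalIntegral.intervalIntegrable_rpow' (by norm_num)).const_mul _)
    have hτ0 := hτ.1
    have hl0 : ∀ m, 0 < l m := fun m => by linarith [hl m]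
    rw [Real.norm_of_nonneg (Finset.sum_nonneg fun m _ => by
      have := hl0 m
      positivity)]
    have h1 : ∀ m, l m * Real.exp (-(l m * τ)) * |Δ m τ| ≤
        2 * τ ^ (-(7 / 4) : ℝ) * (l m ^ (-(3 / 4) : ℝ) * |Δ m τ|) := by
      intro m
      -- With `7/4`, the frequency factor is `l^(1 - 7/4) = l^(-3/4)`, whose square has a bounded
      -- sum, and the factor `τ^(-7/4 + 1)` is integrable at `0`.
      have he := exp_neg_le_rpow (mul_pos (hl0 m) hτ0) (β := 7 / 4) (by norm_num) (by norm_num)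
      have e : l m * (2 * (l m * τ) ^ (-(7 / 4) : ℝ)) =
          2 * τ ^ (-(7 / 4) : ℝ) * l m ^ (-(3 / 4) : ℝ) := by
        rw [Real.mul_rpow (hl0 m).le hτ0.le, show (-(3 / 4) : ℝ) = 1 + -(7 / 4) by norm_num,
          Real.rpow_add (hl0 m), Real.rpow_one]
        ring
      rw [← mul_assoc, ← e]
      have := hl0 m
      gcongr
    -- Cauchy-Schwarz over the modes: the second differences are controlled only in `ℓ²`, uniformly
    -- in `n`.
    have h2 : ∑ m ∈ Finset.range n, l m ^ (-(3 / 4) : ℝ) * |Δ m τ| ≤ √Z * (K * τ) := by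
      refine (Real.sum_mul_le_sqrt_mul_sqrt _ _ _).trans ?_
      have e1 : ∀ m, (l m ^ (-(3 / 4) : ℝ)) ^ 2 = l m ^ (-(3 / 2) : ℝ) := by
        intro m
        rw [← Real.rpow_natCast, ← Real.rpow_mul (hl0 m).le]
        norm_num
      simp_rw [e1, sq_abs]
      refine mul_le_mul (Real.sqrt_le_sqrt hZ) ?_ (Real.sqrt_nonneg _) (Real.sqrt_nonneg _)
      exact Real.sqrt_le_iff.2 ⟨by positivity, hK τ hτ⟩
    calc _ ≤ ∑ m ∈ Finset.range n, 2 * τ ^ (-(7 / 4) : ℝ) * (l m ^ (-(3 / 4) : ℝ) * |Δ m τ|) :=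
          Finset.sum_le_sum fun m _ => h1 m
      _ ≤ 2 * τ ^ (-(7 / 4) : ℝ) * (√Z * (K * τ)) := by
          rw [← Finset.mul_sum]
          gcongr
      _ = 2 * √Z * K * (τ ^ (-(7 / 4) : ℝ) * τ ^ (1 : ℝ)) := by
          rw [Real.rpow_one]
          ring
      _ = _ := by
          rw [← Real.rpow_add hτ0]
          norm_num
  rw [intervalIntegral.integral_const_mul, integral_rpow_zero_left (by norm_num)] at hbound
  have h3 := (hsum.trans (le_abs_self _)).trans hbound
  norm_num at h3
  have h4 : (1 - Real.exp (-T)) * ∑ m ∈ Finset.range n, |-(l m * a m x) - w m x| ≤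
      4 * T ^ (1 / 4 : ℝ) * √Z * K := by linarith
  calc _ = (1 - Real.exp (-T)) * (∑ m ∈ Finset.range n, |-(l m * a m x) - w m x|)
        / (1 - Real.exp (-T)) := by field_simp
    _ ≤ 4 * T ^ (1 / 4 : ℝ) * √Z * K / (1 - Real.exp (-T)) := by gcongr
    _ = _ := by ring

end ODEBounds

/-! ### Velocity estimates from the vorticity -/

/-- Modulus of continuity, of order `1/2` in `x`, of the sine coefficients of the vorticity. -/
def CoeffHolder (T N : ℝ) (ω : ℝ → ℝ → ℝ) : Prop :=
  ∀ (m : ℕ) (x : ℝ), ∀ τ ∈ Ioc 0 T,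
    |sinCoeff ω m (x + τ) - sinCoeff ω m (x - τ)| ≤ N * τ ^ (1 / 2 : ℝ)

theorem abs_sin_sub_sin_le_rpow (a b : ℝ) {α : ℝ} (h0 : 0 ≤ α) (h1 : α ≤ 1) :
    |Real.sin a - Real.sin b| ≤ 2 * |a - b| ^ α := by
  have e : Real.sin a - Real.sin b =
      (Complex.exp (a * Complex.I) - Complex.exp (b * Complex.I)).im := by
    rw [Complex.sub_im, Complex.exp_ofReal_mul_I_im, Complex.exp_ofReal_mul_I_im]
  rw [e]
  exact (Complex.abs_im_le_norm _).trans (norm_cexp_mul_I_sub_le a b h0 h1)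

namespace PeriodicFlow

variable {T : ℝ} {u v : ℝ → ℝ → ℝ}

theorem continuous_sinCoeff_vorticity (h : PeriodicFlow T u v) {K : ℝ}
    (hω : ∀ x, ∀ y ∈ Ioo (-1 : ℝ) 1, |vorticity u v x y| ≤ K) (m : ℕ) :
    Continuous (sinCoeff (vorticity u v) m) :=
  continuous_integral_channel h.continuousOn_vorticity hω (continuous_sinMode m) (abs_sinMode_le m)

theorem abs_sinCoeff_v_le (h : PeriodicFlow T u v) (hT : 0 < T) {K : ℝ}
    (hω : ∀ x, ∀ y ∈ Ioo (-1 : ℝ) 1, |vorticity u v x y| ≤ K) {N : ℝ} (hN0 : 0 ≤ N)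
    (hN : CoeffHolder T N (vorticity u v)) (m : ℕ) (x : ℝ) :
    |sinCoeff v m x| ≤ 8 * T ^ (1 / 8 : ℝ) / (1 - Real.exp (-T)) * N * freq m ^ (-(11 / 8) : ℝ) := by
  have hκ := gap_pos hT
  cases m with
  -- The system estimate requires frequency at least `1`; the zero mode has zero coefficient.
  | zero =>
    simp only [sinCoeff, sinMode_zero, mul_zero, intervalIntegral.integral_zero, abs_zero]
    have := freq_nonneg 0
    positivity
  | succ m =>
    exact abs_periodic_system_le hT (one_le_freq_succ m) (h.cosCoeff_u_periodic _)
      (h.sinCoeff_v_periodic _) (h.continuous_sinCoeff_vorticity hω _)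
      (h.hasDerivAt_cosCoeff_u hT _) (h.hasDerivAt_sinCoeff_v hT hω _)
      (fun τ hτ => hN (m + 1) x τ hτ)

theorem hasSum_v (h : PeriodicFlow T u v) (hT : 0 < T) {K : ℝ}
    (hω : ∀ x, ∀ y ∈ Ioo (-1 : ℝ) 1, |vorticity u v x y| ≤ K) {N : ℝ} (hN0 : 0 ≤ N)
    (hN : CoeffHolder T N (vorticity u v)) (x : ℝ) {y : ℝ} (hy : y ∈ Icc (-1 : ℝ) 1) :
    HasSum (fun m => sinCoeff v m x * sinMode m y) (v x y) := by
  have hκ := gap_pos hT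
  refine hasSum_sinMode (v := v x) (h.continuous_v.comp (f := fun y => (x, y)) (by fun_prop)
    (fun y hy => hy)) (h.wall_bot x) (h.wall_top x) ?_ hy
  have hs : Summable fun m : ℕ => 8 * T ^ (1 / 8 : ℝ) / (1 - Real.exp (-T)) * N *
      (m : ℝ) ^ (-(11 / 8) : ℝ) :=
    (Real.summable_nat_rpow.2 (by norm_num)).mul_left _
  refine Summable.of_nonneg_of_le (fun m => abs_nonneg _) (fun m => ?_) hs
  refine (h.abs_sinCoeff_v_le hT hω hN0 hN m x).trans ?_
  rcases Nat.eq_zero_or_pos m with rfl | hm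
  · simp [freq]
  · gcongr 8 * T ^ (1 / 8 : ℝ) / (1 - Real.exp (-T)) * N * ?_
    exact Real.rpow_le_rpow_of_nonpos (by exact_mod_cast hm) (le_freq m) (by norm_num)

/-- Hölder estimate of the vertical velocity by the modulus of continuity of the vorticity. -/
theorem exists_holder_v {α : ℝ} (h0 : 0 < α) (h1 : α ≤ 1 / 4) (hT : 0 < T) :
    ∃ C : ℝ, 0 < C ∧ ∀ u v : ℝ → ℝ → ℝ, PeriodicFlow T u v → ∀ K : ℝ,
      (∀ x, ∀ y ∈ Ioo (-1 : ℝ) 1, |vorticity u v x y| ≤ K) → ∀ N : ℝ, 0 ≤ N →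
      CoeffHolder T N (vorticity u v) →
      ∀ x, ∀ y ∈ Icc (-1 : ℝ) 1, ∀ y' ∈ Icc (-1 : ℝ) 1,
        |v x y - v x y'| ≤ C * N * |y - y'| ^ α := by
  have hκ := gap_pos hT
  set c := 8 * T ^ (1 / 8 : ℝ) / (1 - Real.exp (-T)) with hc
  have hc0 : 0 < c := by positivity
  set Z := ∑' m : ℕ, (m : ℝ) ^ (-(9 / 8) : ℝ) with hZ
  have hZs : Summable fun m : ℕ => (m : ℝ) ^ (-(9 / 8) : ℝ) :=
    Real.summable_nat_rpow.2 (by norm_num)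
  have hZ0 : 0 ≤ Z := tsum_nonneg fun m => by positivity
  -- The bound `K` on the vorticity serves only continuity and convergence and does not enter the
  -- constant; the estimate is therefore linear in `N`, as the iteration requires.
  refine ⟨2 * c * (Z + 1), by positivity, fun u v h K hω N hN0 hN x y hy y' hy' => ?_⟩
  have hd := (h.hasSum_v hT hω hN0 hN x hy).sub (h.hasSum_v hT hω hN0 hN x hy')
  have hle : ∀ m : ℕ, ‖sinCoeff v m x * sinMode m y - sinCoeff v m x * sinMode m y'‖ ≤
      2 * c * N * |y - y'| ^ α * (m : ℝ) ^ (-(9 / 8) : ℝ) := by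
    intro m
    rcases Nat.eq_zero_or_pos m with rfl | hm
    · simp [sinMode_zero]
    have hm1 : (1 : ℝ) ≤ m := by exact_mod_cast hm
    have hf1 : 1 ≤ freq m := hm1.trans (le_freq m)
    have hf0 : 0 < freq m := by linarith
    rw [← mul_sub, norm_mul, Real.norm_eq_abs, Real.norm_eq_abs]
    have hs : |sinMode m y - sinMode m y'| ≤ 2 * (freq m ^ α * |y - y'| ^ α) := by
      have := abs_sin_sub_sin_le_rpow (freq m * (y + 1)) (freq m * (y' + 1)) h0.le (by linarith)
      rw [← mul_sub, abs_mul, abs_of_pos hf0, Real.mul_rpow hf0.le (abs_nonneg _)] at this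
      rw [add_sub_add_right_eq_sub] at this
      exact this
    calc _ ≤ (c * N * freq m ^ (-(11 / 8) : ℝ)) * (2 * (freq m ^ α * |y - y'| ^ α)) :=
          mul_le_mul (h.abs_sinCoeff_v_le hT hω hN0 hN m x) hs (abs_nonneg _) (by positivity)
      _ = 2 * c * N * |y - y'| ^ α * freq m ^ (-(11 / 8) + α) := by
          rw [Real.rpow_add hf0]
          ring
      _ ≤ 2 * c * N * |y - y'| ^ α * (m : ℝ) ^ (-(9 / 8) : ℝ) := by
          gcongr 2 * c * N * |y - y'| ^ α * ?_
          -- Here `α ≤ 1/4` gives the summable exponent `-9/8`.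
          calc freq m ^ (-(11 / 8) + α) ≤ freq m ^ (-(9 / 8) : ℝ) :=
                Real.rpow_le_rpow_of_exponent_le hf1 (by linarith)
            _ ≤ _ := Real.rpow_le_rpow_of_nonpos (by linarith) (le_freq m) (by norm_num)
  have := hd.norm_le_of_bounded (hZs.mul_left (2 * c * N * |y - y'| ^ α)).hasSum hle
  rw [tsum_mul_left, ← hZ, Real.norm_eq_abs] at this
  have hp : 0 ≤ |y - y'| ^ α := by positivity
  calc _ ≤ _ := this
    _ = 2 * c * Z * N * |y - y'| ^ α := by ring
    _ ≤ 2 * c * (Z + 1) * N * |y - y'| ^ α := by gcongr; linarith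

/-- Lipschitz estimate of the vertical velocity by second differences of the vorticity. -/
theorem exists_lipschitz_v (hT : 0 < T) :
    ∃ C : ℝ, 0 < C ∧ ∀ u v : ℝ → ℝ → ℝ, PeriodicFlow T u v → ∀ K₀ : ℝ,
      (∀ x, ∀ y ∈ Ioo (-1 : ℝ) 1, |vorticity u v x y| ≤ K₀) →
      (∃ N : ℝ, 0 ≤ N ∧ CoeffHolder T N (vorticity u v)) → ∀ K : ℝ, 0 ≤ K →
      (∀ x, ∀ τ ∈ Ioc 0 T, ∫ y in (-1 : ℝ)..1,
        (vorticity u v (x + τ) y + vorticity u v (x - τ) y - 2 * vorticity u v x y) ^ 2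
          ≤ (K * τ) ^ 2) →
      ∀ x x', ∀ y ∈ Icc (-1 : ℝ) 1, |v x' y - v x y| ≤ C * K * |x' - x| := by
  have hκ := gap_pos hT
  have hZs : Summable fun m : ℕ => ((m + 1 : ℕ) : ℝ) ^ (-(3 / 2) : ℝ) :=
    (summable_nat_add_iff 1 (f := fun m : ℕ => (m : ℝ) ^ (-(3 / 2) : ℝ))).2
      (Real.summable_nat_rpow.2 (by norm_num))
  set Z := ∑' m : ℕ, ((m + 1 : ℕ) : ℝ) ^ (-(3 / 2) : ℝ)
  set c := 4 * T ^ (1 / 4 : ℝ) / (1 - Real.exp (-T)) * √Z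
  have hc0 : 0 ≤ c := by positivity
  refine ⟨c + 1, by positivity, fun u v h K₀ hω ⟨N, hN0, hN⟩ K hK0 hK x x' y hy => ?_⟩
  have hb : ∀ m x, HasDerivAt (sinCoeff v (m + 1)) _ x := fun m x =>
    h.hasDerivAt_sinCoeff_v hT hω (m + 1) x
  have hsum : ∀ n x, ∑ m ∈ Finset.range n, |-(freq (m + 1) * cosCoeff u (m + 1) x) -
      sinCoeff (vorticity u v) (m + 1) x| ≤ c * K := by
    intro n x
    refine sum_abs_deriv_periodic_system_le hT one_le_freq_succ
      (fun m => h.cosCoeff_u_periodic (m + 1)) (fun m => h.sinCoeff_v_periodic (m + 1))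
      (fun m => h.continuous_sinCoeff_vorticity hω (m + 1))
      (fun m => h.hasDerivAt_cosCoeff_u hT (m + 1)) hb ?_ hK0 ?_
    · refine le_trans (Finset.sum_le_sum fun m _ => ?_)
        (hZs.sum_le_tsum (Finset.range n) (fun m _ => by positivity))
      exact Real.rpow_le_rpow_of_nonpos (by positivity) (le_freq (m + 1)) (by norm_num)
    · intro τ hτ
      have hii : ∀ x, IntegrableOn (fun y => vorticity u v x y) (Ioo (-1) 1) := by
        intro x
        refine IntegrableOn.of_bound (by simp) ?_ K₀ ?_
        · have : ContinuousOn (fun y => vorticity u v x y) (Ioo (-1) 1) :=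
            h.continuousOn_vorticity.comp (f := fun y => (x, y)) (by fun_prop) (fun y hy => hy)
          exact this.aestronglyMeasurable measurableSet_Ioo
        · exact (ae_restrict_iff' measurableSet_Ioo).2
            (Filter.Eventually.of_forall fun y hy => hω x y hy)
      have hi : ∀ x, IntervalIntegrable (fun y => vorticity u v x y) volume (-1) 1 := fun x =>
        (intervalIntegrable_iff_integrableOn_Ioo_of_le (by norm_num)).2 (hii x)
      have hg := ((hi (x + τ)).add (hi (x - τ))).sub ((hi x).const_mul 2)
      have hg2 : IntervalIntegrable (fun y => (vorticity u v (x + τ) y + vorticity u v (x - τ) y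
          - 2 * vorticity u v x y) ^ 2) volume (-1) 1 := by
        rw [intervalIntegrable_iff_integrableOn_Ioo_of_le (by norm_num)]
        refine IntegrableOn.of_bound (by simp) ?_ ((K₀ + K₀ + 2 * K₀) ^ 2) ?_
        · exact (((hii (x + τ)).1.add (hii (x - τ)).1).sub ((hii x).1.const_mul 2)).pow 2
        · refine (ae_restrict_iff' measurableSet_Ioo).2
            (Filter.Eventually.of_forall fun y hy => ?_)
          have e1 := abs_le.1 (hω (x + τ) y hy)
          have e2 := abs_le.1 (hω (x - τ) y hy)
          have e3 := abs_le.1 (hω x y hy)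
          rw [Real.norm_of_nonneg (sq_nonneg _)]
          refine sq_le_sq' ?_ ?_ <;> linarith [e1.1, e1.2, e2.1, e2.2, e3.1, e3.2]
      -- Second differences of the coefficients are the sine coefficients of the second difference
      -- of `ω`, so Bessel applies.
      refine le_trans (le_of_eq ?_) ((sum_sq_integral_sinMode_le hg hg2 n).trans (hK x τ hτ))
      refine Finset.sum_congr rfl fun m _ => ?_
      have hs : ∀ x, IntervalIntegrable
          (fun y => vorticity u v x y * sinMode (m + 1) y) volume (-1) 1 := fun x =>
        (hi x).mul_continuousOn (by fun_prop)
      have e : ∀ y, (vorticity u v (x + τ) y + vorticity u v (x - τ) y - 2 * vorticity u v x y)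
          * sinMode (m + 1) y = vorticity u v (x + τ) y * sinMode (m + 1) y
            + vorticity u v (x - τ) y * sinMode (m + 1) y
            - 2 * (vorticity u v x y * sinMode (m + 1) y) := fun y => by ring
      simp_rw [e]
      rw [intervalIntegral.integral_sub ((hs _).add (hs _)) ((hs x).const_mul 2),
        intervalIntegral.integral_add (hs _) (hs _), intervalIntegral.integral_const_mul]
      rfl
  -- The Lipschitz bound is uniform over partial sums and passes to the limit; `N` is used only to
  -- know that the series converges to `v`.
  have hpart : ∀ n, |(∑ m ∈ Finset.range (n + 1), sinCoeff v m x' * sinMode m y) -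
      ∑ m ∈ Finset.range (n + 1), sinCoeff v m x * sinMode m y| ≤ c * K * |x' - x| := by
    intro n
    rw [Finset.sum_range_succ', Finset.sum_range_succ']
    simp only [sinMode_zero, mul_zero, add_zero]
    have hder : ∀ z, HasDerivAt
        (fun z => ∑ m ∈ Finset.range n, sinCoeff v (m + 1) z * sinMode (m + 1) y)
        (∑ m ∈ Finset.range n, (-(freq (m + 1) * cosCoeff u (m + 1) z) -
          sinCoeff (vorticity u v) (m + 1) z) * sinMode (m + 1) y) z := fun z =>
      HasDerivAt.fun_sum fun m _ => (hb m z).mul_const _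
    have := convex_univ.norm_image_sub_le_of_norm_hasDerivWithin_le (C := c * K)
      (fun z _ => (hder z).hasDerivWithinAt) (fun z _ => ?_) (mem_univ x) (mem_univ x')
    · simpa [Real.norm_eq_abs] using this
    · refine (norm_sum_le _ _).trans (le_trans (Finset.sum_le_sum fun m _ => ?_) (hsum n z))
      rw [norm_mul, Real.norm_eq_abs, Real.norm_eq_abs]
      exact mul_le_of_le_one_right (abs_nonneg _) (abs_sinMode_le _ _)
  have hlim := (((h.hasSum_v hT hω hN0 hN x' hy).tendsto_sum_nat.sub
    (h.hasSum_v hT hω hN0 hN x hy).tendsto_sum_nat).abs).comp (Filter.tendsto_add_atTop_nat 1)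
  have := le_of_tendsto hlim (Filter.Eventually.of_forall hpart)
  refine this.trans ?_
  gcongr
  linarith

end PeriodicFlow

/-! ### Bernoulli function and regular representative of the vorticity -/

/-- The Bernoulli function: its gradient is the velocity in the moving frame, rotated and multiplied
by the vorticity. -/
def IsBernoulli (c : ℝ) (u v H : ℝ → ℝ → ℝ) : Prop :=
  ∀ x, ∀ y ∈ Ioo (-1 : ℝ) 1,
    HasDerivAt (fun x' => H x' y) (-(v x y * vorticity u v x y)) x ∧
      HasDerivAt (fun y' => H x y') ((u x y - c) * vorticity u v x y) y

theorem IsTravellingSolution.periodicFlow {T c : ℝ} {u v : ℝ → ℝ → ℝ}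
    (h : IsTravellingSolution c u v) (hu : HasXPeriod T u) (hv : HasXPeriod T v) :
    PeriodicFlow T u v := by
  obtain ⟨P, h⟩ := h
  have hmap : ∀ s : Set ℝ, MapsTo (fun p : ℝ × ℝ => ((0 : ℝ), p)) {p | p.2 ∈ s}
      {p : ℝ × ℝ × ℝ | p.2.2 ∈ s} := fun s p hp => hp
  refine ⟨?_, ?_, ?_, ?_, fun x y hy => ?_, fun x => ?_, fun x => ?_, hu, hv⟩
  · have := h.continuous_u.comp (by fun_prop) (hmap _)
    simp only [Function.comp_def, mul_zero, sub_zero] at this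
    exact this
  · have := h.continuous_v.comp (by fun_prop) (hmap _)
    simp only [Function.comp_def, mul_zero, sub_zero] at this
    exact this
  · have := h.contDiff_u.comp (contDiff_const.prodMk contDiff_id).contDiffOn (hmap _)
    simp only [Function.comp_def, mul_zero, sub_zero] at this
    exact this
  · have := h.contDiff_v.comp (contDiff_const.prodMk contDiff_id).contDiffOn (hmap _)
    simp only [Function.comp_def, mul_zero, sub_zero] at this
    exact this
  · simpa using h.incompressible 0 x y hy
  · simpa using h.wall_bot 0 x
  · simpa using h.wall_top 0 x

/-- At `t = 0`, `∂_t = -c ∂_x` on the velocity, so the momentum equations say that pressure plus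
half the squared speed in the moving frame has the required gradient. -/
theorem IsTravellingSolution.exists_bernoulli {T c : ℝ} {u v : ℝ → ℝ → ℝ}
    (h : IsTravellingSolution c u v) (hf : PeriodicFlow T u v) :
    ∃ H : ℝ → ℝ → ℝ, IsBernoulli c u v H := by
  obtain ⟨P, h⟩ := h
  refine ⟨fun x y => P 0 x y + ((u x y - c) ^ 2 + v x y ^ 2) / 2, fun x y hy => ?_⟩
  have hux := (hasDerivAt_fst hf.contDiff_u (x := x) hy).differentiableAt.hasDerivAt
  have huy := (hasDerivAt_snd hf.contDiff_u (x := x) hy).differentiableAt.hasDerivAt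
  have hvx := (hasDerivAt_fst hf.contDiff_v (x := x) hy).differentiableAt.hasDerivAt
  have hvy := (hasDerivAt_snd hf.contDiff_v (x := x) hy).differentiableAt.hasDerivAt
  have hP : DifferentiableAt ℝ (fun p : ℝ × ℝ => P 0 p.1 p.2) (x, y) :=
    (h.differentiable_P 0).differentiableAt
      (isOpen_channel.mem_nhds (show (x, y) ∈ channel from hy))
  have hPx : DifferentiableAt ℝ (fun x' => P 0 x' y) x := by
    have : DifferentiableAt ℝ (fun x' : ℝ => (x', y)) x := by fun_prop
    exact hP.comp x this
  have hPy : DifferentiableAt ℝ (fun y' => P 0 x y') y := by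
    have : DifferentiableAt ℝ (fun y' : ℝ => (x, y')) y := by fun_prop
    exact hP.comp y this
  have hdiv := hf.incompressible x y hy
  have ht : ∀ g : ℝ → ℝ → ℝ, ∀ g', HasDerivAt (fun x' => g x' y) g' x →
      deriv (fun t' => g (x - c * t') y) 0 = -c * g' := by
    intro g g' hg
    have h1 : HasDerivAt (fun t' : ℝ => x - c * t') (-c) 0 := by
      simpa using ((hasDerivAt_id (0 : ℝ)).const_mul c).const_sub x
    have h2 : HasDerivAt (fun x' => g x' y) g' (x - c * 0) := by simpa using hg
    have := h2.comp 0 h1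
    rw [mul_comm]
    exact this.deriv
  have hmx := h.momentum_x 0 x y hy
  have hmy := h.momentum_y 0 x y hy
  rw [ht u _ hux] at hmx
  rw [ht v _ hvx] at hmy
  simp only [mul_zero, sub_zero] at hmx hmy
  constructor
  · have h1 := hPx.hasDerivAt.add ((((hux.sub_const c).pow 2).add (hvx.pow 2)).div_const 2)
    refine h1.congr_deriv ?_
    rw [vorticity]
    simp only [Nat.cast_ofNat, Nat.add_one_sub_one, pow_one]
    linear_combination hmx
  · have h1 := hPy.hasDerivAt.add ((((huy.sub_const c).pow 2).add (hvy.pow 2)).div_const 2)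
    refine h1.congr_deriv ?_
    rw [vorticity]
    simp only [Nat.cast_ofNat, Nat.add_one_sub_one, pow_one]
    linear_combination hmy

/-- A periodic flow whose vorticity is, on a period cell, `1 + f`, where `f` is bounded by `E` and
of class `C^{1,α}` on almost every line parallel to an axis. -/
structure RegularVorticity (T α E : ℝ) (u v f : ℝ → ℝ → ℝ) (A B : ℝ → ℝ) : Prop where
  flow : PeriodicFlow T u v
  continuous : Continuous (fun q : ℝ × ℝ => f q.1 q.2)
  bound : ∀ x y, |f x y| ≤ E
  vorticity_eq : ∀ x ∈ Icc 0 T, ∀ y ∈ Ioo (-1 : ℝ) 1, vorticity u v x y = 1 + f x y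
  measurable_A : Measurable A
  nonneg_A : ∀ x, 0 ≤ A x
  integrable_A : Integrable (fun x => A x ^ 2)
  integral_A : ∫ x, A x ^ 2 ≤ E ^ 2
  slice_A : ∀ᵐ x, HolderSlice α (A x) (fun y => f x y)
  measurable_B : Measurable B
  nonneg_B : ∀ y, 0 ≤ B y
  integrable_B : Integrable (fun y => B y ^ 2)
  integral_B : ∫ y, B y ^ 2 ≤ E ^ 2
  slice_B : ∀ᵐ y, HolderSlice α (B y) (fun x => f x y)

/-- An almost optimal extension of `ω - 1` has a regular representative, and both are continuous, so
they agree everywhere on the cell. The constant does not depend on `T`. -/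
theorem PeriodicFlow.exists_regularVorticity {s α : ℝ} (h0 : 0 < α) (h1 : α ≤ 1)
    (hs : α < s - 3 / 2) :
    ∃ C : ℝ, 0 < C ∧ ∀ (T : ℝ) (u v : ℝ → ℝ → ℝ), 0 < T → PeriodicFlow T u v → ∀ ε : ℝ, 0 ≤ ε →
      sobolevNormOn s (cell T) (fun x y => vorticity u v x y - 1) < ENNReal.ofReal ε →
      ∃ f A B, RegularVorticity T α (C * ε) u v f A B := by
  obtain ⟨C, hC, hrep⟩ := exists_regular_representative h0 h1 hs
  refine ⟨C, hC, fun T u v hT h ε hε hn => ?_⟩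
  simp only [sobolevNormOn, iInf_lt_iff] at hn
  obtain ⟨F, hF, hFn⟩ := hn
  obtain ⟨f, hfc, hfb, hfF, ⟨A, hA1, hA2, hA3, hA4, hA5⟩, ⟨B, hB1, hB2, hB3, hB4, hB5⟩⟩ :=
    hrep F ε hε hFn
  refine ⟨f, A, B, h, hfc, hfb, ?_, hA1, hA2, hA3, hA4, hA5, hB1, hB2, hB3, hB4, hB5⟩
  let Q : Set (ℝ × ℝ) := Ioo 0 T ×ˢ Ioo (-1 : ℝ) 1
  have hQ : IsOpen Q := isOpen_Ioo.prod isOpen_Ioo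
  have hcell : prodPlane ⁻¹' (cell T) = Q := by
    ext q
    simp [cell, prodPlane_zero, prodPlane_one, Q]
  have hae : ∀ᵐ q : ℝ × ℝ, q ∈ Q → vorticity u v q.1 q.2 = 1 + f q.1 q.2 := by
    have hmc : MeasurableSet (cell T) := by
      rw [← prodPlane.measurableSet_preimage, hcell]
      exact hQ.measurableSet
    have h2 := (ae_restrict_iff' hmc).1 hF
    have h3 : ∀ᵐ p : Plane, p ∈ cell T → vorticity u v (p 0) (p 1) = 1 + f (p 0) (p 1) := by
      filter_upwards [h2, hfF] with p hp1 hp2 hp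
      have e1 := congrArg Complex.re (hp1 hp)
      rw [hp2, Complex.ofReal_re] at e1
      linarith
    have h4 := measurePreserving_prodPlane.quasiMeasurePreserving.ae h3
    filter_upwards [h4] with q hq hqQ
    rw [← hcell] at hqQ
    exact hq hqQ
  have heq : EqOn (fun q : ℝ × ℝ => vorticity u v q.1 q.2) (fun q => 1 + f q.1 q.2) Q := by
    refine Measure.eqOn_open_of_ae_eq (μ := (volume : Measure (ℝ × ℝ)))
      ((ae_restrict_iff' hQ.measurableSet).2 hae) hQ ?_ ?_
    · exact h.continuousOn_vorticity.mono fun q hq => hq.2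
    · exact (continuous_const.add hfc).continuousOn
  intro x hx y hy
  have hc1 : Continuous (fun x => vorticity u v x y) :=
    h.continuousOn_vorticity.comp_continuous (f := fun x => (x, y)) (by fun_prop) (fun x => hy)
  have hc2 : Continuous (fun x => 1 + f x y) :=
    continuous_const.add (hfc.comp (by fun_prop : Continuous fun x : ℝ => (x, y)))
  -- Agreement extends to `x = 0` and `x = T`. This is needed later to chain increments across a
  -- period, because the extension `f` itself need not be periodic.
  have := EqOn.closure (s := Ioo 0 T) (f := fun x => vorticity u v x y) (g := fun x => 1 + f x y)
    (fun x hx => heq (show (x, y) ∈ Q from ⟨hx, hy⟩)) hc1 hc2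
  rw [closure_Ioo hT.ne] at this
  exact this hx

/-! ### The vorticity equation almost everywhere -/

/-- An integrable function with vanishing integral over all rectangles in an open set vanishes
almost everywhere there. -/
theorem ae_eq_zero_of_setIntegral_rectangle {Φ : ℝ × ℝ → ℝ} {Q : Set (ℝ × ℝ)} (hΦ : Integrable Φ)
    (hQ : IsOpen Q)
    (h : ∀ x₁ x₂ y₁ y₂ : ℝ, x₁ ≤ x₂ → y₁ ≤ y₂ → Icc x₁ x₂ ×ˢ Icc y₁ y₂ ⊆ Q →
      ∫ q in Icc x₁ x₂ ×ˢ Icc y₁ y₂, Φ q = 0) :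
    ∀ᵐ q, q ∈ Q → Φ q = 0 := by
  -- Lebesgue differentiation; closed balls of the product metric are squares, hence rectangles.
  filter_upwards [IsUnifLocDoublingMeasure.ae_tendsto_average (volume : Measure (ℝ × ℝ))
    hΦ.locallyIntegrable 1] with q hq hqQ
  have hδ : Filter.Tendsto (fun n : ℕ => 1 / ((n : ℝ) + 1)) Filter.atTop (nhdsWithin 0 (Ioi 0)) :=
    tendsto_nhdsWithin_iff.2 ⟨tendsto_one_div_add_atTop_nhds_zero_nat,
      Filter.Eventually.of_forall fun n => by simp only [mem_Ioi]; positivity⟩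
  have hlim := hq (fun _ => q) _ hδ (Filter.Eventually.of_forall fun n => by
    simp only [one_mul]
    exact Metric.mem_closedBall_self (by positivity))
  obtain ⟨r, hr, hrQ⟩ := Metric.isOpen_iff.1 hQ q hqQ
  have hev : ∀ᶠ n : ℕ in Filter.atTop,
      (⨍ z in Metric.closedBall q (1 / ((n : ℝ) + 1)), Φ z) = 0 := by
    have h0 := tendsto_one_div_add_atTop_nhds_zero_nat (𝕜 := ℝ)
    filter_upwards [h0.eventually (gt_mem_nhds hr)] with n hn
    have hball : Metric.closedBall q (1 / ((n : ℝ) + 1)) =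
        Icc (q.1 - 1 / ((n : ℝ) + 1)) (q.1 + 1 / ((n : ℝ) + 1)) ×ˢ
          Icc (q.2 - 1 / ((n : ℝ) + 1)) (q.2 + 1 / ((n : ℝ) + 1)) := by
      rw [← Real.closedBall_eq_Icc, ← Real.closedBall_eq_Icc, closedBall_prod_same]
    have hp : 0 < 1 / ((n : ℝ) + 1) := by positivity
    rw [setAverage_eq, hball, h _ _ _ _ (by linarith) (by linarith), smul_zero]
    rw [← hball]
    exact (Metric.closedBall_subset_ball hn).trans hrQ
  exact tendsto_nhds_unique hlim (tendsto_const_nhds.congr' (hev.mono fun n hn => hn.symm))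

theorem setIntegral_Icc_eq_sub {g g' : ℝ → ℝ} {a b : ℝ} (hab : a ≤ b)
    (hd : ∀ x ∈ Icc a b, HasDerivAt g (g' x) x) (hi : IntegrableOn g' (Icc a b)) :
    ∫ x in Icc a b, g' x = g b - g a := by
  rw [integral_Icc_eq_integral_Ioc, ← intervalIntegral.integral_of_le hab]
  refine intervalIntegral.integral_eq_sub_of_hasDerivAt (fun x hx => hd x ?_) ?_
  · rwa [uIcc_of_le hab] at hx
  · rw [intervalIntegrable_iff_integrableOn_Icc_of_le hab]
    exact hi

namespace RegularVorticity

variable {T α E : ℝ} {u v f : ℝ → ℝ → ℝ} {A B : ℝ → ℝ}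

theorem measurable_deriv_snd (h : RegularVorticity T α E u v f A B)
    : Measurable (fun q : ℝ × ℝ => deriv (fun y' => f q.1 y') q.2) :=
  measurable_deriv_with_param (f := f) h.continuous

theorem measurable_deriv_fst (h : RegularVorticity T α E u v f A B)
    : Measurable (fun q : ℝ × ℝ => deriv (fun x' => f x' q.2) q.1) := by
  have := measurable_deriv_with_param (f := fun y x => f x y)
    (h.continuous.comp (by fun_prop : Continuous fun q : ℝ × ℝ => (q.2, q.1)))
  exact this.comp measurable_swap

theorem ae_deriv_snd_le (h : RegularVorticity T α E u v f A B)
    : ∀ᵐ q : ℝ × ℝ, |deriv (fun y' => f q.1 y') q.2| ≤ A q.1 := by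
  have := (Measure.quasiMeasurePreserving_fst (μ := (volume : Measure ℝ))
    (ν := (volume : Measure ℝ))).ae h.slice_A
  filter_upwards [this] with q hq
  exact hq.2.1 q.2

theorem ae_deriv_fst_le (h : RegularVorticity T α E u v f A B)
    : ∀ᵐ q : ℝ × ℝ, |deriv (fun x' => f x' q.2) q.1| ≤ B q.2 := by
  have := (Measure.quasiMeasurePreserving_snd (μ := (volume : Measure ℝ))
    (ν := (volume : Measure ℝ))).ae h.slice_B
  filter_upwards [this] with q hq
  exact hq.2.1 q.1

theorem integrableOn_A (h : RegularVorticity T α E u v f A B)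
    (a b : ℝ) : IntegrableOn A (Ioo a b) := by
  have : IntegrableOn (fun x => 1 + A x ^ 2) (Ioo a b) :=
    (integrableOn_const (by simp)).add h.integrable_A.integrableOn
  refine this.mono' h.measurable_A.aestronglyMeasurable (Filter.Eventually.of_forall fun x => ?_)
  rw [Real.norm_of_nonneg (h.nonneg_A x)]
  nlinarith [sq_nonneg (A x - 1), h.nonneg_A x]

theorem integrableOn_B (h : RegularVorticity T α E u v f A B)
    (a b : ℝ) : IntegrableOn B (Ioo a b) := by
  have : IntegrableOn (fun x => 1 + B x ^ 2) (Ioo a b) :=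
    (integrableOn_const (by simp)).add h.integrable_B.integrableOn
  refine this.mono' h.measurable_B.aestronglyMeasurable (Filter.Eventually.of_forall fun x => ?_)
  rw [Real.norm_of_nonneg (h.nonneg_B x)]
  nlinarith [sq_nonneg (B x - 1), h.nonneg_B x]

theorem integrableOn_deriv_snd (h : RegularVorticity T α E u v f A B) (a b c d : ℝ) :
    IntegrableOn (fun q : ℝ × ℝ => deriv (fun y' => f q.1 y') q.2) (Ioo a b ×ˢ Ioo c d) := by
  have h1 : IntegrableOn (fun q : ℝ × ℝ => A q.1) (Ioo a b ×ˢ Ioo c d) := by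
    rw [IntegrableOn, Measure.volume_eq_prod, ← Measure.prod_restrict]
    exact Integrable.comp_fst (h.integrableOn_A a b) _
  exact h1.mono' h.measurable_deriv_snd.aestronglyMeasurable (ae_restrict_of_ae h.ae_deriv_snd_le)

theorem integrableOn_deriv_fst (h : RegularVorticity T α E u v f A B) (a b c d : ℝ) :
    IntegrableOn (fun q : ℝ × ℝ => deriv (fun x' => f x' q.2) q.1) (Ioo a b ×ˢ Ioo c d) := by
  have h1 : IntegrableOn (fun q : ℝ × ℝ => B q.2) (Ioo a b ×ˢ Ioo c d) := by
    rw [IntegrableOn, Measure.volume_eq_prod, ← Measure.prod_restrict]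
    exact Integrable.comp_snd (h.integrableOn_B c d) _
  exact h1.mono' h.measurable_deriv_fst.aestronglyMeasurable (ae_restrict_of_ae h.ae_deriv_fst_le)

/-- The vorticity equation holds almost everywhere. -/
theorem ae_vorticity_equation (h : RegularVorticity T α E u v f A B)
    (hT : 0 < T) {c : ℝ} {H : ℝ → ℝ → ℝ} (hH : IsBernoulli c u v H) :
    ∀ᵐ q : ℝ × ℝ, q ∈ Ioo 0 T ×ˢ Ioo (-1 : ℝ) 1 →
      (u q.1 q.2 - c) * deriv (fun x' => f x' q.2) q.1
        + v q.1 q.2 * deriv (fun y' => f q.1 y') q.2 = 0 := by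
  set Q : Set (ℝ × ℝ) := Ioo 0 T ×ˢ Ioo (-1 : ℝ) 1 with hQdef
  have hQ : IsOpen Q := isOpen_Ioo.prod isOpen_Ioo
  have hQch : Q ⊆ channel := fun q hq => hq.2
  set fx : ℝ × ℝ → ℝ := fun q => deriv (fun x' => f x' q.2) q.1
  set fy : ℝ × ℝ → ℝ := fun q => deriv (fun y' => f q.1 y') q.2
  obtain ⟨Ku, hKu⟩ := exists_bound_of_periodic hT h.flow.continuous_u h.flow.periodic_u
  obtain ⟨Kv, hKv⟩ := exists_bound_of_periodic hT h.flow.continuous_v h.flow.periodic_v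
  have huc : ContinuousOn (fun q : ℝ × ℝ => u q.1 q.2 - c) Q :=
    (h.flow.continuous_u.mono (hQch.trans channel_subset_closedChannel)).sub continuousOn_const
  have hvc : ContinuousOn (fun q : ℝ × ℝ => v q.1 q.2) Q :=
    h.flow.continuous_v.mono (hQch.trans channel_subset_closedChannel)
  have hi1 : IntegrableOn (fun q => (u q.1 q.2 - c) * fx q) Q := by
    refine Integrable.bdd_mul (c := Ku + |c|) (h.integrableOn_deriv_fst _ _ _ _)
      (huc.aestronglyMeasurable hQ.measurableSet)
      ((ae_restrict_iff' hQ.measurableSet).2 (Filter.Eventually.of_forall fun q hq => ?_))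
    refine (norm_sub_le _ _).trans (add_le_add ?_ le_rfl)
    exact hKu q.1 q.2 (Ioo_subset_Icc_self hq.2)
  have hi2 : IntegrableOn (fun q => v q.1 q.2 * fy q) Q := by
    refine Integrable.bdd_mul (c := Kv) (h.integrableOn_deriv_snd _ _ _ _)
      (hvc.aestronglyMeasurable hQ.measurableSet)
      ((ae_restrict_iff' hQ.measurableSet).2 (Filter.Eventually.of_forall fun q hq => ?_))
    exact hKv q.1 q.2 (Ioo_subset_Icc_self hq.2)
  let G : ℝ × ℝ → ℝ := fun q => (u q.1 q.2 - c) * fx q + v q.1 q.2 * fy q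
  have hG : IntegrableOn G Q := hi1.add hi2
  -- Formally this is the curl of the gradient of `H`, but `H` need not have second derivatives. The
  -- integrated form suffices: fluxes through the sides of a rectangle are differences of `H` at its
  -- corners.
  have key := ae_eq_zero_of_setIntegral_rectangle (Φ := Q.indicator G)
    ((integrable_indicator_iff hQ.measurableSet).2 hG) hQ ?_
  · filter_upwards [key] with q hq hqQ
    have := hq hqQ
    rwa [indicator_of_mem hqQ] at this
  intro x₁ x₂ y₁ y₂ hx hy hR
  set R : Set (ℝ × ℝ) := Icc x₁ x₂ ×ˢ Icc y₁ y₂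
  have hRm : MeasurableSet R := measurableSet_Icc.prod measurableSet_Icc
  have hRc : IsCompact R := isCompact_Icc.prod isCompact_Icc
  rw [setIntegral_congr_fun hRm (fun q hq => indicator_of_mem (hR hq) G)]
  have hxm : ∀ x ∈ Icc x₁ x₂, x ∈ Ioo 0 T := fun x hx' =>
    (hR (show (x, y₁) ∈ R from ⟨hx', left_mem_Icc.2 hy⟩)).1
  have hym : ∀ y ∈ Icc y₁ y₂, y ∈ Ioo (-1 : ℝ) 1 := fun y hy' =>
    (hR (show (x₁, y) ∈ R from ⟨left_mem_Icc.2 hx, hy'⟩)).2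
  let ux : ℝ × ℝ → ℝ := fun q => deriv (fun x' => u x' q.2) q.1
  let vy : ℝ × ℝ → ℝ := fun q => deriv (fun y' => v q.1 y') q.2
  have hone : Continuous (fun q : ℝ × ℝ => 1 + f q.1 q.2) := continuous_const.add h.continuous
  -- `Φ₁` and `Φ₂` are the product-rule forms of `∂_y (v ω)` and `∂_x ((u - c) ω)`, valid on almost
  -- every line; incompressibility cancels the terms without derivatives of `f`.
  let Φ₁ : ℝ × ℝ → ℝ := fun q => vy q * (1 + f q.1 q.2) + v q.1 q.2 * fy q
  let Φ₂ : ℝ × ℝ → ℝ := fun q => ux q * (1 + f q.1 q.2) + (u q.1 q.2 - c) * fx q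
  have hΦ₁ : IntegrableOn Φ₁ R := by
    refine IntegrableOn.add (ContinuousOn.integrableOn_compact hRc ?_) (hi2.mono_set hR)
    exact ((continuousOn_deriv_snd h.flow.contDiff_v).mono (hR.trans hQch)).mul hone.continuousOn
  have hΦ₂ : IntegrableOn Φ₂ R := by
    refine IntegrableOn.add (ContinuousOn.integrableOn_compact hRc ?_) (hi1.mono_set hR)
    exact ((continuousOn_deriv_fst h.flow.contDiff_u).mono (hR.trans hQch)).mul hone.continuousOn
  have hsum : ∫ q in R, G q = (∫ q in R, Φ₁ q) + ∫ q in R, Φ₂ q := by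
    rw [← integral_add hΦ₁ hΦ₂]
    refine setIntegral_congr_fun hRm fun q hq => ?_
    have := h.flow.incompressible q.1 q.2 (hR hq).2
    simp only [G, Φ₁, Φ₂, ux, vy]
    linear_combination -(1 + f q.1 q.2) * this
  have hωx : ∀ y ∈ Icc y₁ y₂, ∀ x ∈ Icc x₁ x₂, vorticity u v x y = 1 + f x y := fun y hy' x hx' =>
    h.vorticity_eq x (Ioo_subset_Icc_self (hxm x hx')) y (hym y hy')
  have hf1 : ∀ y, Continuous (fun x => f x y) := fun y =>
    h.continuous.comp (by fun_prop : Continuous fun x : ℝ => (x, y))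
  have hf2 : ∀ x, Continuous (fun y => f x y) := fun x =>
    h.continuous.comp (by fun_prop : Continuous fun y : ℝ => (x, y))
  have hv1 : ∀ y ∈ Icc y₁ y₂, Continuous (fun x => v x y) := fun y hy' =>
    h.flow.continuous_v.comp_continuous (f := fun x => (x, y)) (by fun_prop)
      (fun x => Ioo_subset_Icc_self (hym y hy'))
  have hu2 : ∀ x, ContinuousOn (fun y => u x y) (Icc y₁ y₂) := fun x =>
    h.flow.continuous_u.comp (f := fun y => (x, y)) (by fun_prop)
      (fun y hy' => Ioo_subset_Icc_self (hym y hy'))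
  have hHx : ∀ y ∈ Icc y₁ y₂,
      ∫ x in Icc x₁ x₂, v x y * (1 + f x y) = -(H x₂ y - H x₁ y) := by
    intro y hy'
    rw [← neg_inj, ← integral_neg, neg_neg]
    refine setIntegral_Icc_eq_sub (g := fun x => H x y) hx (fun x hx' => ?_) ?_
    · rw [← hωx y hy' x hx']
      exact (hH x y (hym y hy')).1
    · exact ((hv1 y hy').mul (continuous_const.add (hf1 y))).neg.continuousOn.integrableOn_Icc
  have hHy : ∀ x ∈ Icc x₁ x₂,
      ∫ y in Icc y₁ y₂, (u x y - c) * (1 + f x y) = H x y₂ - H x y₁ := by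
    intro x hx'
    refine setIntegral_Icc_eq_sub (g := fun y => H x y) hy (fun y hy' => ?_) ?_
    · rw [← hωx y hy' x hx']
      exact (hH x y (hym y hy')).2
    · exact (((hu2 x).sub continuousOn_const).mul
        (continuous_const.add (hf2 x)).continuousOn).integrableOn_Icc
  have e1 : ∫ q in R, Φ₁ q = -(H x₂ y₂ - H x₁ y₂) + (H x₂ y₁ - H x₁ y₁) := by
    have hint : Integrable Φ₁ ((volume.restrict (Icc x₁ x₂)).prod (volume.restrict (Icc y₁ y₂))) := by
      rw [Measure.prod_restrict]
      exact hΦ₁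
    have hinner : ∀ᵐ x ∂(volume.restrict (Icc x₁ x₂)), ∫ y in Icc y₁ y₂, Φ₁ (x, y) =
        v x y₂ * (1 + f x y₂) - v x y₁ * (1 + f x y₁) := by
      filter_upwards [hint.prod_right_ae, ae_restrict_of_ae h.slice_A] with x hxi hxA
      refine setIntegral_Icc_eq_sub (g := fun y => v x y * (1 + f x y)) hy (fun y hy' => ?_) hxi
      have d1 := (hasDerivAt_snd h.flow.contDiff_v (x := x) (hym y hy')).differentiableAt.hasDerivAt
      have d2 := (hxA.1 y).hasDerivAt
      exact d1.mul (d2.const_add 1)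
    have hcI : ∀ y ∈ Icc y₁ y₂, IntegrableOn (fun x => v x y * (1 + f x y)) (Icc x₁ x₂) :=
      fun y hy' => ((hv1 y hy').mul (continuous_const.add (hf1 y))).continuousOn.integrableOn_Icc
    have : ∫ q in R, Φ₁ q = ∫ x in Icc x₁ x₂, ∫ y in Icc y₁ y₂, Φ₁ (x, y) :=
      setIntegral_prod Φ₁ hΦ₁
    rw [this, integral_congr_ae hinner, integral_sub (hcI _ (right_mem_Icc.2 hy))
      (hcI _ (left_mem_Icc.2 hy)), hHx _ (right_mem_Icc.2 hy), hHx _ (left_mem_Icc.2 hy)]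
    ring
  have e2 : ∫ q in R, Φ₂ q = (H x₂ y₂ - H x₂ y₁) - (H x₁ y₂ - H x₁ y₁) := by
    have hint : Integrable Φ₂ ((volume.restrict (Icc x₁ x₂)).prod (volume.restrict (Icc y₁ y₂))) := by
      rw [Measure.prod_restrict]
      exact hΦ₂
    have hinner : ∀ᵐ y ∂(volume.restrict (Icc y₁ y₂)), ∫ x in Icc x₁ x₂, Φ₂ (x, y) =
        (u x₂ y - c) * (1 + f x₂ y) - (u x₁ y - c) * (1 + f x₁ y) := by
      filter_upwards [hint.prod_left_ae, ae_restrict_of_ae h.slice_B,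
        ae_restrict_mem measurableSet_Icc] with y hyi hyB hy'
      refine setIntegral_Icc_eq_sub (g := fun x => (u x y - c) * (1 + f x y)) hx
        (fun x hx' => ?_) hyi
      have d1 := (hasDerivAt_fst h.flow.contDiff_u (x := x) (hym y hy')).differentiableAt.hasDerivAt
      have d2 := (hyB.1 x).hasDerivAt
      exact (d1.sub_const c).mul (d2.const_add 1)
    have hcI : ∀ x, IntegrableOn (fun y => (u x y - c) * (1 + f x y)) (Icc y₁ y₂) :=
      fun x => (((hu2 x).sub continuousOn_const).mul
        (continuous_const.add (hf2 x)).continuousOn).integrableOn_Icc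
    have : ∫ q in R, Φ₂ q = ∫ y in Icc y₁ y₂, ∫ x in Icc x₁ x₂, Φ₂ (x, y) := by
      have h1 : ∫ q in R, Φ₂ q = ∫ q, Φ₂ q ∂((volume.restrict (Icc x₁ x₂)).prod
          (volume.restrict (Icc y₁ y₂))) := by
        rw [Measure.prod_restrict]
        rfl
      rw [h1, integral_prod_symm _ hint]
    rw [this, integral_congr_ae hinner, integral_sub (hcI _) (hcI _),
      hHy _ (right_mem_Icc.2 hx), hHy _ (left_mem_Icc.2 hx)]
  rw [hsum, e1, e2]
  ring

end RegularVorticity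

/-! ### Periodic moduli of continuity and a singular integral -/

/-- A modulus of continuity on a period gives one on the line. -/
theorem abs_sub_le_of_periodic {T : ℝ} (hT : 0 < T) {g : ℝ → ℝ} (hg : Function.Periodic g T)
    {β r : ℝ} (hβ : 0 ≤ β) (hr : 0 ≤ r)
    (h : ∀ x ∈ Icc 0 T, ∀ x' ∈ Icc 0 T, |g x' - g x| ≤ β * |x' - x| ^ r) (x : ℝ) {τ : ℝ}
    (hτ : τ ∈ Ioc 0 T) : |g (x + τ) - g x| ≤ 2 * β * τ ^ r := by
  have hτ0 := hτ.1
  have hp : 0 ≤ β * τ ^ r := by positivity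
  set n := ⌊x / T⌋
  set z := x - n * T with hz
  have hz0 : 0 ≤ z := Int.sub_floor_div_mul_nonneg x hT
  have hz1 : z < T := Int.sub_floor_div_mul_lt x hT
  have e1 : g x = g z := (hg.sub_int_mul_eq n).symm
  have e2 : g (x + τ) = g (z + τ) := by
    have := hg.sub_int_mul_eq (x := x + τ) n
    rw [← this, hz]
    ring_nf
  rw [e1, e2]
  rcases le_total (z + τ) T with hle | hle
  · have := h z ⟨hz0, hz1.le⟩ (z + τ) ⟨by linarith, hle⟩
    rw [add_sub_cancel_left, abs_of_pos hτ0] at this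
    linarith
  -- The interval crosses the end of the period: split there, each piece being no longer than `τ`.
  -- This costs the factor `2`.
  · have h1 := h 0 ⟨le_rfl, hT.le⟩ (z + τ - T) ⟨by linarith, by linarith [hτ.2]⟩
    have h2 := h z ⟨hz0, hz1.le⟩ T ⟨hT.le, le_rfl⟩
    rw [hg.sub_eq, sub_zero, abs_of_nonneg (by linarith : 0 ≤ z + τ - T)] at h1
    rw [abs_of_nonneg (by linarith : 0 ≤ T - z)] at h2
    have h3 : g T = g 0 := by simpa using hg 0
    rw [h3] at h2
    have h4 : (z + τ - T) ^ r ≤ τ ^ r := Real.rpow_le_rpow (by linarith) (by linarith) hr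
    have h5 : (T - z) ^ r ≤ τ ^ r := Real.rpow_le_rpow (by linarith) (by linarith) hr
    calc |g (z + τ) - g z| = |(g (z + τ) - g 0) + (g 0 - g z)| := by ring_nf
      _ ≤ β * (z + τ - T) ^ r + β * (T - z) ^ r := (abs_add_le _ _).trans (add_le_add h1 h2)
      _ ≤ β * τ ^ r + β * τ ^ r := by gcongr
      _ = 2 * β * τ ^ r := by ring

/-- Each side of `y₀` contributes at most `2/α`, since its length is at most `2` and `α ≤ 1`. -/
theorem integral_abs_sub_rpow_le {α y₀ : ℝ} (h0 : 0 < α) (h1 : α ≤ 1)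
    (hy₀ : y₀ ∈ Icc (-1 : ℝ) 1) :
    IntervalIntegrable (fun y => |y - y₀| ^ (α - 1)) volume (-1) 1 ∧
      ∫ y in (-1 : ℝ)..1, |y - y₀| ^ (α - 1) ≤ 4 / α := by
  have hr : -1 < α - 1 := by linarith
  have hbase : ∀ b, IntervalIntegrable (fun t : ℝ => t ^ (α - 1)) volume 0 b := fun b =>
    intervalIntegral.intervalIntegrable_rpow' hr
  have i1 : IntervalIntegrable (fun y => |y - y₀| ^ (α - 1)) volume (-1) y₀ := by
    have := ((hbase (y₀ + 1)).comp_sub_left y₀).symm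
    simp only [sub_zero] at this
    rw [show y₀ - (y₀ + 1) = -1 by ring] at this
    refine this.congr fun y hy => ?_
    rw [uIoc_of_le hy₀.1] at hy
    rw [abs_of_nonpos (by linarith [hy.2]), neg_sub]
  have i2 : IntervalIntegrable (fun y => |y - y₀| ^ (α - 1)) volume y₀ 1 := by
    have := (hbase (1 - y₀)).comp_sub_right y₀
    simp only [zero_add] at this
    rw [show 1 - y₀ + y₀ = 1 by ring] at this
    refine this.congr fun y hy => ?_
    rw [uIoc_of_le hy₀.2] at hy
    rw [abs_of_nonneg (by linarith [hy.1])]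
  refine ⟨i1.trans i2, ?_⟩
  have v1 : ∫ y in (-1 : ℝ)..y₀, |y - y₀| ^ (α - 1) = (y₀ + 1) ^ α / α := by
    have : ∫ y in (-1 : ℝ)..y₀, |y - y₀| ^ (α - 1) = ∫ y in (-1 : ℝ)..y₀, (y₀ - y) ^ (α - 1) := by
      refine intervalIntegral.integral_congr fun y hy => ?_
      rw [uIcc_of_le hy₀.1] at hy
      rw [abs_of_nonpos (by linarith [hy.2]), neg_sub]
    rw [this, intervalIntegral.integral_comp_sub_left (fun t => t ^ (α - 1)), sub_self,
      integral_rpow_zero_left hr]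
    ring_nf
  have v2 : ∫ y in y₀..1, |y - y₀| ^ (α - 1) = (1 - y₀) ^ α / α := by
    have : ∫ y in y₀..1, |y - y₀| ^ (α - 1) = ∫ y in y₀..1, (y - y₀) ^ (α - 1) := by
      refine intervalIntegral.integral_congr fun y hy => ?_
      rw [uIcc_of_le hy₀.2] at hy
      rw [abs_of_nonneg (by linarith [hy.1])]
    rw [this, intervalIntegral.integral_comp_sub_right (fun t => t ^ (α - 1)), sub_self,
      integral_rpow_zero_left hr]
    ring_nf
  rw [← intervalIntegral.integral_add_adjacent_intervals i1 i2, v1, v2, ← add_div]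
  gcongr
  have b : ∀ t : ℝ, 0 ≤ t → t ≤ 2 → t ^ α ≤ 2 := by
    intro t ht ht2
    calc t ^ α ≤ 2 ^ α := Real.rpow_le_rpow ht ht2 h0.le
      _ ≤ 2 ^ (1 : ℝ) := Real.rpow_le_rpow_of_exponent_le (by norm_num) h1
      _ = 2 := Real.rpow_one 2
  linarith [b (y₀ + 1) (by linarith [hy₀.1]) (by linarith [hy₀.2]),
    b (1 - y₀) (by linarith [hy₀.2]) (by linarith [hy₀.1])]

/-! ### The critical layer on one vertical section -/

section CriticalLayer

variable {α M a : ℝ} {W V φ r : ℝ → ℝ}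

/-- A function that solves `W r + g = 0` and is integrable across a simple zero of `W` forces `g`
to vanish at this zero. -/
theorem eq_zero_of_integrable_div {g : ℝ → ℝ} {y₀ : ℝ} (hy₀ : y₀ ∈ Ioo (-1 : ℝ) 1)
    (hg : ContinuousAt g y₀) (hW : ∀ y ∈ Ioo (-1 : ℝ) 1, |W y| ≤ 2 * |y - y₀|)
    (hr : IntegrableOn r (Ioo (-1) 1))
    (heq : ∀ᵐ y, y ∈ Ioo (-1 : ℝ) 1 → W y * r y + g y = 0) : g y₀ = 0 := by
  by_contra hne
  have hη : 0 < |g y₀| / 2 := by positivity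
  have hev : ∀ᶠ y in nhds y₀, |g y₀| / 2 < |g y| ∧ y ∈ Ioo (-1 : ℝ) 1 :=
    (hg.abs.eventually (lt_mem_nhds (by linarith))).and (isOpen_Ioo.mem_nhds hy₀)
  obtain ⟨δ, hδ, hball⟩ := Metric.eventually_nhds_iff.1 hev
  have hin : ∀ y ∈ Icc (y₀ - δ / 2) (y₀ + δ / 2), |g y₀| / 2 < |g y| ∧ y ∈ Ioo (-1 : ℝ) 1 := by
    intro y hy
    refine hball ?_
    rw [Real.dist_eq, abs_lt]
    constructor <;> linarith [hy.1, hy.2]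
  have hri : IntegrableOn r (Icc (y₀ - δ / 2) (y₀ + δ / 2)) := hr.mono_set fun y hy => (hin y hy).2
  -- If `g y₀ ≠ 0`, then near `y₀` the function `|r| = |g|/|W|` dominates a multiple of `1/|y -
  -- y₀|`, which is not integrable.
  have hinv : IntegrableOn (fun y => (y - y₀)⁻¹) (Icc (y₀ - δ / 2) (y₀ + δ / 2)) := by
    refine (hri.norm.const_mul (2 / (|g y₀| / 2))).mono' (by fun_prop) ?_
    rw [ae_restrict_iff' measurableSet_Icc]
    filter_upwards [heq] with y hy hyI
    obtain ⟨h1, h2⟩ := hin y hyI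
    have h3 := hy h2
    have h4 : |g y| = |W y| * |r y| := by
      rw [← abs_mul, ← abs_neg, show -g y = W y * r y by linarith]
    have h5 : |g y₀| / 2 ≤ 2 * |y - y₀| * |r y| := by
      have := mul_le_mul_of_nonneg_right (hW y h2) (abs_nonneg (r y))
      linarith
    rw [norm_inv, Real.norm_eq_abs, Real.norm_eq_abs]
    rcases (abs_nonneg (y - y₀)).eq_or_lt with h6 | h6
    · rw [← h6]
      simp
      positivity
    · rw [inv_le_iff_one_le_mul₀ h6, div_mul_eq_mul_div, div_mul_eq_mul_div, le_div_iff₀ hη]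
      linarith
  have hii : IntervalIntegrable (fun y => (y - y₀)⁻¹) volume (y₀ - δ / 2) (y₀ + δ / 2) := by
    rwa [intervalIntegrable_iff_integrableOn_Icc_of_le (by linarith)]
  rw [intervalIntegrable_sub_inv_iff] at hii
  rcases hii with h | h
  · linarith
  · exact h (by rw [uIcc_of_le (by linarith)]; constructor <;> linarith)

/-- The main estimate on a vertical section: `r = - V φ / W` is controlled in `L¹`, although `W`
vanishes at a critical point. -/
theorem integral_abs_section_le (h0 : 0 < α) (h1 : α ≤ 1) (hM : 0 ≤ M) (ha : 0 ≤ a)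
    (hWc : ContinuousOn W (Icc (-1) 1)) (hWd : ∀ y ∈ Ioo (-1 : ℝ) 1, DifferentiableAt ℝ W y)
    (hW1 : ∀ y ∈ Ioo (-1 : ℝ) 1, 1 / 2 ≤ deriv W y) (hW2 : ∀ y ∈ Ioo (-1 : ℝ) 1, deriv W y ≤ 2)
    (hV : ∀ y ∈ Icc (-1 : ℝ) 1, ∀ y' ∈ Icc (-1 : ℝ) 1, |V y - V y'| ≤ M * |y - y'| ^ α)
    (hVb : V (-1) = 0) (hVt : V 1 = 0) (hφ : ∀ y, |φ y| ≤ a)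
    (hφ' : ∀ y y', |φ y - φ y'| ≤ a * |y - y'| ^ α) (hr : IntegrableOn r (Ioo (-1) 1))
    (heq : ∀ᵐ y, y ∈ Ioo (-1 : ℝ) 1 → W y * r y + V y * φ y = 0) :
    ∫ y in (-1 : ℝ)..1, |r y| ≤ 24 / α * M * a := by
  have hVM : ∀ y ∈ Icc (-1 : ℝ) 1, |V y| ≤ 2 * M := by
    intro y hy
    have := hV y hy (-1) (by norm_num)
    rw [hVb, sub_zero] at this
    have h2 : |y - -1| ^ α ≤ 2 := by
      rw [abs_of_nonneg (by linarith [hy.1])]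
      calc (y - -1) ^ α ≤ 2 ^ α := Real.rpow_le_rpow (by linarith [hy.1]) (by linarith [hy.2]) h0.le
        _ ≤ 2 ^ (1 : ℝ) := Real.rpow_le_rpow_of_exponent_le (by norm_num) h1
        _ = 2 := Real.rpow_one 2
    nlinarith
  have hg : ∀ y ∈ Icc (-1 : ℝ) 1, ∀ y' ∈ Icc (-1 : ℝ) 1,
      |V y * φ y - V y' * φ y'| ≤ 3 * M * a * |y - y'| ^ α := by
    intro y hy y' hy'
    have e : V y * φ y - V y' * φ y' = V y * (φ y - φ y') + (V y - V y') * φ y' := by ring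
    rw [e]
    refine (abs_add_le _ _).trans ?_
    rw [abs_mul, abs_mul]
    calc _ ≤ 2 * M * (a * |y - y'| ^ α) + M * |y - y'| ^ α * a := by
          gcongr
          · exact hVM y hy
          · exact hφ' y y'
          · exact hV y hy y' hy'
          · exact hφ y'
      _ = _ := by ring
  have hlow : ∀ y ∈ Icc (-1 : ℝ) 1, ∀ y' ∈ Icc (-1 : ℝ) 1, y ≤ y' →
      1 / 2 * (y' - y) ≤ W y' - W y := fun y hy y' hy' hle =>
    (convex_Icc (-1 : ℝ) 1).mul_sub_le_image_sub_of_le_deriv hWc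
      (by rw [interior_Icc]; exact fun y hy => (hWd y hy).differentiableWithinAt)
      (by rw [interior_Icc]; exact hW1) y hy y' hy' hle
  have hup : ∀ y ∈ Icc (-1 : ℝ) 1, ∀ y' ∈ Icc (-1 : ℝ) 1, y ≤ y' →
      W y' - W y ≤ 2 * (y' - y) := fun y hy y' hy' hle =>
    (convex_Icc (-1 : ℝ) 1).image_sub_le_mul_sub_of_deriv_le hWc
      (by rw [interior_Icc]; exact fun y hy => (hWd y hy).differentiableWithinAt)
      (by rw [interior_Icc]; exact hW2) y hy y' hy' hle
  have hm1 : (-1 : ℝ) ∈ Icc (-1 : ℝ) 1 := by norm_num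
  have hp1 : (1 : ℝ) ∈ Icc (-1 : ℝ) 1 := by norm_num
  -- If `W` does not change sign, the appropriate wall serves as `y₀`: there `V = 0`, and
  -- monotonicity still gives `|W| ≥ |y - y₀|/2`. Otherwise `y₀` is the interior zero and
  -- integrability of `r` forces `V φ` to vanish there.
  obtain ⟨y₀, hy₀, hgy₀, hWy₀⟩ : ∃ y₀ ∈ Icc (-1 : ℝ) 1, V y₀ * φ y₀ = 0 ∧
      ∀ y ∈ Icc (-1 : ℝ) 1, 1 / 2 * |y - y₀| ≤ |W y| := by
    rcases le_or_gt 0 (W (-1)) with hb | hb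
    · refine ⟨-1, hm1, by rw [hVb, zero_mul], fun y hy => ?_⟩
      have := hlow (-1) hm1 y hy hy.1
      rw [abs_of_nonneg (by linarith [hy.1])]
      exact le_trans (by linarith) (le_abs_self _)
    rcases le_or_gt (W 1) 0 with ht | ht
    · refine ⟨1, hp1, by rw [hVt, zero_mul], fun y hy => ?_⟩
      have := hlow y hy 1 hp1 hy.2
      rw [abs_of_nonpos (by linarith [hy.2])]
      exact le_trans (by linarith) (neg_le_abs _)
    obtain ⟨y₀, hy₀, hz⟩ := intermediate_value_Ioo (by norm_num : (-1 : ℝ) ≤ 1) hWc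
      (show (0 : ℝ) ∈ Ioo (W (-1)) (W 1) from ⟨hb, ht⟩)
    have hy₀' := Ioo_subset_Icc_self hy₀
    refine ⟨y₀, hy₀', ?_, fun y hy => ?_⟩
    · refine eq_zero_of_integrable_div (g := fun y => V y * φ y) hy₀ ?_ (fun y hy => ?_) hr heq
      · have hlim : Filter.Tendsto (fun y => 3 * M * a * |y - y₀| ^ α) (nhds y₀) (nhds 0) := by
          have : ContinuousAt (fun y => 3 * M * a * |y - y₀| ^ α) y₀ := by
            refine continuousAt_const.mul (ContinuousAt.rpow_const (by fun_prop) (Or.inr h0.le))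
          have h2 := this.tendsto
          simpa [Real.zero_rpow h0.ne'] using h2
        refine tendsto_iff_norm_sub_tendsto_zero.2 (squeeze_zero' (Filter.Eventually.of_forall
          fun y => norm_nonneg _) ?_ hlim)
        filter_upwards [isOpen_Ioo.mem_nhds hy₀] with y hy
        exact hg y (Ioo_subset_Icc_self hy) y₀ hy₀'
      · have hy' := Ioo_subset_Icc_self hy
        rcases le_total y y₀ with hle | hle
        · have h2 := hup y hy' y₀ hy₀' hle
          have h3 := hlow y hy' y₀ hy₀' hle
          rw [abs_of_nonpos (by linarith : y - y₀ ≤ 0), abs_of_nonpos (by linarith)]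
          linarith
        · have h2 := hup y₀ hy₀' y hy' hle
          have h3 := hlow y₀ hy₀' y hy' hle
          rw [abs_of_nonneg (by linarith : 0 ≤ y - y₀), abs_of_nonneg (by linarith)]
          linarith
    · rcases le_total y y₀ with hle | hle
      · have h3 := hlow y hy y₀ hy₀' hle
        rw [abs_of_nonpos (by linarith : y - y₀ ≤ 0)]
        exact le_trans (by linarith) (neg_le_abs _)
      · have h3 := hlow y₀ hy₀' y hy hle
        rw [abs_of_nonneg (by linarith : 0 ≤ y - y₀)]
        exact le_trans (by linarith) (le_abs_self _)
  obtain ⟨hint, hval⟩ := integral_abs_sub_rpow_le h0 h1 hy₀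
  have hri : IntervalIntegrable r volume (-1) 1 :=
    (intervalIntegrable_iff_integrableOn_Ioo_of_le (by norm_num)).2 hr
  -- `|V φ| ≤ 3 M a |y - y₀|^α` against `|W| ≥ |y - y₀|/2` gives the factor `6`; the integral
  -- supplies `4/α`.
  calc ∫ y in (-1 : ℝ)..1, |r y| ≤ ∫ y in (-1 : ℝ)..1, 6 * M * a * |y - y₀| ^ (α - 1) := by
        refine intervalIntegral.integral_mono_ae_restrict (by norm_num) hri.abs
          (hint.const_mul _) ?_
        rw [Filter.EventuallyLE, ae_restrict_iff' measurableSet_Icc]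
        have e1 : ∀ᵐ y : ℝ, y ≠ y₀ := by simp [ae_iff, measure_singleton]
        have e2 : ∀ᵐ y : ℝ, y ≠ 1 := by simp [ae_iff, measure_singleton]
        have e3 : ∀ᵐ y : ℝ, y ≠ -1 := by simp [ae_iff, measure_singleton]
        filter_upwards [heq, e1, e2, e3] with y hy hn1 hn2 hn3 hyI
        have hyo : y ∈ Ioo (-1 : ℝ) 1 :=
          ⟨lt_of_le_of_ne hyI.1 (Ne.symm hn3), lt_of_le_of_ne hyI.2 hn2⟩
        have hpos : 0 < |y - y₀| := abs_pos.2 (sub_ne_zero.2 hn1)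
        have h3 : |V y * φ y| = |W y| * |r y| := by
          rw [← abs_mul, ← abs_neg, show -(V y * φ y) = W y * r y by linarith [hy hyo]]
        have h4 := hg y hyI y₀ hy₀
        rw [hgy₀, sub_zero, h3] at h4
        have h5 : 1 / 2 * |y - y₀| * |r y| ≤ 3 * M * a * |y - y₀| ^ α :=
          (mul_le_mul_of_nonneg_right (hWy₀ y hyI) (abs_nonneg _)).trans h4
        rw [Real.rpow_sub_one hpos.ne', ← mul_div_assoc, le_div_iff₀ hpos]
        linarith
    _ = 6 * M * a * ∫ y in (-1 : ℝ)..1, |y - y₀| ^ (α - 1) := intervalIntegral.integral_const_mul _ _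
    _ ≤ 6 * M * a * (4 / α) := by gcongr
    _ = _ := by ring

end CriticalLayer

/-! ### From the velocity back to the vorticity -/

namespace RegularVorticity

variable {T α E : ℝ} {u v f : ℝ → ℝ → ℝ} {A B : ℝ → ℝ}

theorem periodic_vorticity (h : RegularVorticity T α E u v f A B)
    {y : ℝ} (hy : y ∈ Ioo (-1 : ℝ) 1) :
    Function.Periodic (fun x => vorticity u v x y) T := fun x => h.flow.vorticity_periodic x hy

theorem abs_vorticity_sub_one_le (h : RegularVorticity T α E u v f A B)
    (hT : 0 < T) (x : ℝ) {y : ℝ} (hy : y ∈ Ioo (-1 : ℝ) 1) :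
    |vorticity u v x y - 1| ≤ E := by
  obtain ⟨x', hx', he⟩ := (h.periodic_vorticity hy).exists_mem_Ico₀ hT x
  rw [he, h.vorticity_eq x' (Ico_subset_Icc_self hx') y hy, add_sub_cancel_left]
  exact h.bound x' y

theorem abs_vorticity_le (h : RegularVorticity T α E u v f A B)
    (hT : 0 < T) (x y : ℝ) (hy : y ∈ Ioo (-1 : ℝ) 1) :
    |vorticity u v x y| ≤ 1 + E := by
  have := abs_le.1 (h.abs_vorticity_sub_one_le hT x hy)
  rw [abs_le]
  constructor <;> linarith [this.1, this.2]

theorem ae_abs_vorticity_sub_le (h : RegularVorticity T α E u v f A B) (hT : 0 < T) :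
    ∀ᵐ y, y ∈ Ioo (-1 : ℝ) 1 → ∀ x, ∀ τ ∈ Ioc 0 T,
      |vorticity u v (x + τ) y - vorticity u v x y| ≤ 2 * B y * τ := by
  filter_upwards [h.slice_B] with y hy hyI x τ hτ
  have := abs_sub_le_of_periodic hT (h.periodic_vorticity hyI) (h.nonneg_B y) zero_le_one
    (fun x hx x' hx' => ?_) x hτ
  · rwa [Real.rpow_one] at this
  · rw [h.vorticity_eq x hx y hyI, h.vorticity_eq x' hx' y hyI, Real.rpow_one,
      add_sub_add_left_eq_sub]
    exact convex_univ.norm_image_sub_le_of_norm_deriv_le (fun z _ => hy.1 z)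
      (fun z _ => hy.2.1 z) (mem_univ x) (mem_univ x')

/-- Two increments of at most `2 B y τ` each; then the `L²` bound on `B`. This gives a Lipschitz
modulus proportional to `E`. -/
theorem integral_second_difference_le (h : RegularVorticity T α E u v f A B)
    (hT : 0 < T) (x : ℝ) {τ : ℝ} (hτ : τ ∈ Ioc 0 T) :
    ∫ y in (-1 : ℝ)..1,
      (vorticity u v (x + τ) y + vorticity u v (x - τ) y - 2 * vorticity u v x y) ^ 2
        ≤ (4 * E * τ) ^ 2 := by
  have hi : IntervalIntegrable (fun y => (4 * τ) ^ 2 * B y ^ 2) volume (-1) 1 :=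
    h.integrable_B.intervalIntegrable.const_mul _
  have h1 : ‖∫ y in (-1 : ℝ)..1,
      (vorticity u v (x + τ) y + vorticity u v (x - τ) y - 2 * vorticity u v x y) ^ 2‖
        ≤ ∫ y in (-1 : ℝ)..1, (4 * τ) ^ 2 * B y ^ 2 := by
    refine intervalIntegral.norm_integral_le_of_norm_le (by norm_num) ?_ hi
    have e2 : ∀ᵐ y : ℝ, y ≠ 1 := by simp [ae_iff, measure_singleton]
    filter_upwards [h.ae_abs_vorticity_sub_le hT, e2] with y hy hn hyI
    have hyo : y ∈ Ioo (-1 : ℝ) 1 := ⟨hyI.1, lt_of_le_of_ne hyI.2 hn⟩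
    have a1 := abs_le.1 (hy hyo x τ hτ)
    have a2 := hy hyo (x - τ) τ hτ
    rw [sub_add_cancel] at a2
    have a3 := abs_le.1 a2
    rw [Real.norm_of_nonneg (sq_nonneg _), ← mul_pow]
    refine sq_le_sq' ?_ ?_ <;> linarith [a1.1, a1.2, a3.1, a3.2]
  refine (le_abs_self _).trans (h1.trans ?_)
  rw [intervalIntegral.integral_const_mul, intervalIntegral.integral_of_le (by norm_num)]
  have h2 : ∫ y in Ioc (-1 : ℝ) 1, B y ^ 2 ≤ E ^ 2 :=
    (setIntegral_le_integral h.integrable_B (Filter.Eventually.of_forall fun y => sq_nonneg _)).trans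
      h.integral_B
  calc _ ≤ (4 * τ) ^ 2 * E ^ 2 := by gcongr
    _ = _ := by ring

theorem integrable_vorticity (h : RegularVorticity T α E u v f A B) (hT : 0 < T) (x : ℝ) :
    IntervalIntegrable (fun y => vorticity u v x y) volume (-1) 1 := by
  rw [intervalIntegrable_iff_integrableOn_Ioo_of_le (by norm_num)]
  refine IntegrableOn.of_bound (by simp) ?_ (1 + E) ?_
  · have : ContinuousOn (fun y => vorticity u v x y) (Ioo (-1) 1) :=
      h.flow.continuousOn_vorticity.comp (f := fun y => (x, y)) (by fun_prop) (fun y hy => hy)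
    exact this.aestronglyMeasurable measurableSet_Ioo
  · exact (ae_restrict_iff' measurableSet_Ioo).2
      (Filter.Eventually.of_forall fun y hy => h.abs_vorticity_le hT x y hy)

theorem abs_sinCoeff_sub_le (h : RegularVorticity T α E u v f A B)
    (hT : 0 < T) (m : ℕ) {x x' : ℝ} {g : ℝ → ℝ}
    (hg : IntegrableOn g (Ioo (-1) 1))
    (hle : ∀ᵐ y, y ∈ Ioo (-1 : ℝ) 1 → |vorticity u v x' y - vorticity u v x y| ≤ g y) :
    |sinCoeff (vorticity u v) m x' - sinCoeff (vorticity u v) m x| ≤ ∫ y in Ioo (-1 : ℝ) 1, g y := by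
  have hs : ∀ x, IntervalIntegrable (fun y => vorticity u v x y * sinMode m y) volume (-1) 1 :=
    fun x => (h.integrable_vorticity hT x).mul_continuousOn (by fun_prop)
  rw [sinCoeff, sinCoeff, ← intervalIntegral.integral_sub (hs x') (hs x),
    ← integral_Ioc_eq_integral_Ioo, ← intervalIntegral.integral_of_le (by norm_num)]
  rw [← Real.norm_eq_abs]
  refine intervalIntegral.norm_integral_le_of_norm_le (by norm_num) ?_
    ((intervalIntegrable_iff_integrableOn_Ioo_of_le (by norm_num)).2 hg)
  have e2 : ∀ᵐ y : ℝ, y ≠ 1 := by simp [ae_iff, measure_singleton]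
  filter_upwards [hle, e2] with y hy hn hyI
  rw [← sub_mul, norm_mul, Real.norm_eq_abs, Real.norm_eq_abs]
  exact (mul_le_of_le_one_right (abs_nonneg _) (abs_sinMode_le m y)).trans
    (hy ⟨hyI.1, lt_of_le_of_ne hyI.2 hn⟩)

/-- Starting point of the iteration: finiteness is all that matters, since the iteration removes the
size of `N`. -/
theorem exists_coeffHolder (h : RegularVorticity T α E u v f A B)
    (hT : 0 < T) : ∃ N : ℝ, 0 ≤ N ∧ CoeffHolder T N (vorticity u v) := by
  set b := ∫ y in Ioo (-1 : ℝ) 1, B y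
  have hb : 0 ≤ b := integral_nonneg h.nonneg_B
  refine ⟨4 * b * T ^ (1 / 2 : ℝ), by positivity, fun m x τ hτ => ?_⟩
  have hτ0 := hτ.1
  have h1 := h.abs_sinCoeff_sub_le hT m (x := x - τ) (x' := x + τ) (g := fun y => 4 * τ * B y)
    ((h.integrableOn_B _ _).const_mul _) (by
      filter_upwards [h.ae_abs_vorticity_sub_le hT] with y hy hyo
      have a1 := abs_le.1 (hy hyo x τ hτ)
      have a2 := hy hyo (x - τ) τ hτ
      rw [sub_add_cancel] at a2
      have a3 := abs_le.1 a2
      rw [abs_le]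
      constructor <;> linarith [a1.1, a1.2, a3.1, a3.2])
  rw [integral_const_mul] at h1
  refine h1.trans ?_
  have h2 : τ ≤ T ^ (1 / 2 : ℝ) * τ ^ (1 / 2 : ℝ) := by
    calc τ = τ ^ (1 / 2 : ℝ) * τ ^ (1 / 2 : ℝ) := by
          rw [← Real.rpow_add hτ0]
          norm_num
      _ ≤ _ := by
          gcongr
          exact hτ.2
  calc 4 * τ * b ≤ 4 * (T ^ (1 / 2 : ℝ) * τ ^ (1 / 2 : ℝ)) * b := by gcongr
    _ = _ := by ring

/-- Cauchy-Schwarz in the form of Young's inequality with weight `d / E`. This is the origin of the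
Hölder exponent `1/2` in `CoeffHolder`. -/
theorem integral_A_le (h : RegularVorticity T α E u v f A B)
    (hE : 0 < E) {x₁ x₂ : ℝ} (hx : x₁ < x₂) :
    ∫ x in Ioo x₁ x₂, A x ≤ E * (x₂ - x₁) ^ (1 / 2 : ℝ) := by
  set d := (x₂ - x₁) ^ (1 / 2 : ℝ)
  have hd : 0 < d := Real.rpow_pos_of_pos (by linarith) _
  have hdd : x₂ - x₁ = d * d := by
    rw [← Real.rpow_add (by linarith)]
    norm_num
  have hi : IntegrableOn (fun x => d / (2 * E) * A x ^ 2 + E / (2 * d)) (Ioo x₁ x₂) :=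
    (h.integrable_A.integrableOn.const_mul _).add (integrableOn_const (by simp))
  have h2 : ∫ x in Ioo x₁ x₂, A x ^ 2 ≤ E ^ 2 :=
    (setIntegral_le_integral h.integrable_A (Filter.Eventually.of_forall fun y => sq_nonneg _)).trans
      h.integral_A
  calc ∫ x in Ioo x₁ x₂, A x ≤ ∫ x in Ioo x₁ x₂, (d / (2 * E) * A x ^ 2 + E / (2 * d)) := by
        refine integral_mono (h.integrableOn_A _ _) hi fun x => ?_
        simp only
        rw [div_mul_eq_mul_div, div_add_div _ _ (by positivity) (by positivity),
          le_div_iff₀ (by positivity)]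
        nlinarith [sq_nonneg (d * A x - E)]
    _ = d / (2 * E) * (∫ x in Ioo x₁ x₂, A x ^ 2) + (x₂ - x₁) * (E / (2 * d)) := by
        rw [integral_add (h.integrable_A.integrableOn.const_mul _) (integrableOn_const (by simp)),
          integral_const_mul, setIntegral_const]
        simp [hx.le]
    _ ≤ d / (2 * E) * E ^ 2 + (d * d) * (E / (2 * d)) := by
        rw [← hdd]
        gcongr
    _ = E * d := by
        field_simp
        ring

theorem abs_deriv_u_sub_one_le (h : RegularVorticity T α E u v f A B)
    (hT : 0 < T) {L : ℝ} (hL0 : 0 ≤ L)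
    (hL : ∀ x x', ∀ y ∈ Icc (-1 : ℝ) 1, |v x' y - v x y| ≤ L * |x' - x|) (x : ℝ) {y : ℝ}
    (hy : y ∈ Ioo (-1 : ℝ) 1) : |deriv (fun y' => u x y') y - 1| ≤ E + L := by
  have h1 : |deriv (fun x' => v x' y) x| ≤ L := by
    rw [← Real.norm_eq_abs]
    exact norm_deriv_le_of_lip' hL0 (Filter.Eventually.of_forall fun x' =>
      hL x x' y (Ioo_subset_Icc_self hy))
  have h2 := h.abs_vorticity_sub_one_le hT x hy
  have e : deriv (fun y' => u x y') y - 1 =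
      (vorticity u v x y - 1) + deriv (fun x' => v x' y) x := by
    rw [vorticity]
    ring
  rw [e]
  exact (abs_add_le _ _).trans (add_le_add h2 h1)

/-- For a travelling wave, a Hölder bound of the vertical velocity improves the modulus of
continuity of the vorticity. -/
theorem coeffHolder_of_holder (h : RegularVorticity T α E u v f A B)
    (hT : 0 < T) (h0 : 0 < α) (h1 : α ≤ 1) (hE : 0 < E) {c : ℝ}
    {H : ℝ → ℝ → ℝ} (hH : IsBernoulli c u v H)
    (huy : ∀ x, ∀ y ∈ Ioo (-1 : ℝ) 1, |deriv (fun y' => u x y') y - 1| ≤ 1 / 2) {M : ℝ}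
    (hM : 0 ≤ M)
    (hv : ∀ x, ∀ y ∈ Icc (-1 : ℝ) 1, ∀ y' ∈ Icc (-1 : ℝ) 1,
      |v x y - v x y'| ≤ M * |y - y'| ^ α) :
    CoeffHolder T (96 / α * M * E) (vorticity u v) := by
  set fx : ℝ × ℝ → ℝ := fun q => deriv (fun x' => f x' q.2) q.1
  -- Critical layer estimate with `W = u - c`, `V = v`, `φ = f_y`, `r = f_x`.
  have hsec : ∀ᵐ x, x ∈ Ioo 0 T → ∫ y in Ioo (-1 : ℝ) 1, |fx (x, y)| ≤ 24 / α * M * A x := by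
    have hint : Integrable fx ((volume.restrict (Ioo 0 T)).prod (volume.restrict (Ioo (-1) 1))) := by
      rw [Measure.prod_restrict]
      exact h.integrableOn_deriv_fst _ _ _ _
    have heq := h.ae_vorticity_equation hT hH
    rw [Measure.volume_eq_prod] at heq
    filter_upwards [h.slice_A, Measure.ae_ae_of_ae_prod heq,
      (ae_restrict_iff' measurableSet_Ioo).1 hint.prod_right_ae] with x hA hx hxi hxI
    rw [← integral_Ioc_eq_integral_Ioo, ← intervalIntegral.integral_of_le (by norm_num)]
    have hW : ∀ y ∈ Ioo (-1 : ℝ) 1, HasDerivAt (fun y => u x y - c) (deriv (fun y' => u x y') y) y :=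
      fun y hy => ((hasDerivAt_snd h.flow.contDiff_u hy).differentiableAt.hasDerivAt).sub_const c
    refine integral_abs_section_le (W := fun y => u x y - c) (V := fun y => v x y)
      (φ := fun y => deriv (fun y' => f x y') y) h0 h1 hM (h.nonneg_A x) ?_
      (fun y hy => (hW y hy).differentiableAt) (fun y hy => ?_) (fun y hy => ?_) (hv x)
      (h.flow.wall_bot x) (h.flow.wall_top x) hA.2.1 hA.2.2 (hxi hxI) ?_
    · exact (h.flow.continuous_u.comp (f := fun y => (x, y)) (by fun_prop)
        (fun y hy => hy)).sub continuousOn_const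
    · rw [(hW y hy).deriv]
      linarith [(abs_le.1 (huy x y hy)).1]
    · rw [(hW y hy).deriv]
      linarith [(abs_le.1 (huy x y hy)).2]
    · filter_upwards [hx] with y hy hyI
      exact hy ⟨hxI, hyI⟩
  have hordered : ∀ m, ∀ x₁ ∈ Icc 0 T, ∀ x₂ ∈ Icc 0 T, x₁ < x₂ →
      |sinCoeff (vorticity u v) m x₂ - sinCoeff (vorticity u v) m x₁| ≤
        24 / α * M * E * |x₂ - x₁| ^ (1 / 2 : ℝ) := by
    intro m x₁ hx₁ x₂ hx₂ hlt
    have hint : Integrable fx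
        ((volume.restrict (Ioo x₁ x₂)).prod (volume.restrict (Ioo (-1) 1))) := by
      rw [Measure.prod_restrict]
      exact h.integrableOn_deriv_fst _ _ _ _
    have hle := h.abs_sinCoeff_sub_le hT m (x := x₁) (x' := x₂)
      (g := fun y => ∫ x in Ioo x₁ x₂, |fx (x, y)|) hint.norm.integral_prod_right (by
        filter_upwards [h.slice_B,
          (ae_restrict_iff' measurableSet_Ioo).1 hint.prod_left_ae] with y hB hyi hyI
        rw [h.vorticity_eq x₁ hx₁ y hyI, h.vorticity_eq x₂ hx₂ y hyI, add_sub_add_left_eq_sub]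
        have hii : IntervalIntegrable (fun x => fx (x, y)) volume x₁ x₂ :=
          (intervalIntegrable_iff_integrableOn_Ioo_of_le hlt.le).2 (hyi hyI)
        rw [← intervalIntegral.integral_eq_sub_of_hasDerivAt
          (fun x _ => (hB.1 x).hasDerivAt) hii, ← integral_Ioc_eq_integral_Ioo,
          ← intervalIntegral.integral_of_le hlt.le]
        rw [← Real.norm_eq_abs]
        exact intervalIntegral.norm_integral_le_integral_norm hlt.le)
    refine hle.trans ?_
    -- The section estimate bounds integrals in `y` at fixed `x`, so the order of integration is
    -- exchanged.
    rw [← integral_integral_swap (f := fun x y => |fx (x, y)|) hint.norm]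
    have hmono : ∫ x in Ioo x₁ x₂, (∫ y in Ioo (-1 : ℝ) 1, |fx (x, y)|) ≤
        ∫ x in Ioo x₁ x₂, 24 / α * M * A x := by
      refine integral_mono_ae hint.norm.integral_prod_left ((h.integrableOn_A _ _).const_mul _) ?_
      rw [Filter.EventuallyLE, ae_restrict_iff' measurableSet_Ioo]
      filter_upwards [hsec] with x hx hxI
      exact hx ⟨hx₁.1.trans_lt hxI.1, hxI.2.trans_le hx₂.2⟩
    refine hmono.trans ?_
    rw [integral_const_mul, abs_of_pos (by linarith)]
    calc _ ≤ 24 / α * M * (E * (x₂ - x₁) ^ (1 / 2 : ℝ)) := by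
          gcongr
          exact h.integral_A_le hE hlt
      _ = _ := by ring
  have hall : ∀ m, ∀ x₁ ∈ Icc 0 T, ∀ x₂ ∈ Icc 0 T,
      |sinCoeff (vorticity u v) m x₂ - sinCoeff (vorticity u v) m x₁| ≤
        24 / α * M * E * |x₂ - x₁| ^ (1 / 2 : ℝ) := by
    intro m x₁ hx₁ x₂ hx₂
    rcases lt_trichotomy x₁ x₂ with hlt | rfl | hlt
    · exact hordered m x₁ hx₁ x₂ hx₂ hlt
    · simp
    · rw [abs_sub_comm, abs_sub_comm x₂]
      exact hordered m x₂ hx₂ x₁ hx₁ hlt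
  intro m x τ hτ
  have hp : 0 ≤ 24 / α * M * E := by positivity
  have hper := h.flow.sinCoeff_vorticity_periodic m
  have a1 := abs_sub_le_of_periodic hT hper hp (by norm_num) (hall m) x hτ
  have a2 := abs_sub_le_of_periodic hT hper hp (by norm_num) (hall m) (x - τ) hτ
  rw [sub_add_cancel] at a2
  -- `96 = 24 · 2 · 2`: one factor from periodicity, one from the symmetric increment between `x -
  -- τ` and `x + τ`.
  calc _ ≤ _ := abs_sub_le _ (sinCoeff (vorticity u v) m x) _
    _ ≤ _ := add_le_add a1 a2
    _ = _ := by ring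

end RegularVorticity

/-! ### Conclusion -/

/-- A periodic flow with vanishing vertical velocity is a shear flow. -/
theorem PeriodicFlow.exists_profile {T : ℝ} {u v : ℝ → ℝ → ℝ} (h : PeriodicFlow T u v)
    (hv : ∀ x, ∀ y ∈ Icc (-1 : ℝ) 1, v x y = 0) :
    ∃ U : ℝ → ℝ, ∀ x, ∀ y ∈ Icc (-1 : ℝ) 1, u x y = U y := by
  refine ⟨u 0, fun x y hy => ?_⟩
  have hint : ∀ y ∈ Ioo (-1 : ℝ) 1, u x y = u 0 y := by
    intro y hy
    have hd : ∀ x, HasDerivAt (fun x' => u x' y) 0 x := by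
      intro x
      have h1 := (hasDerivAt_fst h.contDiff_u (x := x) hy).differentiableAt.hasDerivAt
      have h2 := h.incompressible x y hy
      have h3 : deriv (fun y' => v x y') y = 0 := by
        have : (fun y' => v x y') =ᶠ[nhds y] fun _ => 0 := by
          filter_upwards [isOpen_Ioo.mem_nhds hy] with y' hy'
          exact hv x y' (Ioo_subset_Icc_self hy')
        rw [this.deriv_eq, deriv_const]
      rw [h3, add_zero] at h2
      rwa [h2] at h1
    exact is_const_of_deriv_eq_zero (fun x => (hd x).differentiableAt) (fun x => (hd x).deriv) x 0
  have hc : ∀ x, ContinuousOn (fun y => u x y) (Icc (-1) 1) := fun x =>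
    h.continuous_u.comp (f := fun y => (x, y)) (by fun_prop) (fun y hy => hy)
  have hcl : Icc (-1 : ℝ) 1 ⊆ closure (Ioo (-1 : ℝ) 1) := by rw [closure_Ioo (by norm_num)]
  exact EqOn.of_subset_closure (fun y hy => hint y hy) (hc x) (hc 0) Ioo_subset_Icc_self hcl hy

end ChannelEuler

end

theorem theorem3 (T : ℝ) (hT : 0 < T) (s : ℝ) (hs : 3 / 2 < s) :
    ∃ ε₀ : ℝ, 0 < ε₀ ∧
      ∀ (c : ℝ) (u v : ℝ → ℝ → ℝ),
        ChannelEuler.IsTravellingSolution c u v →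
        ChannelEuler.HasXPeriod T u → ChannelEuler.HasXPeriod T v →
        ChannelEuler.sobolevNormOn s (ChannelEuler.cell T)
            (fun x y => ChannelEuler.vorticity u v x y - 1) < ENNReal.ofReal ε₀ →
        (∀ x : ℝ, ∀ y ∈ Set.Icc (-1 : ℝ) 1, v x y = 0) ∧
          ∃ U : ℝ → ℝ, ∀ x : ℝ, ∀ y ∈ Set.Icc (-1 : ℝ) 1, u x y = U y := by
  set α : ℝ := min ((s - 3 / 2) / 2) (1 / 4)
  have h0 : 0 < α := lt_min (by linarith) (by norm_num)
  have h14 : α ≤ 1 / 4 := min_le_right _ _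
  have hα : α < s - 3 / 2 := (min_le_left _ _).trans_lt (by linarith)
  obtain ⟨CF, hCF, hreg⟩ :=
    ChannelEuler.PeriodicFlow.exists_regularVorticity h0 (by linarith) hα
  obtain ⟨CL, hCL, hlip⟩ := ChannelEuler.PeriodicFlow.exists_lipschitz_v hT
  obtain ⟨CH, hCH, hhol⟩ := ChannelEuler.PeriodicFlow.exists_holder_v h0 h14 hT
  -- The first bound keeps `|∂_y u - 1| ≤ 1/2`, with Lipschitz constant `4 CL E` for `v` in `x`; the
  -- second makes one round of the iteration a contraction by `1/2`.
  set E : ℝ := min (1 / (2 * (1 + 4 * CL))) (α / (192 * CH)) with hE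
  have hE0 : 0 < E := lt_min (by positivity) (by positivity)
  have hE1 : E + CL * (4 * E) ≤ 1 / 2 := by
    have : E ≤ 1 / (2 * (1 + 4 * CL)) := min_le_left _ _
    rw [le_div_iff₀ (by positivity)] at this
    linarith
  have hE2 : CH * (96 / α * E) ≤ 1 / 2 := by
    have : E ≤ α / (192 * CH) := min_le_right _ _
    rw [le_div_iff₀ (by positivity)] at this
    rw [div_mul_eq_mul_div, ← mul_div_assoc, div_le_iff₀ h0]
    linarith
  refine ⟨E / CF, by positivity, fun c u v hsol hu hv hn => ?_⟩
  have hflow := hsol.periodicFlow hu hv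
  obtain ⟨H, hH⟩ := hsol.exists_bernoulli hflow
  obtain ⟨f, A, B, h⟩ := hreg T u v hT hflow (E / CF) (by positivity) hn
  rw [mul_div_cancel₀ E hCF.ne'] at h
  have hω := fun x y hy => h.abs_vorticity_le hT x y hy
  obtain ⟨N, hN0, hN⟩ := h.exists_coeffHolder hT
  have hL := hlip u v hflow _ hω ⟨N, hN0, hN⟩ (4 * E) (by positivity)
    (fun x τ hτ => h.integral_second_difference_le hT x hτ)
  have huy : ∀ x, ∀ y ∈ Set.Ioo (-1 : ℝ) 1, |deriv (fun y' => u x y') y - 1| ≤ 1 / 2 :=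
    fun x y hy => (h.abs_deriv_u_sub_one_le hT (by positivity) hL x hy).trans hE1
  -- Each round passes from the Hölder constant of `v` to that of the vorticity coefficients and
  -- back.
  have hiter : ∀ n : ℕ, ∀ x, ∀ y ∈ Set.Icc (-1 : ℝ) 1, ∀ y' ∈ Set.Icc (-1 : ℝ) 1,
      |v x y - v x y'| ≤ CH * N * (1 / 2) ^ n * |y - y'| ^ α := by
    intro n
    induction n with
    | zero => simpa using hhol u v hflow _ hω N hN0 hN
    | succ n ih =>
      have hM : 0 ≤ CH * N * (1 / 2) ^ n := by positivity
      have hN' := h.coeffHolder_of_holder hT h0 (by linarith) hE0 hH huy hM ih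
      intro x y hy y' hy'
      refine (hhol u v hflow _ hω _ (by positivity) hN' x y hy y' hy').trans ?_
      refine mul_le_mul_of_nonneg_right ?_ (by positivity)
      calc CH * (96 / α * (CH * N * (1 / 2) ^ n) * E)
          = CH * (96 / α * E) * (CH * N * (1 / 2) ^ n) := by ring
        _ ≤ 1 / 2 * (CH * N * (1 / 2) ^ n) := by gcongr
        _ = CH * N * (1 / 2) ^ (n + 1) := by ring
  have hv0 : ∀ x : ℝ, ∀ y ∈ Set.Icc (-1 : ℝ) 1, v x y = 0 := by
    intro x y hy
    have hlim : Filter.Tendsto (fun n : ℕ => CH * N * (1 / 2) ^ n * |y - -1| ^ α) Filter.atTop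
        (nhds (CH * N * 0 * |y - -1| ^ α)) :=
      ((tendsto_pow_atTop_nhds_zero_of_lt_one (by norm_num) (by norm_num)).const_mul _).mul_const _
    have hle := ge_of_tendsto hlim
      (Filter.Eventually.of_forall fun n => hiter n x y hy (-1) (by norm_num))
    rw [hflow.wall_bot x] at hle
    simpa using hle
  exact ⟨hv0, hflow.exists_profile hv0⟩
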